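/- **Setting.** Let $\mathcal H$ be a class of functions $\mathcal X\to\{-1,+1\}$ (satisfying the usual measurability convention: its members are measurable, and each is the pointwise limit of a sequence from a fixed countable subclass) with finite VC dimension $d$, and let $D_1,\dots,D_k$ ($k\ge1$) be probability distributions on $\mathcal X\times\{-1,+1\}$. Write $L(h,D)=\Pr_{(x,y)\sim D}[h(x)\ne y]$, $L(h)=\max_{i}L(h,D_i)$, let $h^*\in\mathcal H$ minimize $L$ over $\mathcal H$, and $\nu=L(h^*)$. The star number of $\mathcal H$ with respect to $h^*$ is the largest $m$ for which there are $x_1,\dots,x_m\in\mathcal X$ and $h_1,\dots,h_m\in\mathcal H$ with $h_i(x_i)\neq h^*(x_i)$ and $h_i(x_j)=h^*(x_j)$ for all $j\ne i$. Let $\mathfrak s\ge1$ be an integer that is at least this star number (for instance the star number itself, if it is positive). The learner may draw unlabeled examples from the marginals of the $D_i$, knows the probabilities of events under these marginals, and pays one unit for each label $y\sim D_i(\cdot\mid x)$ that it queries. $\log$ is to base 2. **Algorithm**, with input $\varepsilon,\delta\in(0,1)$ and absolute constants $c,C>0$ in its sample sizes. Let $n_0=\max\{1,\lceil\log\frac{d+k}{\mathfrak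 s\,\varepsilon}\rceil\}$, $\varepsilon_n=2^{-n}$, $\delta_n=\delta/(2n^2)$, $f_0\equiv0$. For $n=1,\dots,n_0$ and a function $f_{n-1}:\mathcal X\to\{-1,+1,0\}$ (where $0$ is an abstention), let $D_{i,n}$ be the law of $(x,y')$, where $(x,y)\sim D_i$ and $y'=y$ if $f_{n-1}(x)=0$, $y'=f_{n-1}(x)$ otherwise; a sample from $D_{i,n}$ costs one label query if $f_{n-1}(x)=0$ and none otherwise. For $n<n_0$, $f_n$ is the output of Passive-RPU-MDL on $(D_{i,n})_i$ with parameters $(\varepsilon_n,\delta_n)$. The output is $\hat h=$ Passive-MDL on $(D_{i,n_0})_i$ with parameters $(\varepsilon,\delta_{n_0})$. * *Passive-RPU-MDL* on $(\mu_i)_i$ with $(\xi,\delta')$: start from $N_1=[k]$; while $N_r\ne\emptyset$, run Robust-RPU-Learn with parameters $(\xi/2,\ \delta'/(2r^2))$ on the uniform mixture of $(\mu_i)_{i\in N_r}$ to get $f^r$, and let $N_{r+1}=N_r\setminus\{i:\Pr_{\mu_i}[f^r(x)=0]\le\xi\}$. Return the function that predicts as the first $f^r$ not abstaining on $x$, and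 abstains if all do. * *Robust-RPU-Learn* on $\mu$ with $(\xi,\delta')$: draw $N=60\lceil\ln\frac1{\delta'}\rceil$ independent batches of $\lceil c\,\mathfrak s/\xi\rceil$ i.i.d. examples from $\mu$. For batch $b$ let $V_b$ be the set of $h\in\mathcal H$ consistent with it, and let $f_b(x)$ be the common prediction of $V_b$ at $x$ if $V_b\neq\emptyset$ and all its members agree on $x$, and $f_b(x)=0$ otherwise. Return the function that is $0$ at $x$ if $\sum_b I(f_b(x)\ne0)\le N/5$, and $\operatorname{sign}(\sum_b f_b(x))$ otherwise. * *Passive-MDL* on $(\mu_i)_i$ with $(\zeta,\delta')$ (the collaborative learner of Blum, Haghtalab, Procaccia and Qiao): let $t=\max\{1,5\lceil\log k\rceil\}$ and $w_i=1$ for all $i$. In each of $t$ rounds, let $h_r$ be an empirical risk minimizer over $\mathcal H$ on $\lceil C(d(1+\ln\frac1\zeta)+\ln\frac t{\delta'})/\zeta\rceil$ fresh examples from $\sum_i w_i\mu_i/\sum_i w_i$; then, for each $i$, draw $\lceil C\ln\frac{kt}{\delta'}/\zeta\rceil$ fresh examples from $\mu_i$ and double $w_i$ unless the empirical error of $h_r$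 on them is at most $\frac34\cdot\frac\zeta6$. Return the majority vote of $h_1,\dots,h_t$. **Theorem.** There are absolute constants $c,C,K>0$ and $p\in\mathbb N$ such that, for every choice of the above with $\varepsilon,\delta\in(0,1)$ and $\varepsilon\ge100(k+d)\nu$ and every (measurable) tie-breaking in the empirical risk minimization, with probability at least $1-\delta$ the algorithm terminates, and 1. its output satisfies $L(\hat h)\le\nu+\varepsilon$; 2. the number of its label queries is $\widetilde O\big(\mathfrak s\ln\frac1\varepsilon\big)$, namely at most $$K\,\mathfrak s\Big(1+\ln\frac1\varepsilon\Big)\Big(1+\ln k+\ln\frac1\delta+\ln\big(1+\ln\tfrac1\varepsilon\big)\Big)^{p}.$$ -/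

import Mathlib

open MeasureTheory Filter

noncomputable section

namespace ActiveMDL

open scoped Classical in
section

/-! Labels `-1, +1` are `false, true : Bool`. A classifier that may abstain (with values in
`{-1, +1, 0}`) is a map into `Option Bool`, where `none` is the abstention `0`. -/

/-! ### Errors, VC dimension, star number -/

/-- The 0-1 error `L(h, D) = Pr_{(x, y) ∼ D}[h(x) ≠ y]`. -/
def err {X : Type*} [MeasurableSpace X] (D : Measure (X × Bool)) (h : X → Bool) : ℝ :=
  D.real {z | h z.1 ≠ z.2}

/-- The multi-distribution error `L(h) = max_i L(h, D_i)`. -/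
def mdErr {X : Type*} [MeasurableSpace X] {k : ℕ} (D : Fin k → Measure (X × Bool))
    (h : X → Bool) : ℝ :=
  ⨆ i, err (D i) h

/-- `H` realizes every labelling of the finite set `T`. -/
def Shatters {X : Type*} (H : Set (X → Bool)) (T : Finset X) : Prop :=
  ∀ g : X → Bool, ∃ h ∈ H, ∀ x ∈ T, h x = g x

/-- The Vapnik–Chervonenkis dimension. -/
def vcDim {X : Type*} (H : Set (X → Bool)) : ℕ∞ :=
  ⨆ (T : Finset X) (_ : Shatters H T), (T.card : ℕ∞)

/-- The points `x_j` together with witnesses `h_j ∈ H` form a star around `h₀`. -/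
def IsStar {X : Type*} (H : Set (X → Bool)) (h₀ : X → Bool) {m : ℕ} (x : Fin m → X) : Prop :=
  ∃ h : Fin m → X → Bool, ∀ i, h i ∈ H ∧ h i (x i) ≠ h₀ (x i) ∧
    ∀ j, j ≠ i → h i (x j) = h₀ (x j)

/-- The star number of `H` with respect to the reference hypothesis `h₀`. -/
def starNumber {X : Type*} (H : Set (X → Bool)) (h₀ : X → Bool) : ℕ∞ :=
  ⨆ (m : ℕ) (_ : ∃ x : Fin m → X, IsStar H h₀ x), (m : ℕ∞)

/-- The usual measurability convention for hypothesis classes: the hypotheses are measurable, and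
every one of them is the pointwise limit of a sequence from a fixed countable subclass. -/
def PointwiseMeasurable {X : Type*} [MeasurableSpace X] (H : Set (X → Bool)) : Prop :=
  (∀ h ∈ H, Measurable h) ∧
  ∃ H₀ ⊆ H, H₀.Countable ∧
    ∀ h ∈ H, ∃ u : ℕ → X → Bool, (∀ n, u n ∈ H₀) ∧ ∀ x, ∀ᶠ n in atTop, u n x = h x

/-- The number of mistakes of `h` on the first `m` examples of `S`. -/
def mistakes {X : Type*} (m : ℕ) (S : Fin m → X × Bool) (h : X → Bool) : ℕ :=
  (Finset.univ.filter fun j => h (S j).1 ≠ (S j).2).card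

/-- `erm` is an empirical risk minimization oracle for `H`: on each finite labelled sample it
returns a hypothesis in `H` with the fewest mistakes (ties are broken in any measurable way). -/
structure IsERM {X : Type*} [MeasurableSpace X] (H : Set (X → Bool))
    (erm : (m : ℕ) → (Fin m → X × Bool) → X → Bool) : Prop where
  mem : ∀ m S, erm m S ∈ H
  le : ∀ m S, ∀ h ∈ H, mistakes m S (erm m S) ≤ mistakes m S h
  measurable : ∀ m, Measurable fun p : (Fin m → X × Bool) × X => erm m p.1 p.2

/-! ### Randomness and sampling

A call to a sampling oracle consumes one fresh seed: a uniform number in `[0, 1]`, used for picking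
an index `i`, and independent examples `(x, y) ∼ D_i`, one for each `i`, of which only the one with
the picked index is looked at. Its label `y` is revealed only if the algorithm pays for it. As every
drawn point is queried at most once, this has the law of drawing `x` from the example oracle `EX_i`
and passing it to the labeling oracle `O_i` on demand. -/

/-- The randomness behind one labelled example. -/
abbrev Seed (X : Type*) (k : ℕ) := unitInterval × (Fin k → X × Bool)

/-- The law of a seed. -/
def seedMeasure {X : Type*} [MeasurableSpace X] {k : ℕ} (D : Fin k → Measure (X × Bool)) :
    Measure (Seed X k) :=
  (volume : Measure unitInterval).prod (Measure.pi D)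

/-- `pick w u`, for `u` uniform in `[0, 1]`, is an index with law `w i / ∑ j, w j`: it is the
least `i` such that `u * ∑ j, w j < ∑ j ≤ i, w j`. -/
def pick {k : ℕ} [NeZero k] (w : Fin k → ℕ) (u : unitInterval) : Fin k :=
  if h : (Finset.univ.filter fun i : Fin k =>
      (u : ℝ) * ∑ j, (w j : ℝ) < ∑ j ∈ Finset.Iic i, (w j : ℝ)).Nonempty
  then Finset.min' _ h else 0

/-- The example after imputation: where `f` predicts, its prediction replaces the label `y`.
If `(x, y) ∼ D_i`, then `impute f (x, y)` has the law
`D_i(x, y) I(f(x) = 0) + D_i(x) I(y = f(x)) I(f(x) ≠ 0)`. -/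
def impute {X : Type*} (f : X → Option Bool) (z : X × Bool) : X × Bool :=
  (z.1, (f z.1).getD z.2)

/-- The number of label queries made by `impute f`: one if `f` abstains, otherwise none. -/
def cost {X : Type*} (f : X → Option Bool) (z : X × Bool) : ℕ :=
  if f z.1 = none then 1 else 0

/-- The example selected by a seed when sampling from the mixture of the `D_i` with weights
proportional to `w`. -/
def mix {X : Type*} {k : ℕ} [NeZero k] (w : Fin k → ℕ) (σ : Seed X k) : X × Bool :=
  σ.2 (pick w σ.1)

/-! ### Learning reliable classifiers from a single distribution -/

/-- The hypotheses of `H` consistent with the first `n` examples of `S`. -/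
def versionSpace {X : Type*} (H : Set (X → Bool)) (n : ℕ) (S : ℕ → X × Bool) : Set (X → Bool) :=
  {h ∈ H | ∀ j < n, h (S j).1 = (S j).2}

/-- The disagreement region of a set of hypotheses. -/
def dis {X : Type*} (V : Set (X → Bool)) : Set X :=
  {x | ∃ h₁ ∈ V, ∃ h₂ ∈ V, h₁ x ≠ h₂ x}

/-- Predict the unanimous label of `V` outside its disagreement region, abstain inside it;
abstain everywhere if `V` is empty. -/
def unanimous {X : Type*} (V : Set (X → Bool)) (x : X) : Option Bool :=
  if h : V.Nonempty then (if x ∈ dis V then none else some (h.some x)) else none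

/-- The thresholded majority vote of `N` abstaining classifiers: abstain if at most `N / 5` of them
predict, and return the sign of the sum of their predictions otherwise. -/
def thresholdVote {X : Type*} (N : ℕ) (f : ℕ → X → Option Bool) (x : X) : Option Bool :=
  let pos := ((Finset.range N).filter fun b => f b x = some true).card
  let neg := ((Finset.range N).filter fun b => f b x = some false).card
  if 5 * (pos + neg) ≤ N then none
  else if neg < pos then some true
  else if pos < neg then some false
  else none

/-- The number `60 ⌈ln(1/δ)⌉` of batches. -/
def batches (δ : ℝ) : ℕ := 60 * ⌈Real.log (1 / δ)⌉₊

/-- The size `⌈c s / ξ⌉` of a batch. -/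
def batchSize (c : ℝ) (s : ℕ) (ξ : ℝ) : ℕ := ⌈c * s / ξ⌉₊

/-- Robust-RPU-Learn with target `ξ` and confidence `δ`; `S b j` is the `j`-th example of the
`b`-th batch. -/
def robustRPULearn {X : Type*} (H : Set (X → Bool)) (c : ℝ) (s : ℕ) (ξ δ : ℝ)
    (S : ℕ → ℕ → X × Bool) : X → Option Bool :=
  thresholdVote (batches δ) fun b => unanimous (versionSpace H (batchSize c s ξ) (S b))

/-! ### The data of a run -/

/-- Everything that a run of the algorithm depends on, besides its seeds: the class `H`, an ERM
oracle for it, the distributions (used through their marginals on `X`, and through seeds), the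
numbers `s` and `d`, the target error `ε`, the failure probability `δ`, and the two absolute
constants `c` and `C` in the sample sizes. -/
structure Setup (X : Type*) [MeasurableSpace X] (k : ℕ) where
  H : Set (X → Bool)
  erm : (m : ℕ) → (Fin m → X × Bool) → X → Bool
  D : Fin k → Measure (X × Bool)
  s : ℕ
  d : ℕ
  ε : ℝ
  δ : ℝ
  c : ℝ
  C : ℝ

namespace Setup

variable {X : Type*} [MeasurableSpace X] {k : ℕ} [NeZero k] (A : Setup X k)

/-! ### Passive-RPU-MDL

Below, `f` is the abstaining classifier used for imputation, so that the `i`-th distribution passed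
to the procedure is the law of `impute f` under `D_i`; `ξ` and `δ` are the target reliability
and the confidence; `σ r b j` is the seed of the `j`-th example in the `b`-th batch of round `r`,
and rounds are numbered from `0`. -/

/-- The output of Robust-RPU-Learn in round `r`, on the uniform mixture over the set `N`. -/
def roundRPU (f : X → Option Bool) (ξ δ : ℝ) (σ : ℕ → ℕ → ℕ → Seed X k) (r : ℕ)
    (N : Finset (Fin k)) : X → Option Bool :=
  robustRPULearn A.H A.c A.s (ξ / 2) (δ / (2 * ((r : ℝ) + 1) ^ 2)) fun b j =>
    impute f (mix (fun i => if i ∈ N then 1 else 0) (σ r b j))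

/-- The set of distributions still active at the start of round `r`: after each round those on
which the classifier of that round abstains with probability at most `ξ` are removed. -/
def active (f : X → Option Bool) (ξ δ : ℝ) (σ : ℕ → ℕ → ℕ → Seed X k) : ℕ → Finset (Fin k)
  | 0 => Finset.univ
  | r + 1 => (active f ξ δ σ r).filter fun i =>
      ¬ (A.D i).fst {x | A.roundRPU f ξ δ σ r (active f ξ δ σ r) x = none} ≤ ENNReal.ofReal ξ

/-- The while loop ends. -/
def Halts (f : X → Option Bool) (ξ δ : ℝ) (σ : ℕ → ℕ → ℕ → Seed X k) : Prop :=
  ∃ r, A.active f ξ δ σ r = ∅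

/-- The number of rounds of the while loop, if it ends. -/
def rounds (f : X → Option Bool) (ξ δ : ℝ) (σ : ℕ → ℕ → ℕ → Seed X k) : ℕ :=
  sInf {r | A.active f ξ δ σ r = ∅}

/-- The output: the prediction of the first round that predicts, abstaining if none does. -/
def passiveRPU (f : X → Option Bool) (ξ δ : ℝ) (σ : ℕ → ℕ → ℕ → Seed X k) (x : X) :
    Option Bool :=
  let out : ℕ → Option Bool := fun r => A.roundRPU f ξ δ σ r (A.active f ξ δ σ r) x
  if ∃ r < A.rounds f ξ δ σ, out r ≠ none
  then out (sInf {r | r < A.rounds f ξ δ σ ∧ out r ≠ none}) else none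

/-- The number of label queries. -/
def labelsRPU (f : X → Option Bool) (ξ δ : ℝ) (σ : ℕ → ℕ → ℕ → Seed X k) : ℕ :=
  ∑ r ∈ Finset.range (A.rounds f ξ δ σ),
    ∑ b ∈ Finset.range (batches (δ / (2 * ((r : ℝ) + 1) ^ 2))),
      ∑ j ∈ Finset.range (batchSize A.c A.s (ξ / 2)),
        cost f (mix (fun i => if i ∈ A.active f ξ δ σ r then 1 else 0) (σ r b j))

/-! ### Passive-MDL

The collaborative learner by multiplicative weights: in each round an empirical risk minimizer is
learned on the current mixture and tested on every distribution, and the weight of each distribution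
on which it fails the test is doubled. The output is the majority vote. Here `f` is as above, `ζ` is
the target error, `δ` the confidence, `τ r j` the seed of the `j`-th training example of round `r`,
and `θ r i j` that of the `j`-th test example from the `i`-th distribution in round `r`. -/

/-- The number of rounds, `5 ⌈log₂ k⌉` (and one round if `k = 1`). -/
def mdlRounds (k : ℕ) : ℕ := max 1 (5 * ⌈Real.logb 2 k⌉₊)

/-- The number of training examples in a round. -/
def trainSize (ζ δ : ℝ) : ℕ :=
  ⌈A.C * (A.d * (1 + Real.log (1 / ζ)) + Real.log (mdlRounds k / δ)) / ζ⌉₊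

/-- The number of test examples from each distribution in a round. -/
def testSize (ζ δ : ℝ) : ℕ :=
  ⌈A.C * Real.log (k * mdlRounds k / δ) / ζ⌉₊

/-- The hypothesis learned in round `r` under the weights `w`. -/
def mdlHyp (f : X → Option Bool) (ζ δ : ℝ) (τ : ℕ → ℕ → Seed X k) (r : ℕ)
    (w : Fin k → ℕ) : X → Bool :=
  A.erm (A.trainSize ζ δ) fun j => impute f (mix w (τ r j))

/-- `h` passes the test on the `i`-th distribution: its empirical error is at most `(3/4)(ζ/6)`. -/
def PassesTest (f : X → Option Bool) (ζ δ : ℝ) (θ : Fin k → ℕ → Seed X k) (i : Fin k)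
    (h : X → Bool) : Prop :=
  (mistakes (A.testSize ζ δ) (fun j => impute f ((θ i j).2 i)) h : ℝ)
    ≤ 3 / 4 * (ζ / 6) * A.testSize ζ δ

/-- The weights at the start of round `r`. -/
def weights (f : X → Option Bool) (ζ δ : ℝ) (τ : ℕ → ℕ → Seed X k)
    (θ : ℕ → Fin k → ℕ → Seed X k) : ℕ → Fin k → ℕ
  | 0 => fun _ => 1
  | r + 1 => fun i =>
      if A.PassesTest f ζ δ (θ r) i (A.mdlHyp f ζ δ τ r (weights f ζ δ τ θ r))
      then weights f ζ δ τ θ r i else 2 * weights f ζ δ τ θ r i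

/-- The output: the majority vote of the hypotheses of all rounds. -/
def passiveMDL (f : X → Option Bool) (ζ δ : ℝ) (τ : ℕ → ℕ → Seed X k)
    (θ : ℕ → Fin k → ℕ → Seed X k) (x : X) : Bool :=
  decide (mdlRounds k < 2 * ((Finset.range (mdlRounds k)).filter fun r =>
    A.mdlHyp f ζ δ τ r (A.weights f ζ δ τ θ r) x = true).card)

/-- The number of label queries. -/
def labelsMDL (f : X → Option Bool) (ζ δ : ℝ) (τ : ℕ → ℕ → Seed X k)
    (θ : ℕ → Fin k → ℕ → Seed X k) : ℕ :=
  ∑ r ∈ Finset.range (mdlRounds k),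
    (∑ j ∈ Finset.range (A.trainSize ζ δ), cost f (mix (A.weights f ζ δ τ θ r) (τ r j))
      + ∑ i, ∑ j ∈ Finset.range (A.testSize ζ δ), cost f ((θ r i j).2 i))

end Setup

/-! ### The active learner -/

/-- Names of all the seeds that a run may consume: `rpu n r b j` for the `j`-th example in batch `b`
of round `r` of Passive-RPU-MDL in epoch `n`, and `train r j`, `test r i j` for the training and
test examples of the final call to Passive-MDL. -/
inductive Slot (k : ℕ) : Type
  | rpu (n r b j : ℕ)
  | train (r j : ℕ)
  | test (r : ℕ) (i : Fin k) (j : ℕ)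

/-- All the randomness of a run. -/
abbrev Tape (X : Type*) (k : ℕ) := Slot k → Seed X k

/-- The law of the tape: independent seeds. -/
def tapeMeasure {X : Type*} [MeasurableSpace X] {k : ℕ} (D : Fin k → Measure (X × Bool))
    [∀ i, IsProbabilityMeasure (D i)] : Measure (Tape X k) :=
  haveI : IsProbabilityMeasure (seedMeasure D) := by unfold seedMeasure; infer_instance
  Measure.infinitePi fun _ : Slot k => seedMeasure D

namespace Setup

variable {X : Type*} [MeasurableSpace X] {k : ℕ} [NeZero k] (A : Setup X k)

/-- The number `n₀ = ⌈log₂((d + k) / (s ε))⌉` of epochs, but at least one. -/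
def epochs : ℕ := max 1 ⌈Real.logb 2 (((A.d : ℝ) + k) / (A.s * A.ε))⌉₊

/-- `ε_n = 2^{-n}`. -/
def epsAt (n : ℕ) : ℝ := (1 / 2) ^ n

/-- `δ_n = δ / (2 n²)`. -/
def deltaAt (n : ℕ) : ℝ := A.δ / (2 * (n : ℝ) ^ 2)

/-- The seeds of Passive-RPU-MDL in epoch `n`. -/
def seedsAt (ω : Tape X k) (n : ℕ) : ℕ → ℕ → ℕ → Seed X k := fun r b j => ω (Slot.rpu n r b j)

/-- The classifiers `f_n`: `f_0` always abstains, and `f_n` is the output of Passive-RPU-MDL on the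
distributions `D_{i, n}` obtained by imputing labels with `f_{n-1}`. -/
def rpuAt (ω : Tape X k) : ℕ → X → Option Bool
  | 0 => fun _ => none
  | n + 1 => A.passiveRPU (rpuAt ω n) (epsAt (n + 1)) (A.deltaAt (n + 1)) (seedsAt ω (n + 1))

/-- The run terminates: the while loops in the epochs `1, …, n₀ - 1` all end. -/
def Terminates (ω : Tape X k) : Prop :=
  ∀ n, n + 1 < A.epochs →
    A.Halts (A.rpuAt ω n) (epsAt (n + 1)) (A.deltaAt (n + 1)) (seedsAt ω (n + 1))

/-- The output `ĥ`: Passive-MDL in epoch `n₀`, on the distributions `D_{i, n₀}`, with target error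
`ε` and confidence `δ_{n₀}`. -/
def output (ω : Tape X k) : X → Bool :=
  A.passiveMDL (A.rpuAt ω (A.epochs - 1)) A.ε (A.deltaAt A.epochs)
    (fun r j => ω (Slot.train r j)) (fun r i j => ω (Slot.test r i j))

/-- The total number of label queries of a terminating run. -/
def labels (ω : Tape X k) : ℕ :=
  ∑ n ∈ Finset.range (A.epochs - 1),
    A.labelsRPU (A.rpuAt ω n) (epsAt (n + 1)) (A.deltaAt (n + 1)) (seedsAt ω (n + 1))
  + A.labelsMDL (A.rpuAt ω (A.epochs - 1)) A.ε (A.deltaAt A.epochs)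
      (fun r j => ω (Slot.train r j)) (fun r i j => ω (Slot.test r i j))

end Setup

end

end ActiveMDL

end

/-!
With probability close to one all abstaining classifiers of the run are *reliable*: where they
predict, they predict as `hstar`. Imputing labels with a reliable classifier replaces some labels
by those of `hstar`, so that on the imputed distributions the error of `hstar` is at most its
original error `ν`, and an error measured on them is off by at most `ν`.

*Robust-RPU-Learn.* A batch on which `hstar` makes no mistake has a version space that contains
`hstar`, so it votes for the label given by `hstar` or abstains. The noise is so small compared to
the size of a batch that, except with exponentially small probability, at most a tenth of the
batches contain a mistake of `hstar`; then the vote is reliable (`thresholdVote_spec`). Leaving out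
one of `m + 1` examples shows that a clean batch of size `m` leaves the label of a random point
undetermined with probability at most `s / (m + 1)`, since the points left undetermined by the
others form a star (`lintegral_uncertain_le`). So the vote abstains rarely on the mixture
(`robust_tail`).

*Passive-RPU-MDL.* If the classifier of a round abstains with probability at most `9 ξ / 10` on the
uniform mixture of the active distributions, then at most `9 / 10` of them remain active
(`card_actAt_succ_le`), and the loop ends after `O(log k)` rounds. As the classifier `f_{n-1}`
abstains with probability at most `2 ε_n`, and a batch has `O(s / ε_n)` examples, an epoch costs
only `O(s)` labels up to logarithms (`badRoundLabels_le`). There are `O(log (k / ε))` epochs,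
because `d ≤ s` (`vcDim_le_of_starNumber_le`).

*Passive-MDL.* A relative deviation bound for empirical risk minimization (`erm_tail`, by a ghost
sample and random swaps) makes the error of the hypothesis of each round small on the current
mixture, so that the distributions that fail the test carry at most an eleventh of the weight. As
the weight of a distribution is `2` to the number of its failures, no distribution fails in more
than a third of the rounds (`card_fails_le`), and the majority vote is accurate on all of them
(`measureReal_majority_le`). By the choice of the number of epochs, `f_{n₀-1}` abstains with
probability at most `2 s ε / (d + k)`, which reduces the `O((d + k) / ε)` examples to `O(s)` labels
up to logarithms.

*Adaptivity.* The tape is a product measure, and what a stage does depends on the past only through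
slots that the stage does not read. Hence the probability of each failure event can be bounded with
these other slots fixed (`measure_le_of_resample`). This needs the failure events to be measurable,
which rests on the countable subclass of `H` with the same traces on finite sets
(`PointwiseMeasurable.exists_countable`).
-/

open MeasureTheory Filter

noncomputable section

namespace ActiveMDL

open scoped Classical in
section

/-! ### Independent trials -/

section Product

variable {ι Z : Type*} [MeasurableSpace Z] {μ : Measure Z} [IsProbabilityMeasure μ]

/-- The number of indices in `T` at which the event `A` happens. -/
def hits (T : Finset ι) (A : ι → Set Z) (ω : ι → Z) : ℕ := (T.filter fun i => ω i ∈ A i).card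

lemma measurable_hits (T : Finset ι) {A : ι → Set Z} (hA : ∀ i, MeasurableSet (A i)) :
    Measurable (hits T A) := by
  have : hits T A = fun ω => ∑ i ∈ T, if ω i ∈ A i then 1 else 0 := by
    funext ω; simp [hits]
  rw [this]
  refine Finset.measurable_sum _ fun i _ => Measurable.ite ?_ measurable_const measurable_const
  exact measurable_pi_apply i (hA i)

/-- The moment generating function of a sum of independent Bernoulli variables. -/
lemma lintegral_pow_hits (T : Finset ι) {A : ι → Set Z} (hA : ∀ i, MeasurableSet (A i))
    {z : ℝ} (hz : 0 < z) :
    ∫⁻ ω, ENNReal.ofReal (z ^ hits T A ω) ∂(Measure.infinitePi fun _ : ι => μ)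
      = ∏ i ∈ T, ENNReal.ofReal (1 + (z - 1) * μ.real (A i)) := by
  have hm : ∀ i, Measurable fun x : Z => if x ∈ A i then ENNReal.ofReal z else 1 := fun i =>
    Measurable.ite (hA i) measurable_const measurable_const
  have h := ProbabilityTheory.lintegral_prod_eq_prod_lintegral_of_indepFun T
    (fun (i : ι) (ω : ι → Z) => if ω i ∈ A i then ENNReal.ofReal z else 1)
    (ProbabilityTheory.iIndepFun_infinitePi (P := fun _ : ι => μ)
      (X := fun i (x : Z) => if x ∈ A i then ENNReal.ofReal z else 1) hm)
    (fun i => (hm i).comp (measurable_pi_apply i))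
  have e : ∀ ω : ι → Z, ENNReal.ofReal (z ^ hits T A ω)
      = ∏ i ∈ T, if ω i ∈ A i then ENNReal.ofReal z else 1 := by
    intro ω
    rw [Finset.prod_ite, Finset.prod_const, Finset.prod_const_one, mul_one,
      ENNReal.ofReal_pow hz.le]; rfl
  simp_rw [e, h]
  refine Finset.prod_congr rfl fun i _ => ?_
  rw [(measurePreserving_eval_infinitePi (fun _ : ι => μ) i).lintegral_comp (hm i)]
  have e2 : (fun x : Z => if x ∈ A i then ENNReal.ofReal z else 1)
      = fun x => (A i).indicator (fun _ => ENNReal.ofReal z) x + (A i)ᶜ.indicator 1 x := by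
    funext x; by_cases hx : x ∈ A i <;> simp [hx]
  rw [e2, lintegral_add_left (measurable_const.indicator (hA i)), lintegral_indicator (hA i),
    lintegral_indicator (hA i).compl]
  simp only [lintegral_const, Measure.restrict_apply, MeasurableSet.univ, Set.univ_inter,
    Pi.one_apply, one_mul]
  rw [prob_compl_eq_one_sub (hA i), ← ofReal_measureReal (μ := μ) (s := A i),
    ← ENNReal.ofReal_mul hz.le, ← ENNReal.ofReal_one,
    ← ENNReal.ofReal_sub _ measureReal_nonneg, ← ENNReal.ofReal_add (by positivity)]
  · congr 1; ring
  · have : μ.real (A i) ≤ 1 := measureReal_le_one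
    linarith

/-- A Chernoff bound, for the upper tail (`1 ≤ z`) and the lower tail (`z ≤ 1`) at once. -/
lemma chernoff (T : Finset ι) {A : ι → Set Z} (hA : ∀ i, MeasurableSet (A i))
    {z p : ℝ} (hz : 0 < z) (hp : ∀ i ∈ T, (z - 1) * μ.real (A i) ≤ (z - 1) * p) (a : ℝ) :
    (Measure.infinitePi fun _ : ι => μ) {ω | a * Real.log z ≤ hits T A ω * Real.log z}
      ≤ ENNReal.ofReal (Real.exp ((z - 1) * p * T.card - a * Real.log z)) := by
  set P := Measure.infinitePi fun _ : ι => μ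
  have hM : Measurable fun ω : ι → Z => ENNReal.ofReal (z ^ hits T A ω) :=
    (measurable_from_top (f := fun n : ℕ => ENNReal.ofReal (z ^ n))).comp (measurable_hits T hA)
  have h1 : {ω | a * Real.log z ≤ hits T A ω * Real.log z}
      ⊆ {ω | ENNReal.ofReal (Real.exp (a * Real.log z)) ≤ ENNReal.ofReal (z ^ hits T A ω)} := by
    intro ω hω
    refine ENNReal.ofReal_le_ofReal ?_
    rw [← Real.exp_log hz, ← Real.exp_nat_mul, Real.log_exp]
    exact Real.exp_le_exp.2 hω
  have h2 := mul_meas_ge_le_lintegral (μ := P) hM (ENNReal.ofReal (Real.exp (a * Real.log z)))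
  rw [lintegral_pow_hits T hA hz] at h2
  have h3 : ∏ i ∈ T, ENNReal.ofReal (1 + (z - 1) * μ.real (A i))
      ≤ ENNReal.ofReal (Real.exp ((z - 1) * p * T.card)) := by
    calc _ ≤ ∏ _i ∈ T, ENNReal.ofReal (Real.exp ((z - 1) * p)) := by
          refine Finset.prod_le_prod' fun i hi => ENNReal.ofReal_le_ofReal ?_
          have := Real.add_one_le_exp ((z - 1) * p)
          linarith [hp i hi]
      _ = _ := by
          rw [Finset.prod_const, ← ENNReal.ofReal_pow (Real.exp_pos _).le, ← Real.exp_nat_mul]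
          congr 2; ring
  have h0 : ENNReal.ofReal (Real.exp (a * Real.log z)) ≠ 0 := by
    simpa using Real.exp_pos _
  have h4 := (mul_le_mul_right (measure_mono (μ := P) h1)
    (ENNReal.ofReal (Real.exp (a * Real.log z)))).trans (h2.trans h3)
  rw [Real.exp_sub, ENNReal.ofReal_div_of_pos (Real.exp_pos _)]
  rw [ENNReal.le_div_iff_mul_le (Or.inl h0) (Or.inl ENNReal.ofReal_ne_top), mul_comm]
  exact h4

lemma chernoff_ge (T : Finset ι) {A : ι → Set Z} (hA : ∀ i, MeasurableSet (A i))
    {z p : ℝ} (hz : 1 ≤ z) (hp : ∀ i ∈ T, μ.real (A i) ≤ p) (a : ℝ) :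
    (Measure.infinitePi fun _ : ι => μ) {ω | a ≤ hits T A ω}
      ≤ ENNReal.ofReal (Real.exp ((z - 1) * p * T.card - a * Real.log z)) :=
  (measure_mono fun _ hω => mul_le_mul_of_nonneg_right hω (Real.log_nonneg hz)).trans
    (chernoff T hA (by linarith)
      (fun i hi => mul_le_mul_of_nonneg_left (hp i hi) (by linarith)) a)

lemma chernoff_le (T : Finset ι) {A : ι → Set Z} (hA : ∀ i, MeasurableSet (A i))
    {z p : ℝ} (hz0 : 0 < z) (hz : z ≤ 1) (hp : ∀ i ∈ T, p ≤ μ.real (A i)) (a : ℝ) :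
    (Measure.infinitePi fun _ : ι => μ) {ω | (hits T A ω : ℝ) ≤ a}
      ≤ ENNReal.ofReal (Real.exp ((z - 1) * p * T.card - a * Real.log z)) :=
  (measure_mono fun _ hω => mul_le_mul_of_nonpos_right hω (Real.log_nonpos hz0.le hz)).trans
    (chernoff T hA hz0
      (fun i hi => mul_le_mul_of_nonpos_left (hp i hi) (by linarith)) a)

/-- If the expected number of hits is at most `B`, there are `3 B` hits with probability at most
`exp (-B)`. -/
lemma hits_tail (T : Finset ι) {A : ι → Set Z} (hA : ∀ i, MeasurableSet (A i))
    {p B : ℝ} (hp : ∀ i ∈ T, μ.real (A i) ≤ p) (hB : p * T.card ≤ B) (hB0 : 0 ≤ B) :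
    (Measure.infinitePi fun _ : ι => μ) {ω | 3 * B ≤ hits T A ω}
      ≤ ENNReal.ofReal (Real.exp (-B)) := by
  refine (chernoff_ge T hA (z := 2) (by norm_num) hp _).trans (ENNReal.ofReal_le_ofReal ?_)
  refine Real.exp_le_exp.2 ?_
  have := Real.log_two_gt_d9
  nlinarith

/-! ### Resampling a set of coordinates -/

/-- Replace the coordinates of `ω` in `I` by those of `ω'`. -/
def merge (I : Set ι) (ω ω' : ι → Z) : ι → Z := fun i => if i ∈ I then ω' i else ω i

omit [MeasurableSpace Z] in
lemma merge_of_mem {I : Set ι} {i : ι} (h : i ∈ I) (ω ω' : ι → Z) : merge I ω ω' i = ω' i :=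
  if_pos h

omit [MeasurableSpace Z] in
lemma merge_of_notMem {I : Set ι} {i : ι} (h : i ∉ I) (ω ω' : ι → Z) : merge I ω ω' i = ω i :=
  if_neg h

lemma measurable_merge (I : Set ι) :
    Measurable fun q : (ι → Z) × (ι → Z) => merge I q.1 q.2 := by
  refine measurable_pi_lambda _ fun i => ?_
  by_cases h : i ∈ I
  · simp only [merge, h, if_true]; fun_prop
  · simp only [merge, h, if_false]; fun_prop

/-- Replacing some coordinates by independent copies does not change the law. -/
lemma map_merge (I : Set ι) :
    ((Measure.infinitePi fun _ : ι => μ).prod (Measure.infinitePi fun _ : ι => μ)).map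
      (fun q => merge I q.1 q.2) = Measure.infinitePi fun _ : ι => μ := by
  refine Measure.eq_infinitePi _ fun s t ht => ?_
  rw [Measure.map_apply (measurable_merge I) (.pi s.countable_toSet fun _ _ => ht _)]
  have : (fun q : (ι → Z) × (ι → Z) => merge I q.1 q.2) ⁻¹' ((s : Set ι).pi t)
      = (((s.filter fun i => i ∉ I : Finset ι) : Set ι).pi t)
        ×ˢ (((s.filter fun i => i ∈ I : Finset ι) : Set ι).pi t) := by
    ext q
    simp only [Set.mem_preimage, Set.mem_pi, Finset.mem_coe, Set.mem_prod, Finset.mem_filter, merge]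
    constructor
    · intro h
      exact ⟨fun i hi => by simpa [hi.2] using h i hi.1, fun i hi => by simpa [hi.2] using h i hi.1⟩
    · rintro ⟨h1, h2⟩ i hi
      by_cases hI : i ∈ I
      · simpa [hI] using h2 i ⟨hi, hI⟩
      · simpa [hI] using h1 i ⟨hi, hI⟩
  rw [this, Measure.prod_prod, Measure.infinitePi_pi _ (fun i _ => ht i),
    Measure.infinitePi_pi _ (fun i _ => ht i), mul_comm, Finset.prod_filter_mul_prod_filter_not]

/-- To bound the probability of an event it suffices to bound it conditionally on the coordinates
outside `I`. -/
lemma measure_le_of_resample (I : Set ι) {E : Set (ι → Z)} (hE : MeasurableSet E) {b : ENNReal}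
    (h : ∀ ω, (Measure.infinitePi fun _ : ι => μ) {ω' | merge I ω ω' ∈ E} ≤ b) :
    (Measure.infinitePi fun _ : ι => μ) E ≤ b := by
  rw [← map_merge (μ := μ) I, Measure.map_apply (measurable_merge I) hE,
    Measure.prod_apply (measurable_merge I hE)]
  calc _ ≤ ∫⁻ _, b ∂(Measure.infinitePi fun _ : ι => μ) := lintegral_mono fun ω => h ω
    _ = b := by simp

end Product

/-! ### Uniform convergence for VC classes -/

lemma mistakes_eq_hits {X : Type*} (m : ℕ) (S : Fin m → X × Bool) (h : X → Bool) :
    mistakes m S h = hits Finset.univ (fun _ => {z : X × Bool | h z.1 ≠ z.2}) S := by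
  simp only [mistakes, hits]
  congr

section VC

variable {X : Type*} {H : Set (X → Bool)}

lemma card_le_of_shatters {d : ℕ} (hd : vcDim H = d) {T : Finset X} (hT : Shatters H T) :
    T.card ≤ d := by
  have : (T.card : ℕ∞) ≤ vcDim H := le_iSup₂_of_le T hT le_rfl
  rw [hd] at this
  exact_mod_cast this

/-- A form of the Sauer–Shelah bound on the number of traces of a class of VC dimension `d`, with a
free parameter `z` instead of the optimal one. -/
lemma card_traces_le {d : ℕ} (hd : vcDim H = d) {J : Type*} [Fintype J] (y : J → X) {z : ℝ}
    (hz : 0 < z) (hz1 : z ≤ 1) :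
    ((Finset.univ.filter fun A : Finset J => ∃ h ∈ H, ∀ j, j ∈ A ↔ h (y j) = true).card : ℝ)
      ≤ z⁻¹ ^ d * (1 + z) ^ Fintype.card J := by
  set 𝒜 := Finset.univ.filter fun A : Finset J => ∃ h ∈ H, ∀ j, j ∈ A ↔ h (y j) = true
  have key : ∀ s ∈ 𝒜.shatterer, s.card ≤ d := by
    intro s hs
    rw [Finset.mem_shatterer] at hs
    have hinj : Set.InjOn y s := by
      intro i hi j hj hij
      by_contra hne
      obtain ⟨A, hA, hsA⟩ := hs (Finset.singleton_subset_iff.2 hi)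
      obtain ⟨h, -, hh⟩ := (Finset.mem_filter.1 hA).2
      have h1 : i ∈ A := (Finset.mem_inter.1 (hsA ▸ Finset.mem_singleton_self i)).2
      have h2 : j ∉ A := fun hjA => hne (Finset.mem_singleton.1
        (hsA ▸ Finset.mem_inter.2 ⟨hj, hjA⟩)).symm
      rw [hh] at h1 h2
      exact h2 (hij ▸ h1)
    rw [← Finset.card_image_of_injOn hinj]
    refine card_le_of_shatters hd fun g => ?_
    obtain ⟨A, hA, hsA⟩ := hs (Finset.filter_subset (fun j => g (y j) = true) s)
    obtain ⟨h, hH, hh⟩ := (Finset.mem_filter.1 hA).2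
    refine ⟨h, hH, fun x hx => ?_⟩
    obtain ⟨j, hj, rfl⟩ := Finset.mem_image.1 hx
    have : j ∈ s ∩ A ↔ j ∈ s.filter fun j => g (y j) = true := by rw [hsA]
    simp only [Finset.mem_inter, hj, true_and, Finset.mem_filter, hh] at this
    exact Bool.eq_iff_iff.2 this
  calc (𝒜.card : ℝ) ≤ 𝒜.shatterer.card := by exact_mod_cast 𝒜.card_le_card_shatterer
    _ = ∑ s ∈ 𝒜.shatterer, (1 : ℝ) := by simp
    _ ≤ ∑ s ∈ 𝒜.shatterer, z⁻¹ ^ d * z ^ s.card := by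
        refine Finset.sum_le_sum fun s hs => ?_
        rw [inv_pow, inv_mul_eq_div, one_le_div (by positivity)]
        exact pow_le_pow_of_le_one hz.le hz1 (key s hs)
    _ ≤ ∑ s : Finset J, z⁻¹ ^ d * z ^ s.card :=
        Finset.sum_le_sum_of_subset_of_nonneg (Finset.subset_univ _) fun _ _ _ => by positivity
    _ = z⁻¹ ^ d * (1 + z) ^ Fintype.card J := by
        rw [← Finset.mul_sum]
        congr 1
        have := Finset.sum_pow_mul_eq_add_pow z 1 (Finset.univ : Finset J)
        simpa [add_comm] using this

lemma card_filter_mul_le {S : Type*} [Fintype S] {f : S → ℝ} (p : S → Prop) [DecidablePred p]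
    {c : ℝ} (hf : ∀ s, 0 ≤ f s) (h : ∀ s, p s → c ≤ f s) :
    ((Finset.univ.filter p).card : ℝ) * c ≤ ∑ s, f s := by
  rw [← nsmul_eq_mul]
  exact (Finset.card_nsmul_le_sum _ f c fun s hs => h s (Finset.mem_filter.1 hs).2).trans
    (Finset.sum_le_sum_of_subset_of_nonneg (Finset.subset_univ _) fun s _ _ => hf s)

/-- Swapping independent fair pairs: for a fixed pattern of mistakes on `m` pairs of examples, few
of the `2 ^ m` ways to order the pairs put few mistakes in first and many in second place. With
`ψ = 1.1`, the moment `ψ ^ (2 q - 3 p)` of a pair with `p` mistakes in first and `q` in second place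
has mean at most one over the two orders, because `(ψ ^ 2 + ψ ^ (-3)) / 2 ≤ 1`. -/
lemma card_swaps_le {m : ℕ} (e : Bool → Fin m → Bool) {a b : ℝ} :
    ((Finset.univ.filter fun σ : Fin m → Bool =>
        ((Finset.univ.filter fun j => e (σ j) j = true).card : ℝ) ≤ a ∧
        b ≤ ((Finset.univ.filter fun j => e (!σ j) j = true).card : ℝ)).card : ℝ)
      ≤ 2 ^ m * Real.exp (-(2 * b - 3 * a) * Real.log 1.1) := by
  set l := Real.log 1.1
  have hl : 0 ≤ l := Real.log_nonneg (by norm_num)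
  -- `g j s` is the moment of the `j`-th pair in the order `s`
  let w : Bool → ℝ := fun q => if q = true then 1 else 0
  let g : Fin m → Bool → ℝ := fun j s => Real.exp ((2 * w (e (!s) j) - 3 * w (e s j)) * l)
  have hg : ∀ j, g j true + g j false ≤ 2 := by
    have e1 : Real.exp l = 1.1 := Real.exp_log (by norm_num)
    have e2 : Real.exp (2 * l) = 1.1 ^ 2 := by rw [← e1, ← Real.exp_nat_mul]; norm_num
    have e3 : Real.exp (-3 * l) = (1.1 ^ 3)⁻¹ := by
      rw [← e1, ← Real.exp_nat_mul, ← Real.exp_neg]; norm_num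
    have e4 : Real.exp (-l) = (1.1)⁻¹ := by rw [← e1, ← Real.exp_neg]
    intro j
    rcases h1 : e true j <;> rcases h2 : e false j <;>
      simp only [g, w, h1, h2, if_true, if_false, Bool.not_true, Bool.not_false,
        Bool.false_eq_true] <;> norm_num
    · rw [show -(3 * l) = -3 * l by ring, e2, e3]; norm_num
    · rw [show -(3 * l) = -3 * l by ring, e2, e3]; norm_num
    · rw [e4]; norm_num
  have hsum : ∑ σ : Fin m → Bool, ∏ j, g j (σ j) ≤ 2 ^ m := by
    have := Finset.prod_univ_sum (fun _ : Fin m => (Finset.univ : Finset Bool)) g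
    rw [Fintype.piFinset_univ] at this
    rw [← this]
    calc _ ≤ ∏ _j : Fin m, (2 : ℝ) := Finset.prod_le_prod
          (fun j _ => Finset.sum_nonneg fun s _ => (Real.exp_pos _).le)
          (fun j _ => by rw [Fintype.sum_bool]; exact hg j)
      _ = 2 ^ m := by simp
  have hprod : ∀ σ : Fin m → Bool, ∏ j, g j (σ j)
      = Real.exp ((2 * (Finset.univ.filter fun j => e (!σ j) j = true).card
        - 3 * (Finset.univ.filter fun j => e (σ j) j = true).card) * l) := by
    intro σ
    rw [← Real.exp_sum, ← Finset.sum_mul, Finset.sum_sub_distrib, ← Finset.mul_sum,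
      ← Finset.mul_sum]
    simp [w]
  have hcard : ((Finset.univ.filter fun σ : Fin m → Bool =>
        ((Finset.univ.filter fun j => e (σ j) j = true).card : ℝ) ≤ a ∧
        b ≤ ((Finset.univ.filter fun j => e (!σ j) j = true).card : ℝ)).card : ℝ)
      * Real.exp ((2 * b - 3 * a) * l) ≤ 2 ^ m := by
    refine (card_filter_mul_le _ (fun σ => Finset.prod_nonneg fun j _ => (Real.exp_pos _).le)
      fun σ hσ => ?_).trans hsum
    obtain ⟨h1, h2⟩ := hσ
    rw [hprod]
    refine Real.exp_le_exp.2 (mul_le_mul_of_nonneg_right ?_ hl)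
    linarith
  rw [neg_mul, Real.exp_neg, ← div_eq_mul_inv, le_div_iff₀ (Real.exp_pos _)]
  exact hcard

end VC

section ERM

variable {X : Type*} [MeasurableSpace X] {H : Set (X → Bool)}

/-- A countable subclass with the same traces on finite sets. -/
lemma PointwiseMeasurable.exists_countable (hH : PointwiseMeasurable H) :
    ∃ H₀ ⊆ H, H₀.Countable ∧
      ∀ h ∈ H, ∀ T : Set X, T.Finite → ∃ g ∈ H₀, ∀ x ∈ T, g x = h x := by
  obtain ⟨-, H₀, hsub, hc, happ⟩ := hH
  refine ⟨H₀, hsub, hc, fun h hh T hT => ?_⟩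
  obtain ⟨u, hu, hlim⟩ := happ h hh
  obtain ⟨n, hn⟩ := ((hT.eventually_all).2 fun x _ => hlim x).exists
  exact ⟨u n, hu n, hn⟩

lemma measurableSet_wrong {h : X → Bool} (hm : Measurable h) :
    MeasurableSet {z : X × Bool | h z.1 ≠ z.2} :=
  (measurableSet_eq_fun (hm.comp measurable_fst) measurable_snd).compl

/-- The ghost sample bound: on two independent samples, seldom does any hypothesis make few
mistakes on the first one and many on the second one. -/
lemma ghost_sample (hH : PointwiseMeasurable H) {d : ℕ} (hd : vcDim H = d) (μ : Measure (X × Bool))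
    [IsProbabilityMeasure μ] (m : ℕ) {z a b : ℝ} (hz : 0 < z) (hz1 : z ≤ 1) :
    ((Measure.infinitePi fun _ : Fin m => μ).prod (Measure.infinitePi fun _ : Fin m => μ))
      {q | ∃ h ∈ H, (mistakes m q.1 h : ℝ) ≤ a ∧ b ≤ (mistakes m q.2 h : ℝ)}
      ≤ ENNReal.ofReal (z⁻¹ ^ d * (1 + z) ^ (2 * m)
          * Real.exp (-(2 * b - 3 * a) * Real.log 1.1)) := by
  set B : ℝ := z⁻¹ ^ d * (1 + z) ^ (2 * m) * Real.exp (-(2 * b - 3 * a) * Real.log 1.1)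
  set P := Measure.infinitePi fun _ : Fin m => μ
  set Q := Measure.infinitePi fun _ : Bool × Fin m => μ
  let Φ : (Bool × Fin m → X × Bool) → (Fin m → X × Bool) × (Fin m → X × Bool) :=
    fun u => (fun j => u (false, j), fun j => u (true, j))
  have hΦm : Measurable Φ := by fun_prop
  have hΦ : Q.map Φ = P.prod P := by
    rw [← Measure.infinitePi_map_eval_prod (P := fun _ : Bool => P) (i := false) (j := true)
      (by simp), ← Measure.infinitePi_map_curry (fun (_ : Bool) (_ : Fin m) => μ),
      Measure.map_map (by fun_prop) (MeasurableEquiv.measurable _)]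
    rfl
  obtain ⟨H₀, hsub, hc, happ⟩ := hH.exists_countable
  set E := {q : (Fin m → X × Bool) × (Fin m → X × Bool) |
    ∃ h ∈ H, (mistakes m q.1 h : ℝ) ≤ a ∧ b ≤ (mistakes m q.2 h : ℝ)}
  have hmist : ∀ h ∈ H, Measurable fun S : Fin m → X × Bool => (mistakes m S h : ℝ) := by
    intro h hh
    simp_rw [mistakes_eq_hits]
    exact measurable_from_top.comp
      (measurable_hits _ fun _ => measurableSet_wrong (hH.1 h hh))
  have hE : MeasurableSet E := by
    have : E = ⋃ h ∈ H₀, {q : (Fin m → X × Bool) × (Fin m → X × Bool) |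
        (mistakes m q.1 h : ℝ) ≤ a ∧ b ≤ (mistakes m q.2 h : ℝ)} := by
      ext q
      simp only [E, Set.mem_ofPred_eq, Set.mem_iUnion, exists_prop]
      constructor
      · rintro ⟨h, hh, h1, h2⟩
        obtain ⟨g, hg, hgh⟩ := happ h hh
          (Set.range (fun j => (q.1 j).1) ∪ Set.range fun j => (q.2 j).1)
          ((Set.finite_range _).union (Set.finite_range _))
        have e1 : mistakes m q.1 g = mistakes m q.1 h := by
          unfold mistakes; simp only [hgh _ (Or.inl ⟨_, rfl⟩)]
        have e2 : mistakes m q.2 g = mistakes m q.2 h := by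
          unfold mistakes; simp only [hgh _ (Or.inr ⟨_, rfl⟩)]
        exact ⟨g, hg, by rwa [e1], by rwa [e2]⟩
      · rintro ⟨h, hh, h1⟩
        exact ⟨h, hsub hh, h1⟩
    rw [this]
    refine MeasurableSet.biUnion hc fun h hh => ?_
    exact (measurableSet_le ((hmist h (hsub hh)).comp measurable_fst) measurable_const).inter
      (measurableSet_le measurable_const ((hmist h (hsub hh)).comp measurable_snd))
  -- swapping pairs preserves the law of the double sample, so that the probability is an average
  -- over the swaps
  let sw : (Fin m → Bool) → (Bool × Fin m → X × Bool) → (Bool × Fin m → X × Bool) :=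
    fun σ u i => u (xor (σ i.2) i.1, i.2)
  have hswm : ∀ σ, Measurable (sw σ) := fun σ => by fun_prop
  have hsw : ∀ σ, Q.map (sw σ) = Q := by
    intro σ
    refine Measure.map_infinitePi_infinitePi_of_inj (P := fun _ : Bool × Fin m => μ)
      (f := fun i : Bool × Fin m => (xor (σ i.2) i.1, i.2)) ?_
    rintro ⟨b, j⟩ ⟨b', j'⟩ h
    simp only [Prod.mk.injEq] at h
    obtain ⟨h1, rfl⟩ := h
    simpa using h1
  -- for a fixed double sample: a union over the traces of the class on the double sample.
  have hpt : ∀ u : Bool × Fin m → X × Bool,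
      ((Finset.univ.filter fun σ => Φ (sw σ u) ∈ E).card : ℝ) ≤ 2 ^ m * B := by
    intro u
    set 𝒜 := Finset.univ.filter fun A : Finset (Bool × Fin m) =>
      ∃ h ∈ H, ∀ j, j ∈ A ↔ h (u j).1 = true
    let e : Finset (Bool × Fin m) → Bool → Fin m → Bool :=
      fun A s j => decide ((s, j) ∈ A) != (u (s, j)).2
    have hcov : (Finset.univ.filter fun σ => Φ (sw σ u) ∈ E) ⊆ 𝒜.biUnion fun A =>
        Finset.univ.filter fun σ : Fin m → Bool =>
          ((Finset.univ.filter fun j => e A (σ j) j = true).card : ℝ) ≤ a ∧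
          b ≤ ((Finset.univ.filter fun j => e A (!σ j) j = true).card : ℝ) := by
      intro σ hσ
      obtain ⟨h, hh, h1, h2⟩ := (Finset.mem_filter.1 hσ).2
      refine Finset.mem_biUnion.2 ⟨Finset.univ.filter fun j => h (u j).1 = true,
        Finset.mem_filter.2 ⟨Finset.mem_univ _, h, hh, by simp⟩,
        Finset.mem_filter.2 ⟨Finset.mem_univ _, ?_, ?_⟩⟩
      · refine le_of_eq_of_le ?_ h1
        unfold mistakes
        congr 2
        ext j
        simp [e, Φ, sw]
      · refine h2.trans_eq ?_
        unfold mistakes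
        congr 2
        ext j
        simp [e, Φ, sw]
    calc ((Finset.univ.filter fun σ => Φ (sw σ u) ∈ E).card : ℝ)
        ≤ ∑ A ∈ 𝒜, ((Finset.univ.filter fun σ : Fin m → Bool =>
          ((Finset.univ.filter fun j => e A (σ j) j = true).card : ℝ) ≤ a ∧
          b ≤ ((Finset.univ.filter fun j => e A (!σ j) j = true).card : ℝ)).card : ℝ) := by
          rw [← Nat.cast_sum]
          exact Nat.cast_le.2 ((Finset.card_le_card hcov).trans Finset.card_biUnion_le)
      _ ≤ ∑ _A ∈ 𝒜, 2 ^ m * Real.exp (-(2 * b - 3 * a) * Real.log 1.1) :=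
          Finset.sum_le_sum fun A _ => card_swaps_le (e A)
      _ = 𝒜.card * (2 ^ m * Real.exp (-(2 * b - 3 * a) * Real.log 1.1)) := by
          rw [Finset.sum_const, nsmul_eq_mul]
      _ ≤ (z⁻¹ ^ d * (1 + z) ^ (2 * m))
            * (2 ^ m * Real.exp (-(2 * b - 3 * a) * Real.log 1.1)) := by
          refine mul_le_mul_of_nonneg_right ?_ (by positivity)
          have := card_traces_le hd (fun j => (u j).1) hz hz1
          rwa [Fintype.card_prod, Fintype.card_bool, Fintype.card_fin] at this
      _ = 2 ^ m * B := by ring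
  have hB : 0 ≤ B := by positivity
  have h1 : ∀ σ, (P.prod P) E = Q {u | Φ (sw σ u) ∈ E} := by
    intro σ
    rw [← hΦ, Measure.map_apply hΦm hE]
    conv_lhs => rw [← hsw σ]
    rw [Measure.map_apply (hswm σ) (hΦm hE)]
    rfl
  have h2 : (2 : ENNReal) ^ m * (P.prod P) E ≤ 2 ^ m * ENNReal.ofReal B := by
    calc (2 : ENNReal) ^ m * (P.prod P) E = ∑ σ : Fin m → Bool, Q {u | Φ (sw σ u) ∈ E} := by
          rw [Finset.sum_congr rfl fun σ _ => (h1 σ).symm]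
          simp
      _ = ∑ σ : Fin m → Bool, ∫⁻ u, {u | Φ (sw σ u) ∈ E}.indicator 1 u ∂Q := by
          refine Finset.sum_congr rfl fun σ _ => ?_
          exact (lintegral_indicator_one ((hΦm.comp (hswm σ)) hE)).symm
      _ = ∫⁻ u, ∑ σ : Fin m → Bool, {u | Φ (sw σ u) ∈ E}.indicator 1 u ∂Q := by
          rw [lintegral_finsetSum]
          exact fun σ _ => measurable_one.indicator ((hΦm.comp (hswm σ)) hE)
      _ ≤ ∫⁻ _, 2 ^ m * ENNReal.ofReal B ∂Q := by
          refine lintegral_mono fun u => ?_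
          have : ∑ σ : Fin m → Bool,
              {u | Φ (sw σ u) ∈ E}.indicator (1 : (Bool × Fin m → X × Bool) → ENNReal) u
              = ((Finset.univ.filter fun σ => Φ (sw σ u) ∈ E).card : ENNReal) := by
            simp [Set.indicator_apply]
          rw [this]
          have h3 := ENNReal.ofReal_le_ofReal (hpt u)
          rw [ENNReal.ofReal_natCast, ENNReal.ofReal_mul (by positivity),
            ENNReal.ofReal_pow (by norm_num)] at h3
          simpa using h3
      _ = 2 ^ m * ENNReal.ofReal B := by simp
  exact (ENNReal.mul_le_mul_iff_right (by positivity) (by finiteness)).1 h2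

/-- The error of a jointly measurable family of hypotheses is a measurable function. -/
lemma measurable_err {Ω : Type*} [MeasurableSpace Ω] {μ : Measure (X × Bool)}
    [IsProbabilityMeasure μ] {h : Ω → X → Bool} (hm : Measurable fun p : Ω × X => h p.1 p.2) :
    Measurable fun ω => err μ (h ω) := by
  have : MeasurableSet {p : Ω × (X × Bool) | h p.1 p.2.1 ≠ p.2.2} :=
    (measurableSet_eq_fun (hm.comp (measurable_fst.prodMk (measurable_fst.comp measurable_snd)))
      (measurable_snd.comp measurable_snd)).compl
  exact (measurable_measure_prodMk_left (ν := μ) this).ennreal_toReal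

/-- Empirical risk minimization in the presence of a hypothesis of small error: a relative
deviation bound. With probability close to one `hstar` makes at most `3 α m / 5` mistakes on the
sample, and then so does the minimizer; but a hypothesis of error more than `α` makes at least
`19 α m / 20` mistakes on a ghost sample with probability at least one half, which `ghost_sample`
makes unlikely. -/
lemma erm_tail (hH : PointwiseMeasurable H) {erm : (m : ℕ) → (Fin m → X × Bool) → X → Bool}
    (hE : IsERM H erm) {d : ℕ} (hd : vcDim H = d) {hstar : X → Bool} (hs : hstar ∈ H)
    (μ : Measure (X × Bool)) [IsProbabilityMeasure μ] (m : ℕ) {α : ℝ} (hα : 0 < α) (hα1 : α ≤ 1)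
    (hν : err μ hstar ≤ 11 / 20 * α) (hm : 1000 ≤ α * m) :
    (Measure.infinitePi fun _ : Fin m => μ) {S | α < err μ (erm m S)}
      ≤ ENNReal.ofReal (Real.exp (-(α * m) / 1000)
          + 2 * ((1000 / α) ^ d * Real.exp (-(α * m) / 200))) := by
  set P := Measure.infinitePi fun _ : Fin m => μ
  set a := 3 / 5 * (α * m)
  set b := 19 / 20 * (α * m)
  set F := {S | α < err μ (erm m S) ∧ (mistakes m S (erm m S) : ℝ) ≤ a}
  set G := {S : Fin m → X × Bool | a ≤ (mistakes m S hstar : ℝ)}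
  have hsub : {S | α < err μ (erm m S)} ⊆ G ∪ F := by
    intro S hS
    by_cases h : (mistakes m S (erm m S) : ℝ) ≤ a
    · exact Or.inr ⟨hS, h⟩
    · left
      have : (mistakes m S (erm m S) : ℝ) ≤ mistakes m S hstar := by
        exact_mod_cast hE.le m S hstar hs
      exact ((not_le.1 h).le).trans this
  have hG : P G ≤ ENNReal.ofReal (Real.exp (-(α * m) / 1000)) := by
    have := chernoff_ge (μ := μ) (Finset.univ : Finset (Fin m))
      (fun _ => measurableSet_wrong (hH.1 _ hs)) (z := 12 / 11) (by norm_num)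
      (fun _ _ => hν) a
    simp_rw [← mistakes_eq_hits] at this
    refine this.trans (ENNReal.ofReal_le_ofReal (Real.exp_le_exp.2 ?_))
    have hl : (0.085 : ℝ) ≤ Real.log (12 / 11) := by
      rw [Real.le_log_iff_exp_le (by norm_num)]
      have := Real.exp_bound' (x := 0.085) (by norm_num) (by norm_num) (n := 3) (by norm_num)
      refine this.trans ?_
      norm_num [Finset.sum_range_succ, Nat.factorial]
    rw [Finset.card_univ, Fintype.card_fin]
    have : 0 ≤ α * m := by positivity
    simp only [a]
    nlinarith
  have hmistm : Measurable fun q : (Fin m → X × Bool) × (Fin m → X × Bool) =>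
      (mistakes m q.2 (erm m q.1) : ℝ) := by
    have : (fun q : (Fin m → X × Bool) × (Fin m → X × Bool) =>
        (mistakes m q.2 (erm m q.1) : ℝ))
        = fun q => ∑ j, if erm m q.1 (q.2 j).1 ≠ (q.2 j).2 then (1 : ℝ) else 0 := by
      funext q
      rw [mistakes, Finset.card_filter, Nat.cast_sum]
      exact Finset.sum_congr rfl fun j _ => by split_ifs <;> simp
    rw [this]
    refine Finset.measurable_sum _ fun j _ =>
      Measurable.ite (MeasurableSet.compl ?_) measurable_const measurable_const
    exact measurableSet_eq_fun ((hE.measurable m).comp (measurable_fst.prodMk (by fun_prop)))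
      (by fun_prop)
  have herrm : Measurable fun S => err μ (erm m S) := measurable_err (hE.measurable m)
  have hF : MeasurableSet F :=
    (measurableSet_lt measurable_const herrm).inter
      (measurableSet_le (hmistm.comp (measurable_id.prodMk measurable_id)) measurable_const)
  set E₂ : Set ((Fin m → X × Bool) × (Fin m → X × Bool)) :=
    {q | q.1 ∈ F ∧ b ≤ (mistakes m q.2 (erm m q.1) : ℝ)}
  have hE₂ : MeasurableSet E₂ :=
    (measurable_fst hF).inter (measurableSet_le measurable_const hmistm)
  -- a ghost sample detects a hypothesis of large error with probability at least one half
  have hhalf : ∀ S ∈ F, (1 / 2 : ENNReal) ≤ P (Prod.mk S ⁻¹' E₂) := by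
    intro S hS
    have hmS : Measurable (erm m S) := hH.1 _ (hE.mem m S)
    have h1 := chernoff_le (μ := μ) (Finset.univ : Finset (Fin m))
      (fun _ => measurableSet_wrong hmS) (z := 19 / 20) (by norm_num) (by norm_num)
      (fun _ _ => hS.1.le) b
    simp_rw [← mistakes_eq_hits] at h1
    have hle : (Prod.mk S ⁻¹' E₂)ᶜ ⊆ {ω | (mistakes m ω (erm m S) : ℝ) ≤ b} := by
      intro ω hω
      by_contra hcon
      exact hω ⟨hS, (not_le.1 hcon).le⟩
    have h2 : P (Prod.mk S ⁻¹' E₂)ᶜ ≤ 1 / 2 := by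
      refine (measure_mono hle).trans (h1.trans ?_)
      rw [show (1 / 2 : ENNReal) = ENNReal.ofReal (Real.exp (-Real.log 2)) by
        rw [Real.exp_neg, Real.exp_log (by norm_num), ENNReal.ofReal_inv_of_pos (by norm_num)]
        simp]
      refine ENNReal.ofReal_le_ofReal (Real.exp_le_exp.2 ?_)
      have hl : Real.log (20 / 19) ≤ 0.0515 := by
        rw [Real.log_le_iff_le_exp (by norm_num)]
        have := Real.quadratic_le_exp_of_nonneg (x := 0.0515) (by norm_num)
        refine le_trans ?_ this
        norm_num
      have hl' : Real.log (19 / 20) = -Real.log (20 / 19) := by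
        rw [← Real.log_inv]; norm_num
      have := Real.log_two_lt_d9
      rw [Finset.card_univ, Fintype.card_fin, hl']
      simp only [b]
      nlinarith
    have h3 := prob_compl_eq_one_sub (μ := P) (measurable_prodMk_left (x := S) hE₂)
    rw [h3] at h2
    have h4 : (1 : ENNReal) ≤ 1 / 2 + P (Prod.mk S ⁻¹' E₂) := tsub_le_iff_right.1 h2
    by_contra hcon
    have h5 := ENNReal.add_lt_add_left (a := 1 / 2) (by simp) (not_le.1 hcon)
    rw [ENNReal.add_halves] at h5
    exact absurd h4 (not_le.2 h5)
  have hsym : P F ≤ 2 * (P.prod P) E₂ := by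
    have : (1 / 2 : ENNReal) * P F ≤ (P.prod P) E₂ := by
      rw [Measure.prod_apply hE₂, ← setLIntegral_const]
      exact (setLIntegral_mono' hF hhalf).trans (setLIntegral_le_lintegral _ _)
    calc P F = 2 * (1 / 2 * P F) := by
          rw [← mul_assoc, one_div, ENNReal.mul_inv_cancel (by simp) (by simp), one_mul]
      _ ≤ _ := mul_le_mul_right this 2
  have hgh := ghost_sample hH hd μ m (a := a) (b := b) (z := α / 1000) (by positivity)
    (by linarith)
  have hE₂le : (P.prod P) E₂ ≤ ENNReal.ofReal ((1000 / α) ^ d * Real.exp (-(α * m) / 200)) := by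
    refine (measure_mono ?_).trans (hgh.trans (ENNReal.ofReal_le_ofReal ?_))
    · rintro q ⟨hq, hqb⟩
      exact ⟨_, hE.mem m q.1, hq.2, hqb⟩
    · rw [inv_div, mul_assoc]
      refine mul_le_mul_of_nonneg_left ?_ (by positivity)
      have h1 : (1 + α / 1000) ^ (2 * m) ≤ Real.exp (α / 500 * m) := by
        calc (1 + α / 1000) ^ (2 * m) ≤ Real.exp (α / 1000) ^ (2 * m) := by
              refine pow_le_pow_left₀ (by positivity) ?_ _
              linarith [Real.add_one_le_exp (α / 1000)]
          _ = _ := by rw [← Real.exp_nat_mul]; congr 1; push_cast; ring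
      refine (mul_le_mul_of_nonneg_right h1 (Real.exp_pos _).le).trans ?_
      rw [← Real.exp_add]
      refine Real.exp_le_exp.2 ?_
      have hl : (0.09 : ℝ) ≤ Real.log 1.1 := by
        rw [Real.le_log_iff_exp_le (by norm_num)]
        have := Real.exp_bound' (x := 0.09) (by norm_num) (by norm_num) (n := 3) (by norm_num)
        refine this.trans ?_
        norm_num [Finset.sum_range_succ, Nat.factorial]
      simp only [a, b]
      nlinarith
  calc P {S | α < err μ (erm m S)} ≤ P G + P F :=
        (measure_mono hsub).trans (measure_union_le _ _)
    _ ≤ ENNReal.ofReal (Real.exp (-(α * m) / 1000))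
        + 2 * ENNReal.ofReal ((1000 / α) ^ d * Real.exp (-(α * m) / 200)) :=
        add_le_add hG (hsym.trans (mul_le_mul_right hE₂le 2))
    _ = _ := by
        rw [ENNReal.ofReal_add (by positivity) (by positivity),
          ENNReal.ofReal_mul (p := 2) (by norm_num)]
        simp

end ERM

/-! ### Disagreement and the star number -/

section Star

variable {X : Type*} {H : Set (X → Bool)} {hstar : X → Bool}

/-- The points whose label is not determined by knowing that a hypothesis agrees with `hstar` on the
sample `S`. -/
def uncertain (H : Set (X → Bool)) (hstar : X → Bool) {J : Type*} (S : J → X × Bool) : Set X :=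
  {x | ∃ h ∈ H, (∀ j, h (S j).1 = hstar (S j).1) ∧ h x ≠ hstar x}

lemma card_le_starNumber {s : ℕ} (hs : starNumber H hstar ≤ s) {J : Type*} [Fintype J] (x : J → X)
    (hx : ∀ i, ∃ h ∈ H, (∀ j ≠ i, h (x j) = hstar (x j)) ∧ h (x i) ≠ hstar (x i)) :
    Fintype.card J ≤ s := by
  choose g hg hag hne using hx
  let e := (Fintype.equivFin J).symm
  have : (Fintype.card J : ℕ∞) ≤ starNumber H hstar := by
    refine le_iSup₂_of_le (Fintype.card J) ⟨fun i => x (e i), fun i => g (e i), fun i =>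
      ⟨hg _, hne _, fun j hj => hag _ _ fun h => hj (e.injective h)⟩⟩ le_rfl
  exact_mod_cast this.trans hs

/-- A shattered set is a star around any hypothesis. -/
lemma vcDim_le_of_starNumber_le {d s : ℕ} (hd : vcDim H = d) (hs : starNumber H hstar ≤ s) :
    d ≤ s := by
  have : vcDim H ≤ s := by
    refine iSup₂_le fun T hT => ?_
    have := card_le_starNumber hs (fun x : T => x.1) fun i => by
      obtain ⟨h, hh, hag⟩ := hT fun x => if x = i.1 then !hstar x else hstar x
      refine ⟨h, hh, fun j hj => ?_, ?_⟩
      · rw [hag _ j.2, if_neg fun h => hj (Subtype.ext h)]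
      · rw [hag _ i.2, if_pos rfl]; simp
    simpa using this
  rw [hd] at this
  exact_mod_cast this

variable [MeasurableSpace X]

lemma measurableSet_uncertain (hH : PointwiseMeasurable H) (hm : Measurable hstar) {J : Type*}
    [Finite J] : MeasurableSet {q : (J → X × Bool) × X | q.2 ∈ uncertain H hstar q.1} := by
  obtain ⟨H₀, hsub, hc, happ⟩ := hH.exists_countable
  have : {q : (J → X × Bool) × X | q.2 ∈ uncertain H hstar q.1} = ⋃ h ∈ H₀,
      (⋂ j, {q | h (q.1 j).1 = hstar (q.1 j).1}) ∩ {q | h q.2 ≠ hstar q.2} := by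
    ext q
    simp only [uncertain, Set.mem_ofPred_eq, Set.mem_iUnion, Set.mem_inter_iff, Set.mem_iInter,
      exists_prop]
    constructor
    · rintro ⟨h, hh, h1, h2⟩
      obtain ⟨g, hg, hgh⟩ := happ h hh (insert q.2 (Set.range fun j => (q.1 j).1))
        ((Set.finite_range _).insert _)
      exact ⟨g, hg, fun j => by rw [hgh _ (Or.inr ⟨j, rfl⟩), h1],
        by rwa [hgh _ (Set.mem_insert _ _)]⟩
    · rintro ⟨h, hh, h1⟩
      exact ⟨h, hsub hh, h1⟩
  rw [this]
  refine MeasurableSet.biUnion hc fun h hh => MeasurableSet.inter ?_ ?_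
  · have hh' := hH.1 h (hsub hh)
    exact MeasurableSet.iInter fun j => measurableSet_eq_fun (by fun_prop) (by fun_prop)
  · have hh' := hH.1 h (hsub hh)
    exact (measurableSet_eq_fun (by fun_prop) (by fun_prop)).compl

/-- The expected mass of the uncertain region, by leaving out one of `m + 1` examples: those left
out whose label is uncertain given the others form a star. -/
lemma lintegral_uncertain_le (hH : PointwiseMeasurable H) (hm : Measurable hstar) {s : ℕ}
    (hs : starNumber H hstar ≤ s) (μ : Measure (X × Bool)) [IsProbabilityMeasure μ] (m : ℕ) :
    ((m : ENNReal) + 1) * ∫⁻ S, μ {z | z.1 ∈ uncertain H hstar S}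
      ∂(Measure.infinitePi fun _ : Fin m => μ) ≤ s := by
  set P := Measure.infinitePi fun _ : Fin m => μ
  set P' := Measure.pi fun _ : Fin (m + 1) => μ
  have hU := measurableSet_uncertain (J := Fin m) hH hm
  have hU' : MeasurableSet {q : (X × Bool) × (Fin m → X × Bool) |
      q.1.1 ∈ uncertain H hstar q.2} :=
    (measurable_snd.prodMk (measurable_fst.comp measurable_fst)) hU
  let G : Fin (m + 1) → Set (Fin (m + 1) → X × Bool) := fun i =>
    {T | (T i).1 ∈ uncertain H hstar fun j => T (i.succAbove j)}
  have hG : ∀ i, MeasurableSet (G i) := fun i =>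
    (Measurable.prodMk (f := fun T : Fin (m + 1) → X × Bool => fun j => T (i.succAbove j))
      (g := fun T => (T i).1) (by fun_prop) (by fun_prop)) hU
  have hGP : ∀ i, P' (G i) = ∫⁻ S, μ {z | z.1 ∈ uncertain H hstar S} ∂P := by
    intro i
    have h1 := (measurePreserving_piFinSuccAbove (fun _ : Fin (m + 1) => μ) i).measure_preimage
      hU'.nullMeasurableSet
    rw [Measure.prod_apply_symm hU', ← Measure.infinitePi_eq_pi (μ := fun _ : Fin m => μ)] at h1
    exact h1
  have hcount : ∀ T, ∑ i, (G i).indicator (1 : (Fin (m + 1) → X × Bool) → ENNReal) T ≤ s := by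
    intro T
    have h1 : Fintype.card {i // T ∈ G i} ≤ s := by
      refine card_le_starNumber hs (fun i : {i // T ∈ G i} => (T i.1).1) fun i => ?_
      obtain ⟨h, hh, hag, hne⟩ := i.2
      refine ⟨h, hh, fun j hj => ?_, hne⟩
      obtain ⟨l, hl⟩ := Fin.exists_succAbove_eq (x := j.1) (y := i.1) fun h => hj (Subtype.ext h)
      simpa [hl] using hag l
    have h2 : ∑ i, (G i).indicator (1 : (Fin (m + 1) → X × Bool) → ENNReal) T
        = (Fintype.card {i // T ∈ G i} : ENNReal) := by
      simp [Set.indicator_apply, Fintype.card_subtype]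
    rw [h2]
    exact_mod_cast h1
  calc ((m : ENNReal) + 1) * ∫⁻ S, μ {z | z.1 ∈ uncertain H hstar S} ∂P
      = ∑ i, P' (G i) := by simp [hGP]
    _ = ∫⁻ T, ∑ i, (G i).indicator 1 T ∂P' := by
        rw [lintegral_finsetSum _ fun i _ => measurable_one.indicator (hG i)]
        exact Finset.sum_congr rfl fun i _ => (lintegral_indicator_one (hG i)).symm
    _ ≤ ∫⁻ _, s ∂P' := lintegral_mono hcount
    _ = s := by simp

end Star

/-! ### Robust-RPU-Learn -/

/-- Abstaining predictions form a finite space, on which all sets are measurable. -/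
instance : MeasurableSpace (Option Bool) := ⊤

instance : DiscreteMeasurableSpace (Option Bool) := ⟨fun _ => trivial⟩

section Robust

variable {X : Type*} {H : Set (X → Bool)} {hstar : X → Bool}

lemma unanimous_eq_some_iff (V : Set (X → Bool)) (x : X) (v : Bool) :
    unanimous V x = some v ↔ (∃ h ∈ V, h x = v) ∧ ¬ ∃ h ∈ V, h x = !v := by
  unfold unanimous
  by_cases hV : V.Nonempty
  · rw [dif_pos hV]
    by_cases hd : x ∈ dis V
    · rw [if_pos hd]
      obtain ⟨h₁, hh₁, h₂, hh₂, hne⟩ := hd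
      simp only [reduceCtorEq, false_iff, not_and, not_not]
      rintro -
      by_cases h : h₁ x = v
      · refine ⟨h₂, hh₂, ?_⟩
        rw [h] at hne
        cases v <;> cases h' : h₂ x <;> simp_all
      · refine ⟨h₁, hh₁, ?_⟩
        cases v <;> cases h' : h₁ x <;> simp_all
    · rw [if_neg hd]
      have hall : ∀ h ∈ V, h x = hV.some x := fun h hh => by
        by_contra hne
        exact hd ⟨h, hh, _, hV.some_mem, hne⟩
      constructor
      · intro h
        have h := Option.some.inj h
        refine ⟨⟨_, hV.some_mem, h⟩, ?_⟩
        rintro ⟨g, hg, hgx⟩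
        rw [hall g hg, h] at hgx
        simp at hgx
      · rintro ⟨⟨g, hg, hgx⟩, -⟩
        rw [← hgx, hall g hg]
  · rw [dif_neg hV]
    simp only [reduceCtorEq, false_iff, not_and]
    rintro ⟨h, hh, -⟩
    exact absurd ⟨h, hh⟩ hV

/-- The batches of size `m` on which `hstar` makes a mistake. -/
def unclean (hstar : X → Bool) (m : ℕ) : Set (ℕ → X × Bool) :=
  {S | ∃ j < m, hstar (S j).1 ≠ (S j).2}

/-- The batches of size `m` whose points leave the label of `x` undetermined. -/
def doubtful (H : Set (X → Bool)) (hstar : X → Bool) (m : ℕ) (x : X) : Set (ℕ → X × Bool) :=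
  {S | x ∈ uncertain H hstar fun j : Fin m => S j}

lemma mem_versionSpace_iff_of_clean {m : ℕ} {S : ℕ → X × Bool} (hc : S ∉ unclean hstar m)
    (h : X → Bool) :
    h ∈ versionSpace H m S ↔ h ∈ H ∧ ∀ j : Fin m, h (S j).1 = hstar (S j).1 := by
  have hc' : ∀ j < m, hstar (S j).1 = (S j).2 := fun j hj => by
    by_contra hne
    exact hc ⟨j, hj, hne⟩
  refine and_congr_right fun _ => ⟨fun h1 j => ?_, fun h1 j hj => ?_⟩
  · rw [h1 _ j.2, hc' _ j.2]
  · rw [h1 ⟨j, hj⟩, hc' _ hj]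

lemma unanimous_of_clean (hs : hstar ∈ H) {m : ℕ} {S : ℕ → X × Bool} (hc : S ∉ unclean hstar m)
    (x : X) :
    unanimous (versionSpace H m S) x
      = if S ∈ doubtful H hstar m x then none else some (hstar x) := by
  have hmem : hstar ∈ versionSpace H m S := (mem_versionSpace_iff_of_clean hc _).2 ⟨hs, by simp⟩
  have hnot : ∀ v w : Bool, v ≠ w ↔ v = !w := by decide
  split_ifs with hd
  · obtain ⟨h, hh, h1, h2⟩ := hd
    have hV := (mem_versionSpace_iff_of_clean hc h).2 ⟨hh, h1⟩
    rw [Option.eq_none_iff_forall_not_mem]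
    intro v hv
    obtain ⟨-, hv⟩ := (unanimous_eq_some_iff _ _ _).1 (Option.mem_def.1 hv)
    by_cases hvs : hstar x = v
    · exact hv ⟨h, hV, by rw [← hvs, ← hnot]; exact h2⟩
    · exact hv ⟨hstar, hmem, (hnot _ _).1 hvs⟩
  · rw [unanimous_eq_some_iff]
    refine ⟨⟨_, hmem, rfl⟩, ?_⟩
    rintro ⟨h, hh, hx⟩
    obtain ⟨h1, h2⟩ := (mem_versionSpace_iff_of_clean hc h).1 hh
    exact hd ⟨h, h1, h2, (hnot _ _).2 hx⟩

/-- If at most a tenth of the batches contain mistakes of `hstar`, then every prediction of the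
vote is that of `hstar`, and it abstains only on points that are doubtful for at least `7 / 10` of
the batches: more than a fifth of the votes are needed for a prediction, and at most a tenth of them
are wrong; an abstention needs four fifths of the batches to abstain, most of them clean. -/
lemma thresholdVote_spec (hs : hstar ∈ H) {L m : ℕ} {S : ℕ → ℕ → X × Bool}
    (hU : hits (Finset.range (60 * L)) (fun _ => unclean hstar m) S ≤ 6 * L) (x : X) :
    let f := thresholdVote (60 * L) fun b => unanimous (versionSpace H m (S b))
    f x ≠ some (!hstar x) ∧
      (f x = none → 42 * L ≤ hits (Finset.range (60 * L)) (fun _ => doubtful H hstar m x) S) := by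
  set R := Finset.range (60 * L)
  set g : ℕ → Option Bool := fun b => unanimous (versionSpace H m (S b)) x
  set U := R.filter fun b => S b ∈ unclean hstar m
  set Dx := R.filter fun b => S b ∈ doubtful H hstar m x
  set good := R.filter fun b => g b = some (hstar x)
  set bad := R.filter fun b => g b = some (!hstar x)
  set non := R.filter fun b => g b = none
  have hg : ∀ b, S b ∉ unclean hstar m →
      g b = if S b ∈ doubtful H hstar m x then none else some (hstar x) :=
    fun b hb => unanimous_of_clean hs hb x
  have h1 : bad.card ≤ U.card := Finset.card_le_card fun b hb => by
    obtain ⟨hR, hb⟩ := Finset.mem_filter.1 hb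
    refine Finset.mem_filter.2 ⟨hR, ?_⟩
    by_contra hc
    rw [hg b hc] at hb
    split_ifs at hb
    simp at hb
  have h2 : non.card ≤ U.card + Dx.card := by
    refine (Finset.card_le_card fun b hb => ?_).trans (Finset.card_union_le U Dx)
    obtain ⟨hR, hb⟩ := Finset.mem_filter.1 hb
    by_cases hc : S b ∈ unclean hstar m
    · exact Finset.mem_union_left _ (Finset.mem_filter.2 ⟨hR, hc⟩)
    · refine Finset.mem_union_right _ (Finset.mem_filter.2 ⟨hR, ?_⟩)
      by_contra hd
      rw [hg b hc, if_neg hd] at hb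
      simp at hb
  have h3 : 60 * L ≤ good.card + bad.card + non.card := by
    have : R ⊆ good ∪ bad ∪ non := fun b hb => by
      simp only [good, bad, non, Finset.mem_union, Finset.mem_filter, hb, true_and]
      rcases g b with _ | v
      · simp
      · cases v <;> cases hstar x <;> simp
    have h4 := (Finset.card_le_card this).trans ((Finset.card_union_le _ _).trans
      (Nat.add_le_add_right (Finset.card_union_le _ _) _))
    simpa [R] using h4
  have hU' : U.card ≤ 6 * L := hU
  change _ ∧ (_ → 42 * L ≤ Dx.card)
  cases hx : hstar x
  · have e1 : (R.filter fun b => unanimous (versionSpace H m (S b)) x = some false) = good := by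
      simp [good, g, hx]
    have e2 : (R.filter fun b => unanimous (versionSpace H m (S b)) x = some true) = bad := by
      simp [bad, g, hx]
    simp only [thresholdVote, R] at e1 e2 ⊢
    simp only [e1, e2]
    split_ifs <;> simp <;> omega
  · have e1 : (R.filter fun b => unanimous (versionSpace H m (S b)) x = some true) = good := by
      simp [good, g, hx]
    have e2 : (R.filter fun b => unanimous (versionSpace H m (S b)) x = some false) = bad := by
      simp [bad, g, hx]
    simp only [thresholdVote, R] at e1 e2 ⊢
    simp only [e1, e2]
    split_ifs <;> simp <;> omega

variable [MeasurableSpace X]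

lemma measurable_unanimous (hH : PointwiseMeasurable H) (m : ℕ) :
    Measurable fun q : (ℕ → X × Bool) × X => unanimous (versionSpace H m q.1) q.2 := by
  obtain ⟨H₀, hsub, hc, happ⟩ := hH.exists_countable
  have hW : ∀ v,
      MeasurableSet {q : (ℕ → X × Bool) × X | ∃ h ∈ versionSpace H m q.1, h q.2 = v} := by
    intro v
    have : {q : (ℕ → X × Bool) × X | ∃ h ∈ versionSpace H m q.1, h q.2 = v}
        = ⋃ h ∈ H₀, (⋂ j : Fin m, {q | h (q.1 j).1 = (q.1 j).2}) ∩ {q | h q.2 = v} := by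
      ext q
      simp only [versionSpace, Set.mem_ofPred_eq, Set.mem_iUnion, Set.mem_inter_iff,
        Set.mem_iInter, exists_prop]
      constructor
      · rintro ⟨h, ⟨hh, h1⟩, h2⟩
        obtain ⟨g, hg, hgh⟩ := happ h hh (insert q.2 (Set.range fun j : Fin m => (q.1 j).1))
          ((Set.finite_range _).insert _)
        exact ⟨g, hg, fun j => by rw [hgh _ (Or.inr ⟨j, rfl⟩), h1 _ j.2],
          by rwa [hgh _ (Set.mem_insert _ _)]⟩
      · rintro ⟨h, hh, h1, h2⟩
        exact ⟨h, ⟨hsub hh, fun j hj => h1 ⟨j, hj⟩⟩, h2⟩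
    rw [this]
    refine MeasurableSet.biUnion hc fun h hh => MeasurableSet.inter ?_ ?_
    · have hh' := hH.1 h (hsub hh)
      exact MeasurableSet.iInter fun j => measurableSet_eq_fun (by fun_prop) (by fun_prop)
    · have hh' := hH.1 h (hsub hh)
      exact measurableSet_eq_fun (by fun_prop) (by fun_prop)
  have hsome : ∀ v, MeasurableSet {q : (ℕ → X × Bool) × X |
      unanimous (versionSpace H m q.1) q.2 = some v} := by
    intro v
    simp only [unanimous_eq_some_iff]
    exact (hW v).inter (hW (!v)).compl
  refine measurable_to_countable' fun v => ?_
  rcases v with _ | v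
  · have : (fun q : (ℕ → X × Bool) × X => unanimous (versionSpace H m q.1) q.2) ⁻¹' {none}
        = ({q | unanimous (versionSpace H m q.1) q.2 = some true}
          ∪ {q | unanimous (versionSpace H m q.1) q.2 = some false})ᶜ := by
      ext q
      simp only [Set.mem_preimage, Set.mem_singleton_iff, Set.mem_compl_iff, Set.mem_union,
        Set.mem_ofPred_eq]
      rcases unanimous (versionSpace H m q.1) q.2 with _ | v
      · simp
      · cases v <;> simp
    rw [this]
    exact ((hsome true).union (hsome false)).compl
  · exact hsome v

lemma measurable_robustRPULearn (hH : PointwiseMeasurable H) (c : ℝ) (s : ℕ) (ξ δ : ℝ) :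
    Measurable fun q : (ℕ → ℕ → X × Bool) × X => robustRPULearn H c s ξ δ q.1 q.2 := by
  have hcount : ∀ v : Option Bool, Measurable fun q : (ℕ → ℕ → X × Bool) × X =>
      ((Finset.range (batches δ)).filter fun b =>
        unanimous (versionSpace H (batchSize c s ξ) (q.1 b)) q.2 = v).card := by
    intro v
    simp_rw [Finset.card_filter]
    refine Finset.measurable_sum _ fun b _ => Measurable.ite ?_ measurable_const measurable_const
    have : Measurable fun q : (ℕ → ℕ → X × Bool) × X =>
        unanimous (versionSpace H (batchSize c s ξ) (q.1 b)) q.2 :=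
      (measurable_unanimous hH _).comp
        (Measurable.prodMk (f := fun q : (ℕ → ℕ → X × Bool) × X => q.1 b) (by fun_prop)
          measurable_snd)
    exact this (measurableSet_singleton v)
  exact (measurable_of_countable fun q : ℕ × ℕ =>
    if 5 * (q.1 + q.2) ≤ batches δ then none
    else if q.2 < q.1 then some true
    else if q.1 < q.2 then some false
    else none).comp ((hcount (some true)).prodMk (hcount (some false)))

/-- An event of probability `p ≤ 1 / 2` seldom happens in `7 / 10` of the trials; the bound is
proportional to `p`. To this end Markov's inequality is applied to `2 ^ hits - 1` instead of
`2 ^ hits`. -/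
lemma hits_tail_of_le_half {Z : Type*} [MeasurableSpace Z] {μ : Measure Z} [IsProbabilityMeasure μ]
    {A : Set Z} (hA : MeasurableSet A) (hp : μ.real A ≤ 1 / 2) {L : ℕ} (hL : 1 ≤ L) :
    (Measure.infinitePi fun _ : ℕ => μ) {S | 42 * L ≤ hits (Finset.range (60 * L)) (fun _ => A) S}
      ≤ ENNReal.ofReal (2 * (1 / 100) ^ L) * μ A := by
  set P := Measure.infinitePi fun _ : ℕ => μ
  set p := μ.real A
  have hp0 : 0 ≤ p := measureReal_nonneg
  set N := 60 * L
  set h : (ℕ → Z) → ℕ := hits (Finset.range N) fun _ => A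
  have hm : Measurable h := measurable_hits _ fun _ => hA
  have hmgf : ∫⁻ S, ENNReal.ofReal (2 ^ h S) ∂P = ENNReal.ofReal ((1 + p) ^ N) := by
    rw [lintegral_pow_hits (μ := μ) _ (fun _ => hA) (by norm_num : (0 : ℝ) < 2),
      Finset.prod_const, Finset.card_range, ← ENNReal.ofReal_pow (by positivity)]
    congr 3
    ring
  have hmg : Measurable fun S => ENNReal.ofReal (2 ^ h S - 1) :=
    (measurable_from_top (f := fun n : ℕ => ENNReal.ofReal (2 ^ n - 1))).comp hm
  have hg : ∫⁻ S, ENNReal.ofReal (2 ^ h S - 1) ∂P = ENNReal.ofReal ((1 + p) ^ N - 1) := by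
    have e : ∀ S, ENNReal.ofReal (2 ^ h S) = ENNReal.ofReal (2 ^ h S - 1) + 1 := fun S => by
      rw [← ENNReal.ofReal_one, ← ENNReal.ofReal_add _ (by norm_num)]
      · congr 1; ring
      · have : (1 : ℝ) ≤ 2 ^ h S := one_le_pow₀ (by norm_num)
        linarith
    simp_rw [e] at hmgf
    rw [lintegral_add_right _ measurable_const, lintegral_const, measure_univ, mul_one] at hmgf
    have h1 : (1 : ℝ) ≤ (1 + p) ^ N := one_le_pow₀ (by linarith)
    have e2 : ENNReal.ofReal ((1 + p) ^ N) = ENNReal.ofReal ((1 + p) ^ N - 1) + 1 := by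
      rw [← ENNReal.ofReal_one, ← ENNReal.ofReal_add (by linarith) (by norm_num)]
      congr 1; ring
    rw [e2] at hmgf
    exact (ENNReal.add_left_inj (by simp)).1 hmgf
  have h1 := mul_meas_ge_le_lintegral (μ := P) hmg (ENNReal.ofReal (2 ^ (42 * L) - 1))
  rw [hg] at h1
  have hsub : {S | 42 * L ≤ h S}
      ⊆ {S | ENNReal.ofReal (2 ^ (42 * L) - 1) ≤ ENNReal.ofReal (2 ^ h S - 1)} := by
    intro S hS
    refine ENNReal.ofReal_le_ofReal ?_
    have : (2 : ℝ) ^ (42 * L) ≤ 2 ^ h S := pow_le_pow_right₀ (by norm_num) hS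
    linarith
  have hbig : (1 : ℝ) < 2 ^ (42 * L) := one_lt_pow₀ (by norm_num) (by omega)
  -- convexity of the power: `1 + p` lies between `1` and `3 / 2`
  have hconv : (1 + p) ^ N - 1 ≤ 2 * p * ((3 / 2) ^ N - 1) := by
    have := (convexOn_pow (𝕜 := ℝ) N).2 (Set.mem_Ici.2 zero_le_one)
      (Set.mem_Ici.2 (by norm_num : (0 : ℝ) ≤ 3 / 2)) (by linarith : 0 ≤ 1 - 2 * p)
      (by linarith : 0 ≤ 2 * p) (by ring)
    simp only [smul_eq_mul, one_pow, mul_one] at this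
    have e : 1 - 2 * p + 2 * p * (3 / 2) = 1 + p := by ring
    rw [e] at this
    linarith
  have hratio : (3 / 2 : ℝ) ^ N - 1 ≤ (1 / 100) ^ L * (2 ^ (42 * L) - 1) := by
    have e1 : (3 / 2 : ℝ) ^ N ≤ (1 / 100) ^ L * 2 ^ (42 * L) := by
      rw [pow_mul, pow_mul, ← mul_pow]
      exact pow_le_pow_left₀ (by positivity) (by norm_num) _
    have e2 : (1 / 100 : ℝ) ^ L ≤ 1 := pow_le_one₀ (by norm_num) (by norm_num)
    linarith
  have h2 : ENNReal.ofReal (2 ^ (42 * L) - 1) * P {S | 42 * L ≤ h S}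
      ≤ ENNReal.ofReal (2 ^ (42 * L) - 1) * (ENNReal.ofReal (2 * (1 / 100) ^ L) * μ A) := by
    refine (mul_le_mul_right (measure_mono hsub) _).trans (h1.trans ?_)
    rw [← ofReal_measureReal (μ := μ) (s := A), ← ENNReal.ofReal_mul (by positivity),
      ← ENNReal.ofReal_mul (by linarith)]
    refine ENNReal.ofReal_le_ofReal (hconv.trans ?_)
    calc 2 * p * ((3 / 2) ^ N - 1) ≤ 2 * p * ((1 / 100) ^ L * (2 ^ (42 * L) - 1)) :=
          mul_le_mul_of_nonneg_left hratio (by positivity)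
      _ = _ := by ring
  refine (ENNReal.mul_le_mul_iff_right ?_ ENNReal.ofReal_ne_top).1 h2
  simpa using hbig

end Robust

section RobustTail

variable {X : Type*} [MeasurableSpace X] {H : Set (X → Bool)} {hstar : X → Bool}

lemma measurableSet_unclean (hm : Measurable hstar) (m : ℕ) :
    MeasurableSet (unclean hstar m) := by
  have : unclean hstar m = ⋃ j ∈ Finset.range m, {S | hstar (S j).1 ≠ (S j).2} := by
    ext S; simp [unclean]
  rw [this]
  exact Finset.measurableSet_biUnion _ fun j _ =>
    (measurableSet_wrong hm).preimage (measurable_pi_apply j)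

/-- A union bound over the examples of a batch. -/
lemma unclean_le (hm : Measurable hstar) (μ : Measure (X × Bool)) [IsProbabilityMeasure μ]
    (m : ℕ) : (Measure.infinitePi fun _ : ℕ => μ).real (unclean hstar m) ≤ m * err μ hstar := by
  have : unclean hstar m = ⋃ j ∈ Finset.range m, {S | hstar (S j).1 ≠ (S j).2} := by
    ext S; simp [unclean]
  rw [this]
  refine (measureReal_biUnion_finset_le _ _).trans ?_
  rw [← nsmul_eq_mul]
  refine (Finset.sum_le_card_nsmul _ _ (err μ hstar) fun j _ => ?_).trans (by simp)
  exact ((measurePreserving_eval_infinitePi (fun _ : ℕ => μ) j).measureReal_preimage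
    (measurableSet_wrong hm).nullMeasurableSet).le

lemma measurableSet_doubtful (hH : PointwiseMeasurable H) (hm : Measurable hstar) (m : ℕ) :
    MeasurableSet {q : (ℕ → X × Bool) × X | q.1 ∈ doubtful H hstar m q.2} :=
  (Measurable.prodMk
    (f := fun q : (ℕ → X × Bool) × X => fun j : Fin m => q.1 j) (g := fun q => q.2)
    (by fun_prop) (by fun_prop)) (measurableSet_uncertain hH hm)

/-- The mean probability that a batch leaves the label of a random point undetermined. -/
lemma lintegral_doubtful_le (hH : PointwiseMeasurable H) (hm : Measurable hstar) {s : ℕ}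
    (hs : starNumber H hstar ≤ s) (μ : Measure (X × Bool)) [IsProbabilityMeasure μ] {m : ℕ}
    {ξ : ℝ} (hξ : 4 * s ≤ ξ * m) (hξ0 : 0 < ξ) :
    ∫⁻ z, (Measure.infinitePi fun _ : ℕ => μ) (doubtful H hstar m z.1) ∂μ
      ≤ ENNReal.ofReal (ξ / 4) := by
  set Q := Measure.infinitePi fun _ : ℕ => μ
  set P := Measure.infinitePi fun _ : Fin m => μ
  have h0 := lintegral_uncertain_le hH hm hs μ m
  have hmap : Q.map (fun S (j : Fin m) => S j) = P :=
    Measure.map_infinitePi_infinitePi_of_inj (P := fun _ : ℕ => μ) Fin.val_injective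
  have hU := measurableSet_uncertain (J := Fin m) hH hm
  have hU' : MeasurableSet {q : (X × Bool) × (Fin m → X × Bool) |
      q.1.1 ∈ uncertain H hstar q.2} :=
    (measurable_snd.prodMk (measurable_fst.comp measurable_fst)) hU
  have h1 : ∫⁻ z, Q (doubtful H hstar m z.1) ∂μ
      = ∫⁻ S, μ {z | z.1 ∈ uncertain H hstar S} ∂P := by
    have e1 : ∀ z : X × Bool, Q (doubtful H hstar m z.1)
        = P (Prod.mk z ⁻¹' {q | q.1.1 ∈ uncertain H hstar q.2}) := by
      intro z
      rw [← hmap, Measure.map_apply (by fun_prop) (measurable_prodMk_left hU')]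
      rfl
    simp_rw [e1]
    rw [← Measure.prod_apply hU', Measure.prod_apply_symm hU']
    rfl
  rw [h1]
  set I := ∫⁻ S, μ {z | z.1 ∈ uncertain H hstar S} ∂P
  have hI : I ≤ 1 := by
    calc I ≤ ∫⁻ _, 1 ∂P := lintegral_mono fun _ => prob_le_one
      _ = 1 := by simp
  have hIt : I ≠ ⊤ := ne_top_of_le_ne_top ENNReal.one_ne_top hI
  rw [← ENNReal.ofReal_toReal hIt]
  refine ENNReal.ofReal_le_ofReal ?_
  have h2 := ENNReal.toReal_mono (by finiteness) h0
  rw [ENNReal.toReal_mul, ENNReal.toReal_add (by finiteness) (by finiteness)] at h2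
  simp only [ENNReal.toReal_natCast, ENNReal.toReal_one] at h2
  have h3 : ((m : ℝ) + 1) * I.toReal ≤ (m + 1) * (ξ / 4) := by nlinarith
  exact le_of_mul_le_mul_left h3 (by positivity)

/-- The guarantee of Robust-RPU-Learn with `60 L` batches of size `m`, for examples with law `μ`:
except with probability `3 exp (-L) / 4`, few batches contain mistakes of `hstar`, and the vote
abstains with probability at most `9 ξ / 10`. By Markov's inequality, the points that are doubtful
for a batch with probability more than one half have mass at most `ξ / 2`; the other points, on
average, rarely lead to an abstention. -/
lemma robust_tail (hH : PointwiseMeasurable H) (hs : hstar ∈ H) {s : ℕ}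
    (hstarno : starNumber H hstar ≤ s) (μ : Measure (X × Bool)) [IsProbabilityMeasure μ] {m L : ℕ}
    {ξ : ℝ} (hξ : 4 * s ≤ ξ * m) (hξ0 : 0 < ξ) (hη : m * err μ hstar ≤ 1 / 25) (hL : 1 ≤ L) :
    (Measure.infinitePi fun _ : ℕ => Measure.infinitePi fun _ : ℕ => μ)
      {S | 6 * L < hits (Finset.range (60 * L)) (fun _ => unclean hstar m) S ∨
        ENNReal.ofReal (9 / 10 * ξ) < μ {z | thresholdVote (60 * L)
          (fun b => unanimous (versionSpace H m (S b))) z.1 = none}}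
      ≤ ENNReal.ofReal (3 / 4 * Real.exp (-L)) := by
  set Q := Measure.infinitePi fun _ : ℕ => μ
  set P := Measure.infinitePi fun _ : ℕ => Q
  have hm := hH.1 _ hs
  have hL' : (1 : ℝ) ≤ L := by exact_mod_cast hL
  set R := Finset.range (60 * L)
  set B₁ := {S : ℕ → ℕ → X × Bool | 6 * L < hits R (fun _ => unclean hstar m) S}
  have hB₁ : P B₁ ≤ ENNReal.ofReal (1 / 2 * Real.exp (-L)) := by
    have h1 := chernoff_ge (μ := Q) R (fun _ => measurableSet_unclean hm m) (z := 2) (by norm_num)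
      (fun _ _ => (unclean_le hm μ m).trans hη) (6 * L)
    refine (measure_mono fun S hS => ?_).trans (h1.trans (ENNReal.ofReal_le_ofReal ?_))
    · have : 6 * L ≤ hits R (fun _ => unclean hstar m) S := hS.le
      exact_mod_cast this
    · have e : (1 / 2 : ℝ) = Real.exp (-Real.log 2) := by
        rw [Real.exp_neg, Real.exp_log (by norm_num)]; norm_num
      rw [e, ← Real.exp_add]
      refine Real.exp_le_exp.2 ?_
      have := Real.log_two_gt_d9
      have := Real.log_two_lt_d9
      simp only [R, Finset.card_range]
      push_cast
      nlinarith
  have hD := measurableSet_doubtful hH hm m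
  have hDx : ∀ x, MeasurableSet (doubtful H hstar m x) := fun x => measurable_prodMk_right hD
  set p : X × Bool → ENNReal := fun z => Q (doubtful H hstar m z.1)
  have hpm : Measurable p := (measurable_measure_prodMk_right hD).comp measurable_fst
  have hpint : ∫⁻ z, p z ∂μ ≤ ENNReal.ofReal (ξ / 4) := lintegral_doubtful_le hH hm hstarno μ hξ hξ0
  set low := {z | p z ≤ 1 / 2}
  have hlow : MeasurableSet low := measurableSet_le hpm measurable_const
  have hhigh : μ lowᶜ ≤ ENNReal.ofReal (ξ / 2) := by
    have h1 := mul_meas_ge_le_lintegral (μ := μ) hpm (1 / 2)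
    have h2 : (1 / 2 : ENNReal) * μ lowᶜ ≤ ENNReal.ofReal (ξ / 4) := by
      refine (mul_le_mul_right (measure_mono fun z hz => ?_) _).trans (h1.trans hpint)
      exact (lt_of_not_ge (show ¬ p z ≤ 1 / 2 from hz)).le
    calc μ lowᶜ = 2 * (1 / 2 * μ lowᶜ) := by
          rw [← mul_assoc, one_div, ENNReal.mul_inv_cancel (by simp) (by simp), one_mul]
      _ ≤ 2 * ENNReal.ofReal (ξ / 4) := mul_le_mul_right h2 2
      _ = ENNReal.ofReal (ξ / 2) := by
          rw [show (2 : ENNReal) = ENNReal.ofReal 2 by simp, ← ENNReal.ofReal_mul (by norm_num)]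
          congr 1; ring
  set W : Set ((ℕ → ℕ → X × Bool) × (X × Bool)) :=
    {q | 42 * L ≤ hits R (fun _ => doubtful H hstar m q.2.1) q.1}
  have hW : MeasurableSet W := by
    have : Measurable fun q : (ℕ → ℕ → X × Bool) × (X × Bool) =>
        hits R (fun _ => doubtful H hstar m q.2.1) q.1 := by
      simp only [hits, Finset.card_filter]
      refine Finset.measurable_sum _ fun b _ =>
        Measurable.ite ?_ measurable_const measurable_const
      exact (Measurable.prodMk (f := fun q : (ℕ → ℕ → X × Bool) × (X × Bool) => q.1 b)
        (g := fun q => q.2.1) (by fun_prop) (by fun_prop)) hD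
    exact measurableSet_le measurable_const this
  have hWlow : MeasurableSet (W ∩ Prod.snd ⁻¹' low) := hW.inter (measurable_snd hlow)
  set M : (ℕ → ℕ → X × Bool) → ENNReal := fun S => μ (Prod.mk S ⁻¹' (W ∩ Prod.snd ⁻¹' low))
  have hMm : Measurable M := measurable_measure_prodMk_left hWlow
  have hMint : ∫⁻ S, M S ∂P ≤ ENNReal.ofReal (ξ / 2 * (1 / 100) ^ L) := by
    rw [← Measure.prod_apply hWlow, Measure.prod_apply_symm hWlow]
    calc ∫⁻ z, P ((fun S => (S, z)) ⁻¹' (W ∩ Prod.snd ⁻¹' low)) ∂μ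
        ≤ ∫⁻ z, ENNReal.ofReal (2 * (1 / 100) ^ L) * p z ∂μ := by
          refine lintegral_mono fun z => ?_
          by_cases hz : z ∈ low
          · have hz' : Q.real (doubtful H hstar m z.1) ≤ 1 / 2 := by
              have := ENNReal.toReal_mono (by simp) (show p z ≤ 1 / 2 from hz)
              simpa [p, Measure.real] using this
            refine (measure_mono fun S hS => ?_).trans (hits_tail_of_le_half (hDx z.1) hz' hL)
            exact hS.1
          · have : (fun S => (S, z)) ⁻¹' (W ∩ Prod.snd ⁻¹' low) = ∅ :=
              Set.eq_empty_of_forall_notMem fun S hS => hz hS.2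
            rw [this]; simp
      _ = ENNReal.ofReal (2 * (1 / 100) ^ L) * ∫⁻ z, p z ∂μ := lintegral_const_mul _ hpm
      _ ≤ ENNReal.ofReal (2 * (1 / 100) ^ L) * ENNReal.ofReal (ξ / 4) := mul_le_mul_right hpint _
      _ = _ := by rw [← ENNReal.ofReal_mul (by positivity)]; congr 1; ring
  set B₂ := {S | ENNReal.ofReal (2 / 5 * ξ) ≤ M S}
  have hB₂ : P B₂ ≤ ENNReal.ofReal (1 / 4 * Real.exp (-L)) := by
    have h1 := (mul_meas_ge_le_lintegral (μ := P) hMm (ENNReal.ofReal (2 / 5 * ξ))).trans hMint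
    have hpos : ENNReal.ofReal (2 / 5 * ξ) ≠ 0 := by simpa using hξ0
    refine (ENNReal.mul_le_mul_iff_right hpos ENNReal.ofReal_ne_top).1 (h1.trans ?_)
    rw [← ENNReal.ofReal_mul (by positivity)]
    refine ENNReal.ofReal_le_ofReal ?_
    have he : 5 * (1 / 100 : ℝ) ^ L ≤ Real.exp (-L) := by
      have h3 : Real.exp (-(L : ℝ)) = Real.exp (-1) ^ L := by
        rw [← Real.exp_nat_mul]; congr 1; ring
      have h4 : (1 / 20 : ℝ) ≤ Real.exp (-1) := by
        rw [Real.exp_neg, ← one_div]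
        refine one_div_le_one_div_of_le (Real.exp_pos _) ?_
        linarith [Real.exp_one_lt_d9]
      have h5 : (5 : ℝ) ≤ 5 ^ L := by
        calc (5 : ℝ) = 5 ^ 1 := by norm_num
          _ ≤ 5 ^ L := pow_le_pow_right₀ (by norm_num) hL
      calc 5 * (1 / 100 : ℝ) ^ L ≤ 5 ^ L * (1 / 100) ^ L :=
            mul_le_mul_of_nonneg_right h5 (by positivity)
        _ = (1 / 20) ^ L := by rw [← mul_pow]; norm_num
        _ ≤ Real.exp (-1) ^ L := pow_le_pow_left₀ (by norm_num) h4 _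
        _ = _ := h3.symm
    nlinarith
  have hsub : {S | 6 * L < hits R (fun _ => unclean hstar m) S ∨
        ENNReal.ofReal (9 / 10 * ξ) < μ {z | thresholdVote (60 * L)
          (fun b => unanimous (versionSpace H m (S b))) z.1 = none}} ⊆ B₁ ∪ B₂ := by
    rintro S (hS | hS)
    · exact Or.inl hS
    · by_cases hU : hits R (fun _ => unclean hstar m) S ≤ 6 * L
      · right
        by_contra hcon
        have hcon : M S < ENNReal.ofReal (2 / 5 * ξ) := not_le.1 hcon
        refine absurd hS (not_lt.2 ?_)
        calc _ ≤ μ (lowᶜ ∪ Prod.mk S ⁻¹' (W ∩ Prod.snd ⁻¹' low)) := by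
              refine measure_mono fun z hz => ?_
              by_cases hzl : z ∈ low
              · exact Or.inr ⟨(thresholdVote_spec hs hU z.1).2 hz, hzl⟩
              · exact Or.inl hzl
          _ ≤ ENNReal.ofReal (ξ / 2) + ENNReal.ofReal (2 / 5 * ξ) :=
              (measure_union_le _ _).trans (add_le_add hhigh hcon.le)
          _ = _ := by
              rw [← ENNReal.ofReal_add (by positivity) (by positivity)]; congr 1; ring
      · exact Or.inl (not_le.1 hU)
  calc _ ≤ P B₁ + P B₂ := (measure_mono hsub).trans (measure_union_le _ _)
    _ ≤ _ := add_le_add hB₁ hB₂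
    _ = _ := by
        rw [← ENNReal.ofReal_add (by positivity) (by positivity)]; congr 1; ring

end RobustTail

/-! ### Sampling from mixtures -/

section Mixture

variable {X : Type*} [MeasurableSpace X] {k : ℕ} [NeZero k]

lemma measurable_pick :
    Measurable fun q : (Fin k → ℕ) × unitInterval => pick q.1 q.2 := by
  refine measurable_from_prod_countable_right fun w => ?_
  have h1 : Measurable fun u : unitInterval => Finset.univ.filter fun i : Fin k =>
      (u : ℝ) * ∑ j, (w j : ℝ) < ∑ j ∈ Finset.Iic i, (w j : ℝ) := by
    refine measurable_finset_iff.2 fun i => ?_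
    simp only [Finset.mem_filter, Finset.mem_univ, true_and]
    have h2 : Measurable fun u : unitInterval => (u : ℝ) * ∑ j, (w j : ℝ) := by fun_prop
    exact measurableSet_setOfPred.1 (measurableSet_lt h2 measurable_const)
  exact (measurable_of_countable fun T : Finset (Fin k) =>
    if h : T.Nonempty then T.min' h else 0).comp h1

lemma measurable_mix {Ω : Type*} [MeasurableSpace Ω] {w : Ω → Fin k → ℕ} (hw : Measurable w)
    {σ : Ω → Seed X k} (hσ : Measurable σ) : Measurable fun ω => mix (w ω) (σ ω) := by
  have h1 := measurable_pick.comp (hw.prodMk hσ.fst)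
  have h2 : Measurable fun q : (Fin k → X × Bool) × Fin k => q.1 q.2 :=
    measurable_from_prod_countable_left fun i => measurable_pi_apply i
  have h3 := h2.comp (hσ.snd.prodMk h1)
  exact h3

/-- The index `i` is picked on an interval of length `w i / ∑ j, w j`; if all weights vanish, then
the left-hand side is zero. -/
lemma le_volume_pick (w : Fin k → ℕ) (i : Fin k) :
    ENNReal.ofReal (w i / ∑ j, (w j : ℝ)) ≤ volume {u : unitInterval | pick w u = i} := by
  set W := ∑ j, (w j : ℝ)
  rcases (Finset.sum_nonneg fun j _ => Nat.cast_nonneg (w j) : (0 : ℝ) ≤ W).eq_or_lt with h0 | h0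
  · change (0 : ℝ) = W at h0
    simp [← h0]
  set a := ∑ j ∈ Finset.Iio i, (w j : ℝ)
  have ha : 0 ≤ a := Finset.sum_nonneg fun j _ => Nat.cast_nonneg (w j)
  have hab : a + w i = ∑ j ∈ Finset.Iic i, (w j : ℝ) := Finset.sum_Iio_add_eq_sum_Iic _
  have hbW : a + w i ≤ W := by
    rw [hab]
    exact Finset.sum_le_sum_of_subset_of_nonneg (Finset.subset_univ _) fun j _ _ =>
      Nat.cast_nonneg (w j)
  have hwi : (0 : ℝ) ≤ w i := Nat.cast_nonneg _
  let x : unitInterval := ⟨a / W, div_nonneg ha h0.le, (div_le_one h0).2 (by linarith)⟩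
  let y : unitInterval := ⟨(a + w i) / W, div_nonneg (by linarith) h0.le, (div_le_one h0).2 hbW⟩
  have hxy : ENNReal.ofReal (w i / W) = volume (Set.Ico x y) := by
    rw [unitInterval.volume_Ico]
    congr 1
    simp only [x, y]
    ring
  rw [hxy]
  refine measure_mono fun u hu => ?_
  have h1 : a ≤ u * W := (div_le_iff₀ h0).1 hu.1
  have h2 : u * W < a + w i := (lt_div_iff₀ h0).1 hu.2
  have hmem : i ∈ Finset.univ.filter fun i : Fin k =>
      (u : ℝ) * ∑ j, (w j : ℝ) < ∑ j ∈ Finset.Iic i, (w j : ℝ) := by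
    simp only [Finset.mem_filter, Finset.mem_univ, true_and]
    rw [← hab]; exact h2
  have hne : (Finset.univ.filter fun i : Fin k =>
      (u : ℝ) * ∑ j, (w j : ℝ) < ∑ j ∈ Finset.Iic i, (w j : ℝ)).Nonempty := ⟨i, hmem⟩
  change pick w u = i
  rw [pick, dif_pos hne]
  refine le_antisymm (Finset.min'_le _ _ hmem) (Finset.le_min' _ _ _ fun l hl => ?_)
  by_contra hlt
  have hl' := (Finset.mem_filter.1 hl).2
  have : ∑ j ∈ Finset.Iic l, (w j : ℝ) ≤ a :=
    Finset.sum_le_sum_of_subset_of_nonneg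
      (fun j hj => Finset.mem_Iio.2 ((Finset.mem_Iic.1 hj).trans_lt (not_le.1 hlt)))
      fun j _ _ => Nat.cast_nonneg (w j)
  linarith

variable (D : Fin k → Measure (X × Bool)) [∀ i, IsProbabilityMeasure (D i)]

instance : IsProbabilityMeasure (seedMeasure D) := by
  unfold seedMeasure; infer_instance

lemma measurable_mix_right (w : Fin k → ℕ) : Measurable (mix (X := X) w) :=
  measurable_mix measurable_const measurable_id

lemma seedMeasure_mix (w : Fin k → ℕ) {A : Set (X × Bool)} (hA : MeasurableSet A) :
    seedMeasure D (mix w ⁻¹' A) = ∫⁻ u : unitInterval, D (pick w u) A := by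
  rw [seedMeasure, Measure.prod_apply (measurable_mix_right w hA)]
  refine lintegral_congr fun u => ?_
  exact (measurePreserving_eval D (pick w u)).measure_preimage hA.nullMeasurableSet

/-- An event has at most the largest of its probabilities under the `D i`. -/
lemma seedMeasure_mix_le (w : Fin k → ℕ) {A : Set (X × Bool)} (hA : MeasurableSet A) {b : ENNReal}
    (h : ∀ i, D i A ≤ b) : seedMeasure D (mix w ⁻¹' A) ≤ b := by
  rw [seedMeasure_mix D w hA]
  calc _ ≤ ∫⁻ _ : unitInterval, b := lintegral_mono fun u => h _
    _ = b := by simp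

lemma sum_fiber_mul {Ω ι : Type*} [MeasurableSpace Ω] [Fintype ι] [MeasurableSpace ι]
    [MeasurableSingletonClass ι] (ν : Measure Ω) {g : Ω → ι} (hg : Measurable g)
    (a : ι → ENNReal) : ∑ i, ν (g ⁻¹' {i}) * a i = ∫⁻ u, a (g u) ∂ν := by
  have e : ∀ u, a (g u) = ∑ i, (g ⁻¹' {i}).indicator (fun _ => a i) u := fun u => by
    simp [Set.indicator_apply]
  simp_rw [e]
  rw [lintegral_finsetSum _ fun i _ =>
    measurable_const.indicator (hg (measurableSet_singleton i))]
  refine Finset.sum_congr rfl fun i _ => ?_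
  rw [lintegral_indicator_const (hg (measurableSet_singleton i)), mul_comm]

/-- The mixture with weights `w` gives an event at least the weighted mean of its probabilities. -/
lemma sum_weights_le (w : Fin k → ℕ) {A : Set (X × Bool)} (hA : MeasurableSet A) :
    ∑ i, w i * (D i).real A ≤ (∑ i, (w i : ℝ)) * (seedMeasure D).real (mix w ⁻¹' A) := by
  set W := ∑ i, (w i : ℝ)
  rcases (Finset.sum_nonneg fun j _ => Nat.cast_nonneg (w j) : (0 : ℝ) ≤ W).eq_or_lt with h0 | h0
  · change (0 : ℝ) = W at h0
    rw [← h0, zero_mul]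
    refine (Finset.sum_eq_zero fun i hi => ?_).le
    have := (Finset.sum_eq_zero_iff_of_nonneg (fun j _ => Nat.cast_nonneg (w j))).1 h0.symm i hi
    rw [this, zero_mul]
  have hpm := measurable_pick.comp (measurable_prodMk_left (x := w) (β := unitInterval))
  have h1 : ∑ i, ENNReal.ofReal (w i / W) * D i A ≤ seedMeasure D (mix w ⁻¹' A) := by
    rw [seedMeasure_mix D w hA]
    calc ∑ i, ENNReal.ofReal (w i / W) * D i A
        ≤ ∑ i, volume {u : unitInterval | pick w u = i} * D i A :=
          Finset.sum_le_sum fun i _ => mul_le_mul_left (le_volume_pick w i) _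
      _ = ∫⁻ u : unitInterval, D (pick w u) A := sum_fiber_mul volume hpm fun i => D i A
  have h2 := ENNReal.toReal_mono (by finiteness) h1
  rw [ENNReal.toReal_sum fun i _ => by finiteness] at h2
  have h3 : ∀ i, (ENNReal.ofReal (w i / W) * D i A).toReal = w i / W * (D i).real A := fun i => by
    rw [ENNReal.toReal_mul, ENNReal.toReal_ofReal (div_nonneg (Nat.cast_nonneg _) h0.le),
      Measure.real]
  rw [Finset.sum_congr rfl fun i _ => h3 i] at h2
  have hW : W ≠ 0 := h0.ne'
  calc ∑ i, w i * (D i).real A = W * ∑ i, w i / W * (D i).real A := by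
        rw [Finset.mul_sum]
        refine Finset.sum_congr rfl fun i _ => ?_
        field_simp
    _ ≤ _ := mul_le_mul_of_nonneg_left h2 h0.le

end Mixture

/-! ### Measurability of the algorithm -/

section Measurability

variable {X : Type*} [MeasurableSpace X] {Ω : Type*} [MeasurableSpace Ω]

lemma measurable_getD {f : Ω → Option Bool} {g : Ω → Bool} (hf : Measurable f)
    (hg : Measurable g) : Measurable fun ω => (f ω).getD (g ω) :=
  (measurable_of_countable fun q : Option Bool × Bool => q.1.getD q.2).comp (hf.prodMk hg)

lemma measurable_impute {f : Ω → X → Option Bool} (hf : Measurable fun q : Ω × X => f q.1 q.2)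
    {g : Ω → X × Bool} (hg : Measurable g) : Measurable fun ω => impute (f ω) (g ω) :=
  (measurable_fst.comp hg).prodMk (measurable_getD
    (hf.comp (measurable_id.prodMk (measurable_fst.comp hg))) (measurable_snd.comp hg))

lemma measurable_impute_right {f : X → Option Bool} (hf : Measurable f) :
    Measurable (impute f) :=
  measurable_fst.prodMk (measurable_getD (hf.comp measurable_fst) measurable_snd)

lemma measurable_cost {f : Ω → X → Option Bool} (hf : Measurable fun q : Ω × X => f q.1 q.2)
    {g : Ω → X × Bool} (hg : Measurable g) : Measurable fun ω => cost (f ω) (g ω) :=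
  (measurable_of_countable fun v : Option Bool => if v = none then 1 else 0).comp
    (hf.comp (measurable_id.prodMk (measurable_fst.comp hg)))

/-- For natural numbers, the infimum of the empty set is `0`. -/
lemma measurable_sInf_nat {p : Ω → ℕ → Prop} (hp : ∀ n, MeasurableSet {ω | p ω n}) :
    Measurable fun ω => sInf {n | p ω n} := by
  refine measurable_to_countable' fun n => ?_
  have : (fun ω => sInf {n | p ω n}) ⁻¹' {n}
      = ({ω | p ω n} ∩ ⋂ m ∈ Finset.range n, {ω | p ω m}ᶜ)
        ∪ ({_ω | n = 0} ∩ ⋂ m, {ω | p ω m}ᶜ) := by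
    ext ω
    simp only [Set.mem_preimage, Set.mem_singleton_iff, Set.mem_union, Set.mem_inter_iff,
      Set.mem_ofPred_eq, Set.mem_iInter, Set.mem_compl_iff, Finset.mem_range]
    constructor
    · rintro rfl
      by_cases h : {n | p ω n}.Nonempty
      · exact Or.inl ⟨Nat.sInf_mem h, fun m hm => Nat.notMem_of_lt_sInf hm⟩
      · rw [Set.not_nonempty_iff_eq_empty] at h
        refine Or.inr ⟨by rw [h]; simp, fun m hm => ?_⟩
        exact (h ▸ hm : m ∈ (∅ : Set ℕ))
    · rintro (⟨h1, h2⟩ | ⟨rfl, h⟩)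
      · refine le_antisymm (Nat.sInf_le h1) (not_lt.1 fun hlt => ?_)
        exact h2 _ hlt (Nat.sInf_mem ⟨n, h1⟩)
      · exact Nat.sInf_eq_zero.2 (Or.inr (Set.eq_empty_of_forall_notMem h))
  rw [this]
  exact ((hp n).inter (Finset.measurableSet_biInter _ fun m _ => (hp m).compl)).union
    ((MeasurableSet.const _).inter (MeasurableSet.iInter fun m => (hp m).compl))

variable {k : ℕ} (A : Setup X k)

namespace Setup

lemma measurable_indicatorWeights {N : Ω → Finset (Fin k)} (hN : Measurable N) :
    Measurable fun ω (i : Fin k) => if i ∈ N ω then 1 else 0 :=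
  measurable_pi_lambda _ fun i => Measurable.ite
    (measurableSet_setOfPred.2 (measurable_finset_iff.1 hN i)) measurable_const measurable_const

lemma measurableSet_passesTest {f : Ω → X → Option Bool}
    (hf : Measurable fun q : Ω × X => f q.1 q.2) (ζ δ : ℝ) {θ : Ω → Fin k → ℕ → Seed X k}
    (hθ : Measurable θ) (i : Fin k) {h : Ω → X → Bool}
    (hh : Measurable fun q : Ω × X => h q.1 q.2) :
    MeasurableSet {ω | A.PassesTest (f ω) ζ δ (θ ω) i (h ω)} := by
  unfold PassesTest
  refine measurableSet_le ?_ measurable_const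
  simp only [mistakes, Finset.card_filter, Nat.cast_sum]
  refine Finset.measurable_sum _ fun j _ => measurable_from_top.comp
    (Measurable.ite (MeasurableSet.compl ?_) measurable_const measurable_const)
  have h1 : Measurable fun ω => (θ ω i j).2 i := by fun_prop
  have h2 := measurable_impute hf h1
  exact measurableSet_eq_fun (hh.comp (measurable_id.prodMk (measurable_fst.comp h2)))
    (measurable_snd.comp h2)

variable [NeZero k]

lemma measurable_mdlHyp (hE : IsERM A.H A.erm) {f : Ω → X → Option Bool}
    (hf : Measurable fun q : Ω × X => f q.1 q.2) (ζ δ : ℝ) {τ : Ω → ℕ → ℕ → Seed X k}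
    (hτ : Measurable τ) (r : ℕ) {w : Ω → Fin k → ℕ} (hw : Measurable w) :
    Measurable fun q : Ω × X => A.mdlHyp (f q.1) ζ δ (τ q.1) r (w q.1) q.2 := by
  refine (hE.measurable (A.trainSize ζ δ)).comp (Measurable.prodMk ?_ measurable_snd)
  refine measurable_pi_lambda _ fun j => ?_
  have h1 : Measurable fun ω => τ ω r j := by fun_prop
  exact (measurable_impute hf (measurable_mix hw h1)).comp measurable_fst

lemma measurable_weights (hE : IsERM A.H A.erm) {f : Ω → X → Option Bool}
    (hf : Measurable fun q : Ω × X => f q.1 q.2) (ζ δ : ℝ) {τ : Ω → ℕ → ℕ → Seed X k}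
    (hτ : Measurable τ) {θ : Ω → ℕ → Fin k → ℕ → Seed X k} (hθ : Measurable θ) (r : ℕ) :
    Measurable fun ω => A.weights (f ω) ζ δ (τ ω) (θ ω) r := by
  induction r with
  | zero => exact measurable_const
  | succ r ih =>
    refine measurable_pi_lambda _ fun i => ?_
    have h1 : Measurable fun ω => A.weights (f ω) ζ δ (τ ω) (θ ω) r i :=
      (measurable_pi_apply i).comp ih
    have h2 : Measurable fun ω => θ ω r := by fun_prop
    have h3 := A.measurable_mdlHyp hE hf ζ δ hτ r ih
    have h4 := A.measurableSet_passesTest hf ζ δ h2 i (h :=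
      fun ω => A.mdlHyp (f ω) ζ δ (τ ω) r (A.weights (f ω) ζ δ (τ ω) (θ ω) r)) h3
    exact Measurable.ite h4 h1 (h1.const_mul 2)

variable (hH : PointwiseMeasurable A.H)

include hH

lemma measurable_roundRPU {f : Ω → X → Option Bool}
    (hf : Measurable fun q : Ω × X => f q.1 q.2) (ξ δ : ℝ) {σ : Ω → ℕ → ℕ → ℕ → Seed X k}
    (hσ : Measurable σ) (r : ℕ) {N : Ω → Finset (Fin k)} (hN : Measurable N) :
    Measurable fun q : Ω × X => A.roundRPU (f q.1) ξ δ (σ q.1) r (N q.1) q.2 := by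
  have h0 : Measurable fun (ω : Ω) (b j : ℕ) =>
      impute (f ω) (mix (fun i => if i ∈ N ω then 1 else 0) (σ ω r b j)) := by
    refine measurable_pi_lambda _ fun b => measurable_pi_lambda _ fun j => ?_
    have h1 : Measurable fun ω => σ ω r b j := by fun_prop
    exact measurable_impute hf (measurable_mix (measurable_indicatorWeights hN) h1)
  have h2 : Measurable fun q : Ω × X => ((fun (b j : ℕ) => impute (f q.1)
      (mix (fun i => if i ∈ N q.1 then 1 else 0) (σ q.1 r b j))), q.2) :=
    (h0.comp measurable_fst).prodMk measurable_snd
  have h3 := (measurable_robustRPULearn hH A.c A.s (ξ / 2) (δ / (2 * ((r : ℝ) + 1) ^ 2))).comp h2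
  exact h3

variable [∀ i, IsProbabilityMeasure (A.D i)]

lemma measurable_active {f : Ω → X → Option Bool}
    (hf : Measurable fun q : Ω × X => f q.1 q.2) (ξ δ : ℝ) {σ : Ω → ℕ → ℕ → ℕ → Seed X k}
    (hσ : Measurable σ) (r : ℕ) : Measurable fun ω => A.active (f ω) ξ δ (σ ω) r := by
  induction r with
  | zero => exact measurable_const
  | succ r ih =>
    refine measurable_finset_iff.2 fun i => ?_
    simp only [active, Finset.mem_filter]
    have h1 := measurable_finset_iff.1 ih i
    have h0 := A.measurable_roundRPU hH hf ξ δ hσ r (N := fun ω => A.active (f ω) ξ δ (σ ω) r) ih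
    have h2 : MeasurableSet {q : Ω × X |
        A.roundRPU (f q.1) ξ δ (σ q.1) r (A.active (f q.1) ξ δ (σ q.1) r) q.2 = none} :=
      h0 (measurableSet_singleton none)
    have h3 := measurable_measure_prodMk_left (ν := (A.D i).fst) h2
    exact h1.and (measurableSet_setOfPred.1 (measurableSet_le h3 measurable_const)).not

lemma measurable_rounds {f : Ω → X → Option Bool}
    (hf : Measurable fun q : Ω × X => f q.1 q.2) (ξ δ : ℝ) {σ : Ω → ℕ → ℕ → ℕ → Seed X k}
    (hσ : Measurable σ) : Measurable fun ω => A.rounds (f ω) ξ δ (σ ω) :=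
  measurable_sInf_nat fun r => A.measurable_active hH hf ξ δ hσ r (measurableSet_singleton ∅)

lemma measurable_passiveRPU {f : Ω → X → Option Bool}
    (hf : Measurable fun q : Ω × X => f q.1 q.2) (ξ δ : ℝ) {σ : Ω → ℕ → ℕ → ℕ → Seed X k}
    (hσ : Measurable σ) :
    Measurable fun q : Ω × X => A.passiveRPU (f q.1) ξ δ (σ q.1) q.2 := by
  set out : Ω × X → ℕ → Option Bool := fun q r =>
    A.roundRPU (f q.1) ξ δ (σ q.1) r (A.active (f q.1) ξ δ (σ q.1) r) q.2
  have hout : ∀ r, Measurable fun q => out q r := by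
    intro r
    have h := A.measurable_active hH hf ξ δ hσ r
    have h' := A.measurable_roundRPU hH hf ξ δ hσ r (N := fun ω => A.active (f ω) ξ δ (σ ω) r) h
    exact h'
  have hR : Measurable fun q : Ω × X => A.rounds (f q.1) ξ δ (σ q.1) :=
    (A.measurable_rounds hH hf ξ δ hσ).comp measurable_fst
  have hp : ∀ r, MeasurableSet {q : Ω × X | r < A.rounds (f q.1) ξ δ (σ q.1) ∧ out q r ≠ none} :=
    fun r => (measurableSet_lt measurable_const hR).inter
      (hout r (measurableSet_singleton none)).compl
  have hex : MeasurableSet {q : Ω × X | ∃ r < A.rounds (f q.1) ξ δ (σ q.1), out q r ≠ none} := by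
    have : {q : Ω × X | ∃ r < A.rounds (f q.1) ξ δ (σ q.1), out q r ≠ none}
        = ⋃ r, {q : Ω × X | r < A.rounds (f q.1) ξ δ (σ q.1) ∧ out q r ≠ none} := by
      ext q; simp
    rw [this]
    exact MeasurableSet.iUnion hp
  have h1 : Measurable fun z : (Ω × X) × ℕ => out z.1 z.2 :=
    measurable_from_prod_countable_left hout
  have h2 := h1.comp (measurable_id.prodMk (measurable_sInf_nat hp))
  exact Measurable.ite hex h2 measurable_const

lemma measurable_rpuAt (n : ℕ) : Measurable fun q : Tape X k × X => A.rpuAt q.1 n q.2 := by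
  induction n with
  | zero => exact measurable_const
  | succ n ih =>
    exact A.measurable_passiveRPU hH (f := fun ω => A.rpuAt ω n) ih (epsAt (n + 1))
      (A.deltaAt (n + 1)) (σ := fun ω => seedsAt ω (n + 1)) (by unfold seedsAt; fun_prop)

end Setup

end Measurability

/-! ### Passive-RPU-MDL within a run -/

/-- An abstaining classifier is reliable if it never contradicts `hstar`. -/
def Reliable {X : Type*} (hstar : X → Bool) (f : X → Option Bool) : Prop :=
  ∀ x, f x ≠ some (!hstar x)

lemma Reliable.getD_eq {X : Type*} {hstar : X → Bool} {f : X → Option Bool}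
    (hf : Reliable hstar f) {x : X} (hx : f x ≠ none) (y : Bool) : (f x).getD y = hstar x := by
  have h := hf x
  rcases hfx : f x with _ | v
  · exact absurd hfx hx
  · rw [hfx] at h
    cases v <;> cases h' : hstar x <;> simp_all

section Tape

variable {X : Type*} [MeasurableSpace X] {k : ℕ} (D : Fin k → Measure (X × Bool))
  [∀ i, IsProbabilityMeasure (D i)]

instance : IsProbabilityMeasure (tapeMeasure D) := by
  unfold tapeMeasure; infer_instance

/-- The seeds in distinct slots are independent. -/
lemma map_slots {κ : Type*} {e : κ → Slot k} (he : Function.Injective e) :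
    (tapeMeasure D).map (fun ω q => ω (e q)) = Measure.infinitePi fun _ : κ => seedMeasure D :=
  Measure.map_infinitePi_infinitePi_of_inj (P := fun _ : Slot k => seedMeasure D) he

/-- The number of label queries among examples with distinct seeds. -/
lemma tape_hits_tail {κ : Type*} {e : κ → Slot k} (he : Function.Injective e)
    (T : Finset κ) {A : κ → Set (Seed X k)} (hA : ∀ q, MeasurableSet (A q))
    {p B : ℝ} (hp : ∀ q ∈ T, (seedMeasure D).real (A q) ≤ p) (hB : p * T.card ≤ B)
    (hB0 : 0 ≤ B) :
    tapeMeasure D {ω | 3 * B ≤ hits T A fun q => ω (e q)} ≤ ENNReal.ofReal (Real.exp (-B)) := by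
  have h1 : Measurable fun (ω : Tape X k) (q : κ) => ω (e q) := by fun_prop
  have h2 := hits_tail (μ := seedMeasure D) T hA hp hB hB0
  rw [← map_slots D he] at h2
  exact (Measure.le_map_apply h1.aemeasurable _).trans h2

/-- Examples obtained from seeds in distinct slots form independent batches. -/
lemma map_batches {e : ℕ × ℕ → Slot k} (he : Function.Injective e) {Z : Type*}
    [MeasurableSpace Z] {g : Seed X k → Z} (hg : Measurable g) :
    (tapeMeasure D).map (fun ω (b j : ℕ) => g (ω (e (b, j))))
      = Measure.infinitePi fun _ : ℕ => Measure.infinitePi fun _ : ℕ => (seedMeasure D).map g := by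
  have : IsProbabilityMeasure ((seedMeasure D).map g) :=
    Measure.isProbabilityMeasure_map hg.aemeasurable
  rw [← Measure.infinitePi_map_curry (fun (_ _ : ℕ) => (seedMeasure D).map g),
    ← Measure.infinitePi_map_pi (fun _ : ℕ × ℕ => seedMeasure D) (fun _ => hg),
    ← map_slots D he, Measure.map_map (by fun_prop) (by fun_prop),
    Measure.map_map ((MeasurableEquiv.measurable _).comp (by fun_prop)) (by fun_prop)]
  rfl

/-- A conditional bound, given the seeds in the slots outside `I`, is enough. -/
lemma tape_le_of_resample (I : Set (Slot k)) {E : Set (Tape X k)} (hE : MeasurableSet E)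
    {b : ENNReal} (h : ∀ ω, tapeMeasure D {ω' | merge I ω ω' ∈ E} ≤ b) : tapeMeasure D E ≤ b :=
  measure_le_of_resample (μ := seedMeasure D) I hE h

end Tape

lemma injective_roundSlot {k : ℕ} (n r : ℕ) :
    Function.Injective fun q : ℕ × ℕ => (Slot.rpu n r q.1 q.2 : Slot k) := by
  rintro ⟨b, j⟩ ⟨b', j'⟩ h
  simpa using h

lemma err_le_mdErr {X : Type*} [MeasurableSpace X] {k : ℕ} (D : Fin k → Measure (X × Bool))
    (h : X → Bool) (i : Fin k) : err (D i) h ≤ mdErr D h :=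
  le_ciSup (f := fun i => err (D i) h) (Set.finite_range _).bddAbove i

namespace Setup

section Congr

variable {X : Type*} [MeasurableSpace X] {k : ℕ} [NeZero k] (A : Setup X k)

/-- The distributions active in round `r` depend only on the seeds of earlier rounds. -/
lemma active_congr (f : X → Option Bool) (ξ δ : ℝ) {σ σ' : ℕ → ℕ → ℕ → Seed X k} {r : ℕ}
    (h : ∀ r' < r, σ r' = σ' r') : A.active f ξ δ σ r = A.active f ξ δ σ' r := by
  induction r with
  | zero => rfl
  | succ r ih =>
    have h1 := ih fun r' hr' => h r' (hr'.trans r.lt_succ_self)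
    have h2 : ∀ N, A.roundRPU f ξ δ σ r N = A.roundRPU f ξ δ σ' r N := fun N => by
      simp only [roundRPU, h r r.lt_succ_self]
    ext i
    simp only [active, Finset.mem_filter, h1, h2]

/-- `f_n` depends only on the seeds of the first `n` epochs. -/
lemma rpuAt_congr {ω ω' : Tape X k} {n : ℕ}
    (h : ∀ n' ≤ n, ∀ r b j, ω (Slot.rpu n' r b j) = ω' (Slot.rpu n' r b j)) :
    A.rpuAt ω n = A.rpuAt ω' n := by
  induction n with
  | zero => rfl
  | succ n ih =>
    have h1 := ih fun n' hn' => h n' (hn'.trans n.le_succ)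
    have h2 : seedsAt ω (n + 1) = seedsAt ω' (n + 1) := by
      funext r b j
      exact h _ le_rfl r b j
    simp only [rpuAt, h1, h2]

end Congr

section Round

variable {X : Type*} [MeasurableSpace X] {k : ℕ} [NeZero k] (A : Setup X k)

/-- The confidence parameter of round `r` of Passive-RPU-MDL in epoch `n + 1`. -/
def roundDelta (n r : ℕ) : ℝ := A.deltaAt (n + 1) / (2 * ((r : ℝ) + 1) ^ 2)

/-- The distributions active in round `r` of epoch `n + 1`. -/
def actAt (ω : Tape X k) (n r : ℕ) : Finset (Fin k) :=
  A.active (A.rpuAt ω n) (epsAt (n + 1)) (A.deltaAt (n + 1)) (seedsAt ω (n + 1)) r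

/-- The example with seed `σ` in round `r` of epoch `n + 1`. -/
def drawAt (ω : Tape X k) (n r : ℕ) (σ : Seed X k) : X × Bool :=
  mix (fun i => if i ∈ A.actAt ω n r then 1 else 0) σ

/-- The imputed examples in round `r` of epoch `n + 1`. -/
def sampleAt (ω : Tape X k) (n r b j : ℕ) : X × Bool :=
  impute (A.rpuAt ω n) (A.drawAt ω n r (ω (Slot.rpu (n + 1) r b j)))

/-- The classifier obtained in round `r` of epoch `n + 1`. -/
def roundAt (ω : Tape X k) (n r : ℕ) : X → Option Bool :=
  robustRPULearn A.H A.c A.s (epsAt (n + 1) / 2) (A.roundDelta n r) (A.sampleAt ω n r)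

/-- The number of label queries in round `r` of epoch `n + 1`. -/
def roundLabels (ω : Tape X k) (n r : ℕ) : ℕ :=
  ∑ b ∈ Finset.range (batches (A.roundDelta n r)),
    ∑ j ∈ Finset.range (batchSize A.c A.s (epsAt (n + 1) / 2)),
      cost (A.rpuAt ω n) (A.drawAt ω n r (ω (Slot.rpu (n + 1) r b j)))

/-- The slots of round `r` of epoch `n + 1`. -/
def roundSlots (k n r : ℕ) : Set (Slot k) :=
  Set.range fun q : ℕ × ℕ => Slot.rpu (n + 1) r q.1 q.2

lemma rpuAt_merge (ω ω' : Tape X k) (n r : ℕ) :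
    A.rpuAt (merge (roundSlots k n r) ω ω') n = A.rpuAt ω n := by
  refine A.rpuAt_congr fun n' hn' r' b j => merge_of_notMem ?_ _ _
  rintro ⟨q, hq⟩
  simp only [Slot.rpu.injEq] at hq
  omega

lemma actAt_merge (ω ω' : Tape X k) (n r : ℕ) :
    A.actAt (merge (roundSlots k n r) ω ω') n r = A.actAt ω n r := by
  rw [actAt, rpuAt_merge]
  refine A.active_congr _ _ _ fun r' hr' => ?_
  funext b j
  refine merge_of_notMem ?_ _ _
  rintro ⟨q, hq⟩
  simp only [Slot.rpu.injEq] at hq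
  omega

lemma sampleAt_merge (ω ω' : Tape X k) (n r : ℕ) :
    A.sampleAt (merge (roundSlots k n r) ω ω') n r
      = fun b j => impute (A.rpuAt ω n) (A.drawAt ω n r (ω' (Slot.rpu (n + 1) r b j))) := by
  funext b j
  have : merge (roundSlots k n r) ω ω' (Slot.rpu (n + 1) r b j) = ω' (Slot.rpu (n + 1) r b j) :=
    merge_of_mem (I := roundSlots k n r) ⟨(b, j), rfl⟩ _ _
  rw [sampleAt, drawAt, actAt_merge, rpuAt_merge, this, drawAt]

/-- The failure event of round `r` in epoch `n + 1`: imputation has not increased the error of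
`hstar`, but many batches contain a mistake of `hstar`, or the classifier of the round abstains too
often on the mixture. -/
def badRound (hstar : X → Bool) (n r : ℕ) : Set (Tape X k) :=
  {ω | (∀ i, A.D i {z | hstar z.1 ≠ (impute (A.rpuAt ω n) z).2}
        ≤ ENNReal.ofReal (mdErr A.D hstar)) ∧
    (6 * ⌈Real.log (1 / A.roundDelta n r)⌉₊
        < hits (Finset.range (batches (A.roundDelta n r)))
          (fun _ => unclean hstar (batchSize A.c A.s (epsAt (n + 1) / 2))) (A.sampleAt ω n r) ∨
      ENNReal.ofReal (9 / 10 * epsAt (n + 1))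
        < seedMeasure A.D {σ | A.roundAt ω n r (A.drawAt ω n r σ).1 = none})}

/-- The event that imputation saves labels, but many are queried in round `r` of epoch `n + 1`. -/
def badRoundLabels (n r : ℕ) : Set (Tape X k) :=
  {ω | (∀ i, (A.D i).fst {x | A.rpuAt ω n x = none} ≤ ENNReal.ofReal (2 * epsAt (n + 1))) ∧
    3 * (480 * (⌈Real.log (1 / A.roundDelta n r)⌉₊ : ℝ) * A.s) ≤ A.roundLabels ω n r}

variable {A} (hH : PointwiseMeasurable A.H) [∀ i, IsProbabilityMeasure (A.D i)]

include hH

lemma measurable_actAt (n r : ℕ) : Measurable fun ω => A.actAt ω n r :=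
  A.measurable_active hH (f := fun ω => A.rpuAt ω n) (A.measurable_rpuAt hH n) _ _
    (σ := fun ω => seedsAt ω (n + 1)) (by unfold seedsAt; fun_prop) r

lemma measurable_drawAt {Ω : Type*} [MeasurableSpace Ω] {ω : Ω → Tape X k} (hω : Measurable ω)
    (n r : ℕ) {σ : Ω → Seed X k} (hσ : Measurable σ) :
    Measurable fun x => A.drawAt (ω x) n r (σ x) :=
  measurable_mix (measurable_indicatorWeights ((measurable_actAt hH n r).comp hω)) hσ

lemma measurable_rpuAt_right (ω : Tape X k) (n : ℕ) : Measurable (A.rpuAt ω n) :=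
  (A.measurable_rpuAt hH n).comp measurable_prodMk_left

lemma measurable_sampleAt (n r : ℕ) : Measurable fun ω => A.sampleAt ω n r := by
  refine measurable_pi_lambda _ fun b => measurable_pi_lambda _ fun j => ?_
  have h1 : Measurable fun ω : Tape X k => ω (Slot.rpu (n + 1) r b j) := by fun_prop
  exact measurable_impute (f := fun ω => A.rpuAt ω n) (A.measurable_rpuAt hH n)
    (measurable_drawAt hH measurable_id n r h1)

lemma measurable_roundAt (n r : ℕ) :
    Measurable fun q : Tape X k × X => A.roundAt q.1 n r q.2 := by
  have h1 : Measurable fun q : Tape X k × X => (A.sampleAt q.1 n r, q.2) :=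
    ((measurable_sampleAt hH n r).comp measurable_fst).prodMk measurable_snd
  have h2 :=
    (measurable_robustRPULearn hH A.c A.s (epsAt (n + 1) / 2) (A.roundDelta n r)).comp h1
  exact h2

/-- The set of examples on which imputation leaves a mistake of `hstar` depends measurably on the
tape. -/
lemma measurableSet_noise {hstar : X → Bool} (hs : hstar ∈ A.H) (n : ℕ) :
    MeasurableSet {q : Tape X k × (X × Bool) | hstar q.2.1 ≠ (impute (A.rpuAt q.1 n) q.2).2} := by
  have h1 : Measurable fun q : Tape X k × (X × Bool) => impute (A.rpuAt q.1 n) q.2 :=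
    measurable_impute (Ω := Tape X k × (X × Bool)) (f := fun q => A.rpuAt q.1 n)
      ((A.measurable_rpuAt hH n).comp
        ((measurable_fst.comp measurable_fst).prodMk measurable_snd)) measurable_snd
  exact (measurableSet_eq_fun ((hH.1 _ hs).comp (measurable_fst.comp measurable_snd))
    (measurable_snd.comp h1)).compl

lemma measurableSet_noiseOK {hstar : X → Bool} (hs : hstar ∈ A.H) (n : ℕ) :
    MeasurableSet {ω | ∀ i, A.D i {z | hstar z.1 ≠ (impute (A.rpuAt ω n) z).2}
        ≤ ENNReal.ofReal (mdErr A.D hstar)} := by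
  have : {ω | ∀ i, A.D i {z | hstar z.1 ≠ (impute (A.rpuAt ω n) z).2}
        ≤ ENNReal.ofReal (mdErr A.D hstar)}
      = ⋂ i, {ω | A.D i {z | hstar z.1 ≠ (impute (A.rpuAt ω n) z).2}
        ≤ ENNReal.ofReal (mdErr A.D hstar)} := by ext; simp
  rw [this]
  exact MeasurableSet.iInter fun i => measurableSet_le
    (measurable_measure_prodMk_left (measurableSet_noise hH hs n)) measurable_const

lemma measurableSet_abstainsOK (n : ℕ) (b : ℝ) :
    MeasurableSet {ω | ∀ i, (A.D i).fst {x | A.rpuAt ω n x = none} ≤ ENNReal.ofReal b} := by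
  have : {ω | ∀ i, (A.D i).fst {x | A.rpuAt ω n x = none} ≤ ENNReal.ofReal b}
      = ⋂ i, {ω | (A.D i).fst {x | A.rpuAt ω n x = none} ≤ ENNReal.ofReal b} := by ext; simp
  rw [this]
  exact MeasurableSet.iInter fun i => measurableSet_le
    (measurable_measure_prodMk_left (A.measurable_rpuAt hH n (measurableSet_singleton none)))
    measurable_const

lemma measurableSet_badRound {hstar : X → Bool} (hs : hstar ∈ A.H) (n r : ℕ) :
    MeasurableSet (A.badRound hstar n r) := by
  have h1 : MeasurableSet {q : Tape X k × Seed X k |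
      A.roundAt q.1 n r (A.drawAt q.1 n r q.2).1 = none} :=
    ((measurable_roundAt hH n r).comp (measurable_fst.prodMk
      (measurable_drawAt hH measurable_fst n r measurable_snd).fst)) (measurableSet_singleton none)
  have h2 : Measurable fun ω => hits (Finset.range (batches (A.roundDelta n r)))
      (fun _ => unclean hstar (batchSize A.c A.s (epsAt (n + 1) / 2))) (A.sampleAt ω n r) :=
    (measurable_hits _ fun _ => measurableSet_unclean (hH.1 _ hs) _).comp
      (measurable_sampleAt hH n r)
  exact (measurableSet_noiseOK hH hs n).inter
    ((measurableSet_lt measurable_const h2).union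
      (measurableSet_lt measurable_const (measurable_measure_prodMk_left h1)))

lemma measurableSet_badRoundLabels (n r : ℕ) :
    MeasurableSet (A.badRoundLabels n r) := by
  have h1 : Measurable fun ω => A.roundLabels ω n r := by
    refine Finset.measurable_sum _ fun b _ => Finset.measurable_sum _ fun j _ => ?_
    have h1 : Measurable fun ω : Tape X k => ω (Slot.rpu (n + 1) r b j) := by fun_prop
    exact measurable_cost (f := fun ω => A.rpuAt ω n) (A.measurable_rpuAt hH n)
      (measurable_drawAt hH measurable_id n r h1)
  have h2 : Measurable fun ω => (A.roundLabels ω n r : ℝ) := measurable_from_top.comp h1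
  exact (measurableSet_abstainsOK hH n _).inter (measurableSet_le measurable_const h2)

omit hH [∀ i, IsProbabilityMeasure (A.D i)] in
lemma mdErr_nonneg (hstar : X → Bool) : 0 ≤ mdErr A.D hstar :=
  measureReal_nonneg.trans (err_le_mdErr A.D hstar 0)

omit [NeZero k] hH [∀ i, IsProbabilityMeasure (A.D i)] in
lemma batchSize_epsAt (s n : ℕ) : batchSize 2 s (epsAt (n + 1) / 2) = 4 * s * 2 ^ (n + 1) := by
  have : (2 : ℝ) * s / (epsAt (n + 1) / 2) = ((4 * s * 2 ^ (n + 1) : ℕ) : ℝ) := by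
    simp only [epsAt, one_div, inv_pow]
    push_cast
    field_simp
    ring
  rw [batchSize, this, Nat.ceil_natCast]

/-- Given the seeds of all other slots, the examples of the round are independent draws from the
mixture, and `robust_tail` applies. -/
lemma badRound_le {hstar : X → Bool} (hs : hstar ∈ A.H) (hstarno : starNumber A.H hstar ≤ A.s)
    (hc : A.c = 2) {n r : ℕ} (hν : 4 * A.s * 2 ^ (n + 1) * mdErr A.D hstar ≤ 1 / 25)
    (hδ : 1 ≤ ⌈Real.log (1 / A.roundDelta n r)⌉₊) :
    tapeMeasure A.D (A.badRound hstar n r)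
      ≤ ENNReal.ofReal (3 / 4 * Real.exp (-(⌈Real.log (1 / A.roundDelta n r)⌉₊ : ℝ))) := by
  set L := ⌈Real.log (1 / A.roundDelta n r)⌉₊
  have hm : batchSize A.c A.s (epsAt (n + 1) / 2) = 4 * A.s * 2 ^ (n + 1) := by
    rw [hc, batchSize_epsAt]
  have hξ0 : (0 : ℝ) < epsAt (n + 1) := by unfold epsAt; positivity
  refine tape_le_of_resample A.D (roundSlots k n r) (measurableSet_badRound hH hs n r) fun ω => ?_
  by_cases hnoise : ∀ i, A.D i {z | hstar z.1 ≠ (impute (A.rpuAt ω n) z).2}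
        ≤ ENNReal.ofReal (mdErr A.D hstar)
  swap
  · rw [show {ω' | merge (roundSlots k n r) ω ω' ∈ A.badRound hstar n r} = ∅ from
      Set.eq_empty_of_forall_notMem fun ω' hω' => hnoise (by
        have := hω'.1
        rwa [rpuAt_merge] at this)]
    simp
  have hdraw : Measurable (A.drawAt ω n r) :=
    measurable_drawAt hH measurable_const n r measurable_id
  have hf := measurable_rpuAt_right hH ω n
  let g : Seed X k → X × Bool := fun σ => impute (A.rpuAt ω n) (A.drawAt ω n r σ)
  have hg : Measurable g := (measurable_impute_right hf).comp hdraw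
  have hprob : IsProbabilityMeasure ((seedMeasure A.D).map g) :=
    Measure.isProbabilityMeasure_map hg.aemeasurable
  have herr : err ((seedMeasure A.D).map g) hstar ≤ mdErr A.D hstar := by
    have hA : MeasurableSet {z : X × Bool | hstar z.1 ≠ (impute (A.rpuAt ω n) z).2} :=
      measurable_prodMk_left (measurableSet_noise hH hs n)
    have h1 := seedMeasure_mix_le A.D (fun i => if i ∈ A.actAt ω n r then 1 else 0) hA hnoise
    rw [err, map_measureReal_apply hg (measurableSet_wrong (hH.1 _ hs))]
    exact ENNReal.toReal_le_of_le_ofReal (mdErr_nonneg _) h1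
  have hη : ((4 * A.s * 2 ^ (n + 1) : ℕ) : ℝ) * err ((seedMeasure A.D).map g) hstar ≤ 1 / 25 := by
    refine le_trans ?_ hν
    push_cast
    exact mul_le_mul_of_nonneg_left herr (by positivity)
  have hξ : 4 * (A.s : ℝ) ≤ epsAt (n + 1) * ((4 * A.s * 2 ^ (n + 1) : ℕ) : ℝ) := by
    simp only [epsAt, one_div, inv_pow]
    push_cast
    field_simp
    exact le_rfl
  have key := robust_tail hH hs hstarno ((seedMeasure A.D).map g) hξ hξ0 hη hδ
  rw [← map_batches A.D (injective_roundSlot (n + 1) r) hg] at key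
  have hΨ : Measurable fun (ω' : Tape X k) (b j : ℕ) => g (ω' (Slot.rpu (n + 1) r b j)) := by
    fun_prop
  refine (measure_mono ?_).trans ((Measure.le_map_apply hΨ.aemeasurable _).trans key)
  rintro ω' ⟨-, hω'⟩
  have hbatch : batches (A.roundDelta n r) = 60 * L := rfl
  rw [sampleAt_merge] at hω'
  rw [hm, hbatch] at hω'
  refine hω'.imp id fun h => h.trans_le ?_
  have hround : ∀ σ, A.roundAt (merge (roundSlots k n r) ω ω') n r
      (A.drawAt (merge (roundSlots k n r) ω ω') n r σ).1
      = thresholdVote (60 * L) (fun b => unanimous (versionSpace A.H (4 * A.s * 2 ^ (n + 1))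
        fun j => g (ω' (Slot.rpu (n + 1) r b j)))) (g σ).1 := by
    intro σ
    simp only [roundAt, robustRPULearn, sampleAt_merge, drawAt, actAt_merge, hm, hbatch]
    rfl
  simp only [hround]
  exact Measure.le_map_apply hg.aemeasurable _

/-- Given the seeds of all other slots, each example of the round costs a label with probability at
most `2 * epsAt (n + 1)`, so that `480 ⌈log (1 / δ)⌉ s` labels are queried in expectation. -/
lemma badRoundLabels_le (hc : A.c = 2) (hs1 : 1 ≤ A.s) {n r : ℕ}
    (hδ : 1 ≤ ⌈Real.log (1 / A.roundDelta n r)⌉₊) :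
    tapeMeasure A.D (A.badRoundLabels n r)
      ≤ ENNReal.ofReal (1 / 4 * Real.exp (-(⌈Real.log (1 / A.roundDelta n r)⌉₊ : ℝ))) := by
  set L := ⌈Real.log (1 / A.roundDelta n r)⌉₊
  have hL : (1 : ℝ) ≤ L := by exact_mod_cast hδ
  have hs1' : (1 : ℝ) ≤ A.s := by exact_mod_cast hs1
  have hm : batchSize A.c A.s (epsAt (n + 1) / 2) = 4 * A.s * 2 ^ (n + 1) := by
    rw [hc, batchSize_epsAt]
  have hξ0 : (0 : ℝ) < epsAt (n + 1) := by unfold epsAt; positivity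
  refine tape_le_of_resample A.D (roundSlots k n r) (measurableSet_badRoundLabels hH n r)
    fun ω => ?_
  by_cases habs : ∀ i, (A.D i).fst {x | A.rpuAt ω n x = none}
      ≤ ENNReal.ofReal (2 * epsAt (n + 1))
  swap
  · rw [show {ω' | merge (roundSlots k n r) ω ω' ∈ A.badRoundLabels n r} = ∅ from
      Set.eq_empty_of_forall_notMem fun ω' hω' => habs (by
        have := hω'.1
        rwa [rpuAt_merge] at this)]
    simp
  have hdraw : Measurable (A.drawAt ω n r) :=
    measurable_drawAt hH measurable_const n r measurable_id
  have hf := measurable_rpuAt_right hH ω n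
  set W : Set (X × Bool) := {z | A.rpuAt ω n z.1 = none}
  have hW : MeasurableSet W := (hf.comp measurable_fst) (measurableSet_singleton none)
  have hp : (seedMeasure A.D).real (A.drawAt ω n r ⁻¹' W) ≤ 2 * epsAt (n + 1) := by
    refine ENNReal.toReal_le_of_le_ofReal (by positivity) ?_
    refine seedMeasure_mix_le A.D _ hW fun i => ?_
    have h1 := habs i
    rwa [Measure.fst_apply (s := {x | A.rpuAt ω n x = none}) (hf (measurableSet_singleton none))]
      at h1
  have key := tape_hits_tail A.D (injective_roundSlot (n + 1) r)
    (Finset.range (60 * L) ×ˢ Finset.range (4 * A.s * 2 ^ (n + 1)))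
    (A := fun _ => A.drawAt ω n r ⁻¹' W) (fun _ => hdraw hW) (fun _ _ => hp)
    (B := 480 * (L : ℝ) * A.s) (by
      simp only [epsAt, one_div, inv_pow, Finset.card_product, Finset.card_range]
      push_cast
      field_simp
      norm_num) (by positivity)
  refine (measure_mono ?_).trans (key.trans (ENNReal.ofReal_le_ofReal ?_))
  · rintro ω' ⟨-, hω'⟩
    refine hω'.trans (le_of_eq ?_)
    congr 1
    rw [roundLabels, hits, Finset.card_filter, Finset.sum_product, hm]
    refine Finset.sum_congr rfl fun b _ => Finset.sum_congr rfl fun j _ => ?_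
    have : merge (roundSlots k n r) ω ω' (Slot.rpu (n + 1) r b j)
        = ω' (Slot.rpu (n + 1) r b j) := merge_of_mem (I := roundSlots k n r) ⟨(b, j), rfl⟩ _ _
    rw [drawAt, actAt_merge, rpuAt_merge, this, cost]
    exact if_congr Iff.rfl rfl rfl
  · have e : (1 / 4 : ℝ) = Real.exp (-(2 * Real.log 2)) := by
      rw [Real.exp_neg, two_mul, Real.exp_add, Real.exp_log (by norm_num)]; norm_num
    rw [e, ← Real.exp_add]
    refine Real.exp_le_exp.2 ?_
    have := Real.log_two_lt_d9
    nlinarith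

end Round

end Setup

/-! ### The epochs before the last one -/

/-- The confidences `δ / (2 n²)` add up to less than `δ`. -/
lemma sum_inv_sq_le (R : ℕ) :
    ∑ r ∈ Finset.range R, (1 : ℝ) / (2 * ((r : ℝ) + 1) ^ 2) ≤ 1 - 1 / ((R : ℝ) + 1) := by
  induction R with
  | zero => simp
  | succ R ih =>
    rw [Finset.sum_range_succ]
    refine (add_le_add_left ih _).trans ?_
    push_cast
    have h0 : (0 : ℝ) ≤ R := Nat.cast_nonneg R
    have e : (1 : ℝ) - 1 / (R + 1 + 1) - (1 - 1 / (R + 1)) - 1 / (2 * ((R : ℝ) + 1) ^ 2)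
        = R / (2 * (R + 1) ^ 2 * (R + 2)) := by
      field_simp
      ring
    have : (0 : ℝ) ≤ R / (2 * (R + 1) ^ 2 * (R + 2)) := by positivity
    linarith

/-- If `W` has probability at least `ξ` under some of the distributions, then it has a proportional
probability under the uniform mixture. -/
lemma card_mul_le_of_subset {X : Type*} [MeasurableSpace X] {k : ℕ} [NeZero k]
    (D : Fin k → Measure (X × Bool)) [∀ i, IsProbabilityMeasure (D i)] {N N' : Finset (Fin k)}
    (hN : N' ⊆ N) {W : Set (X × Bool)} (hW : MeasurableSet W) {ξ : ℝ}
    (h : ∀ i ∈ N', ξ ≤ (D i).real W) :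
    N'.card * ξ ≤ N.card * (seedMeasure D).real (mix (fun i => if i ∈ N then 1 else 0) ⁻¹' W) := by
  have h1 := sum_weights_le D (fun i => if i ∈ N then 1 else 0) hW
  have h3 : ∑ i, ((if i ∈ N then 1 else 0 : ℕ) : ℝ) = N.card := by simp
  rw [h3] at h1
  refine le_trans ?_ h1
  calc (N'.card : ℝ) * ξ = ∑ i ∈ N', ξ := by simp
    _ ≤ ∑ i ∈ N', ((if i ∈ N then 1 else 0 : ℕ) : ℝ) * (D i).real W := by
        refine Finset.sum_le_sum fun i hi => ?_
        rw [if_pos (hN hi), Nat.cast_one, one_mul]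
        exact h i hi
    _ ≤ _ := Finset.sum_le_sum_of_subset_of_nonneg (Finset.subset_univ _) fun i _ _ =>
        mul_nonneg (Nat.cast_nonneg _) measureReal_nonneg

namespace Setup

section Run

variable {X : Type*} [MeasurableSpace X] {k : ℕ} [NeZero k] {A : Setup X k}

omit [NeZero k] in
lemma roundDelta_pos (hδ : 0 < A.δ) (n r : ℕ) : 0 < A.roundDelta n r := by
  unfold roundDelta deltaAt
  positivity

omit [NeZero k] in
lemma deltaAt_le (hδ : 0 < A.δ) (n : ℕ) : A.deltaAt (n + 1) ≤ A.δ / 2 := by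
  unfold deltaAt
  refine div_le_div_of_nonneg_left hδ.le (by norm_num) ?_
  have : (1 : ℝ) ≤ ((n + 1 : ℕ) : ℝ) ^ 2 := one_le_pow₀ (by simp)
  linarith

omit [NeZero k] in
lemma one_le_ceil_log (hδ : 0 < A.δ) (hδ1 : A.δ < 1) (n r : ℕ) :
    1 ≤ ⌈Real.log (1 / A.roundDelta n r)⌉₊ := by
  rw [Nat.one_le_ceil_iff]
  refine Real.log_pos ?_
  rw [lt_one_div one_pos (roundDelta_pos hδ n r), div_one]
  have h1 : A.roundDelta n r ≤ A.deltaAt (n + 1) := by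
    unfold roundDelta
    refine div_le_self (by unfold deltaAt; positivity) ?_
    have : (1 : ℝ) ≤ ((r : ℝ) + 1) ^ 2 :=
      one_le_pow₀ (by linarith [(Nat.cast_nonneg r : (0 : ℝ) ≤ r)])
    linarith
  linarith [deltaAt_le hδ n]

omit [NeZero k] in
lemma exp_neg_ceil_le (hδ : 0 < A.δ) (n r : ℕ) :
    Real.exp (-(⌈Real.log (1 / A.roundDelta n r)⌉₊ : ℝ)) ≤ A.roundDelta n r := by
  have h1 := Nat.le_ceil (Real.log (1 / A.roundDelta n r))
  calc _ ≤ Real.exp (-Real.log (1 / A.roundDelta n r)) := Real.exp_le_exp.2 (neg_le_neg h1)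
    _ = _ := by
      rw [one_div, Real.log_inv, neg_neg, Real.exp_log (roundDelta_pos hδ n r)]

/-- In all epochs but the last one, the noise is small compared to the reliability target. -/
lemma two_pow_lt_of_lt_epochs (hs : 1 ≤ A.s) (hε : 0 < A.ε) {n : ℕ} (hn : n + 1 < A.epochs) :
    (A.s : ℝ) * 2 ^ (n + 1) * A.ε < A.d + k := by
  have hs' : (1 : ℝ) ≤ A.s := by exact_mod_cast hs
  have h1 : n + 1 < ⌈Real.logb 2 (((A.d : ℝ) + k) / (A.s * A.ε))⌉₊ := by
    unfold epochs at hn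
    omega
  rw [Nat.lt_ceil] at h1
  have hk : (0 : ℝ) < A.d + k := by
    have : (1 : ℝ) ≤ k := by exact_mod_cast Nat.one_le_iff_ne_zero.2 (NeZero.ne k)
    positivity
  have h2 : (0 : ℝ) < ((A.d : ℝ) + k) / (A.s * A.ε) := by positivity
  rw [Real.lt_logb_iff_rpow_lt (by norm_num) h2, Real.rpow_natCast,
    lt_div_iff₀ (by positivity)] at h1
  linarith

variable [∀ i, IsProbabilityMeasure (A.D i)] {hstar : X → Bool}

/-- The union of the failure events of Passive-RPU-MDL in epoch `n + 1`. -/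
def badEpoch (A : Setup X k) (hstar : X → Bool) (n : ℕ) : Set (Tape X k) :=
  ⋃ r, A.badRound hstar n r ∪ A.badRoundLabels n r

lemma badEpoch_le (hH : PointwiseMeasurable A.H) (hs : hstar ∈ A.H)
    (hstarno : starNumber A.H hstar ≤ A.s) (hc : A.c = 2) (hs1 : 1 ≤ A.s) (hδ : 0 < A.δ)
    (hδ1 : A.δ < 1) {n : ℕ} (hν : 4 * A.s * 2 ^ (n + 1) * mdErr A.D hstar ≤ 1 / 25) :
    tapeMeasure A.D (A.badEpoch hstar n) ≤ ENNReal.ofReal (A.deltaAt (n + 1)) := by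
  have hd : 0 ≤ A.deltaAt (n + 1) := by unfold deltaAt; positivity
  calc tapeMeasure A.D (A.badEpoch hstar n)
      ≤ ∑' r, tapeMeasure A.D (A.badRound hstar n r ∪ A.badRoundLabels n r) :=
        measure_iUnion_le _
    _ ≤ ∑' r, ENNReal.ofReal (A.roundDelta n r) := by
        refine ENNReal.tsum_le_tsum fun r => ?_
        have hL := one_le_ceil_log hδ hδ1 n r
        refine (measure_union_le _ _).trans ((add_le_add (badRound_le hH hs hstarno hc hν hL)
          (badRoundLabels_le hH hc hs1 hL)).trans ?_)
        rw [← ENNReal.ofReal_add (by positivity) (by positivity)]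
        refine ENNReal.ofReal_le_ofReal ?_
        linarith [exp_neg_ceil_le hδ n r]
    _ ≤ ENNReal.ofReal (A.deltaAt (n + 1)) := by
        refine ENNReal.tsum_le_of_sum_range_le fun R => ?_
        rw [← ENNReal.ofReal_sum_of_nonneg fun r _ => (roundDelta_pos hδ n r).le]
        refine ENNReal.ofReal_le_ofReal ?_
        have h1 := mul_le_mul_of_nonneg_left (sum_inv_sq_le R) hd
        rw [Finset.mul_sum] at h1
        calc ∑ r ∈ Finset.range R, A.roundDelta n r
            = ∑ r ∈ Finset.range R, A.deltaAt (n + 1) * (1 / (2 * ((r : ℝ) + 1) ^ 2)) := by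
              refine Finset.sum_congr rfl fun r _ => ?_
              rw [roundDelta, mul_one_div]
          _ ≤ A.deltaAt (n + 1) * (1 - 1 / (R + 1)) := h1
          _ ≤ A.deltaAt (n + 1) := by
              have : (0 : ℝ) ≤ 1 / ((R : ℝ) + 1) := by positivity
              nlinarith

omit [NeZero k] in
/-- Imputation with a reliable classifier does not increase the error of `hstar`. -/
lemma noise_le_of_reliable {f : X → Option Bool} (hf : Reliable hstar f) (i : Fin k) :
    A.D i {z | hstar z.1 ≠ (impute f z).2} ≤ ENNReal.ofReal (mdErr A.D hstar) := by
  calc A.D i {z | hstar z.1 ≠ (impute f z).2} ≤ A.D i {z | hstar z.1 ≠ z.2} := by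
        refine measure_mono fun z hz => ?_
        by_cases hn : f z.1 = none
        · simpa [impute, hn] using hz
        · exact absurd (hf.getD_eq hn z.2).symm hz
    _ = ENNReal.ofReal (err (A.D i) hstar) := by rw [err, ofReal_measureReal]
    _ ≤ _ := ENNReal.ofReal_le_ofReal (err_le_mdErr A.D hstar i)

lemma hits_le_of_notMem_badRound {ω : Tape X k} {n r : ℕ} (hω : ω ∉ A.badRound hstar n r)
    (hf : Reliable hstar (A.rpuAt ω n)) :
    hits (Finset.range (batches (A.roundDelta n r)))
        (fun _ => unclean hstar (batchSize A.c A.s (epsAt (n + 1) / 2))) (A.sampleAt ω n r)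
      ≤ 6 * ⌈Real.log (1 / A.roundDelta n r)⌉₊ ∧
    seedMeasure A.D {σ | A.roundAt ω n r (A.drawAt ω n r σ).1 = none}
      ≤ ENNReal.ofReal (9 / 10 * epsAt (n + 1)) := by
  by_contra hcon
  rw [not_and_or, not_le, not_le] at hcon
  exact hω ⟨noise_le_of_reliable hf, hcon⟩

lemma reliable_roundAt (hs : hstar ∈ A.H) {ω : Tape X k} {n r : ℕ}
    (hω : ω ∉ A.badRound hstar n r) (hf : Reliable hstar (A.rpuAt ω n)) :
    Reliable hstar (A.roundAt ω n r) := fun x =>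
  (thresholdVote_spec hs (hits_le_of_notMem_badRound hω hf).1 x).1

omit [∀ i, IsProbabilityMeasure (A.D i)] in
lemma actAt_succ (ω : Tape X k) (n r : ℕ) :
    A.actAt ω n (r + 1) = (A.actAt ω n r).filter fun i =>
      ¬ (A.D i).fst {x | A.roundAt ω n r x = none} ≤ ENNReal.ofReal (epsAt (n + 1)) := by
  ext i
  simp only [actAt, active, Finset.mem_filter]
  rfl

/-- By Markov's inequality, each round removes a tenth of the active distributions. -/
lemma card_actAt_succ_le (hH : PointwiseMeasurable A.H) {ω : Tape X k} {n r : ℕ}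
    (hω : ω ∉ A.badRound hstar n r) (hf : Reliable hstar (A.rpuAt ω n)) :
    ((A.actAt ω n (r + 1)).card : ℝ) ≤ 9 / 10 * (A.actAt ω n r).card := by
  have hξ0 : (0 : ℝ) < epsAt (n + 1) := by unfold epsAt; positivity
  have hmass := (hits_le_of_notMem_badRound hω hf).2
  have hR : MeasurableSet {x | A.roundAt ω n r x = none} :=
    measurable_prodMk_left (measurable_roundAt hH n r (measurableSet_singleton none))
  have hW : MeasurableSet {z : X × Bool | A.roundAt ω n r z.1 = none} := measurable_fst hR
  have h2 : (seedMeasure A.D).real (mix (fun i => if i ∈ A.actAt ω n r then 1 else 0) ⁻¹'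
      {z : X × Bool | A.roundAt ω n r z.1 = none}) ≤ 9 / 10 * epsAt (n + 1) :=
    ENNReal.toReal_le_of_le_ofReal (by positivity) hmass
  have h4 : ∀ i ∈ A.actAt ω n (r + 1),
      epsAt (n + 1) ≤ (A.D i).real {z : X × Bool | A.roundAt ω n r z.1 = none} := by
    intro i hi
    rw [actAt_succ, Finset.mem_filter] at hi
    have h5 := (not_le.1 hi.2).le
    rw [Measure.fst_apply hR] at h5
    exact (ENNReal.ofReal_le_iff_le_toReal (measure_ne_top _ _)).1 h5
  have hsub : A.actAt ω n (r + 1) ⊆ A.actAt ω n r := by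
    rw [actAt_succ]
    exact Finset.filter_subset _ _
  have h7 := card_mul_le_of_subset A.D hsub hW h4
  have h8 := mul_le_mul_of_nonneg_left h2 (Nat.cast_nonneg (A.actAt ω n r).card)
  refine le_of_mul_le_mul_right ?_ hξ0
  linarith

/-- A bound on the number of rounds of Passive-RPU-MDL: the least natural number `r` such that
`r > 10 log k`, hence `(9 / 10) ^ r * k < 1`. -/
def maxRounds (k : ℕ) : ℕ := ⌊10 * Real.log k⌋₊ + 1

lemma actAt_maxRounds (hH : PointwiseMeasurable A.H) {ω : Tape X k} {n : ℕ}
    (hω : ω ∉ A.badEpoch hstar n) (hf : Reliable hstar (A.rpuAt ω n)) :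
    A.actAt ω n (maxRounds k) = ∅ := by
  have hω' : ∀ r, ω ∉ A.badRound hstar n r := fun r hr =>
    hω (Set.mem_iUnion.2 ⟨r, Or.inl hr⟩)
  have h1 : ∀ r, ((A.actAt ω n r).card : ℝ) ≤ (9 / 10) ^ r * k := by
    intro r
    induction r with
    | zero => simp [actAt, active]
    | succ r ih =>
      refine (card_actAt_succ_le hH (hω' r) hf).trans ?_
      rw [pow_succ]
      linarith
  have hk : (0 : ℝ) < k := by exact_mod_cast Nat.pos_of_ne_zero (NeZero.ne k)
  have h2 : (9 / 10 : ℝ) ^ maxRounds k * k < 1 := by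
    have h3 : 10 * Real.log k < maxRounds k := by
      unfold maxRounds
      push_cast
      exact Nat.lt_floor_add_one _
    have h4 : (9 / 10 : ℝ) ≤ Real.exp (-(1 / 10)) := by
      have := Real.add_one_le_exp (-(1 / 10 : ℝ))
      linarith
    calc (9 / 10 : ℝ) ^ maxRounds k * k ≤ Real.exp (-(1 / 10)) ^ maxRounds k * k :=
          mul_le_mul_of_nonneg_right (pow_le_pow_left₀ (by norm_num) h4 _) hk.le
      _ = Real.exp (maxRounds k * -(1 / 10) + Real.log k) := by
          rw [Real.exp_add, Real.exp_log hk, ← Real.exp_nat_mul]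
      _ < 1 := Real.exp_lt_one_iff.2 (by linarith)
  have h5 := (h1 (maxRounds k)).trans_lt h2
  rw [← Finset.card_eq_zero]
  have : (A.actAt ω n (maxRounds k)).card < 1 := by exact_mod_cast h5
  omega

lemma rounds_le_maxRounds (hH : PointwiseMeasurable A.H) {ω : Tape X k} {n : ℕ}
    (hω : ω ∉ A.badEpoch hstar n) (hf : Reliable hstar (A.rpuAt ω n)) :
    A.rounds (A.rpuAt ω n) (epsAt (n + 1)) (A.deltaAt (n + 1)) (seedsAt ω (n + 1))
      ≤ maxRounds k :=
  Nat.sInf_le (actAt_maxRounds hH hω hf)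

lemma actAt_rounds (hH : PointwiseMeasurable A.H) {ω : Tape X k} {n : ℕ}
    (hω : ω ∉ A.badEpoch hstar n) (hf : Reliable hstar (A.rpuAt ω n)) :
    A.actAt ω n (A.rounds (A.rpuAt ω n) (epsAt (n + 1)) (A.deltaAt (n + 1))
      (seedsAt ω (n + 1))) = ∅ :=
  Nat.sInf_mem (s := {r | A.active (A.rpuAt ω n) (epsAt (n + 1)) (A.deltaAt (n + 1))
    (seedsAt ω (n + 1)) r = ∅}) ⟨_, actAt_maxRounds hH hω hf⟩

lemma reliable_rpuAt_succ (hs : hstar ∈ A.H) {ω : Tape X k} {n : ℕ}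
    (hω : ω ∉ A.badEpoch hstar n) (hf : Reliable hstar (A.rpuAt ω n)) :
    Reliable hstar (A.rpuAt ω (n + 1)) := by
  intro x
  simp only [rpuAt, passiveRPU]
  split_ifs with h
  · exact reliable_roundAt hs (fun hr => hω (Set.mem_iUnion.2 ⟨_, Or.inl hr⟩)) hf x
  · simp

/-- Each distribution is removed in a round whose classifier seldom abstains on it, and the combined
classifier abstains less often than that one. -/
lemma abstains_rpuAt_succ (hH : PointwiseMeasurable A.H) {ω : Tape X k} {n : ℕ}
    (hω : ω ∉ A.badEpoch hstar n) (hf : Reliable hstar (A.rpuAt ω n)) (i : Fin k) :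
    (A.D i).fst {x | A.rpuAt ω (n + 1) x = none} ≤ ENNReal.ofReal (epsAt (n + 1)) := by
  set R := A.rounds (A.rpuAt ω n) (epsAt (n + 1)) (A.deltaAt (n + 1)) (seedsAt ω (n + 1))
  have hex : ∃ r < R, (A.D i).fst {x | A.roundAt ω n r x = none}
      ≤ ENNReal.ofReal (epsAt (n + 1)) := by
    by_contra hcon
    push Not at hcon
    have h1 : ∀ r ≤ R, i ∈ A.actAt ω n r := by
      intro r
      induction r with
      | zero => intro _; simp [actAt, active]
      | succ r ih =>
        intro hr
        rw [actAt_succ, Finset.mem_filter]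
        exact ⟨ih (by omega), not_le.2 (hcon r (by omega))⟩
    have h2 := h1 R le_rfl
    rw [actAt_rounds hH hω hf] at h2
    simp at h2
  obtain ⟨r, hr, hle⟩ := hex
  refine (measure_mono fun x hx => ?_).trans hle
  by_contra hne
  have hex' : ∃ r < R, A.roundAt ω n r x ≠ none := ⟨r, hr, hne⟩
  have h3 : A.rpuAt ω (n + 1) x
      = A.roundAt ω n (sInf {r | r < R ∧ A.roundAt ω n r x ≠ none}) x := if_pos hex'
  have h4 := Nat.sInf_mem (s := {r | r < R ∧ A.roundAt ω n r x ≠ none}) hex'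
  exact h4.2 (h3.symm.trans hx)

omit [∀ i, IsProbabilityMeasure (A.D i)] in
lemma labelsRPU_eq (ω : Tape X k) (n : ℕ) :
    A.labelsRPU (A.rpuAt ω n) (epsAt (n + 1)) (A.deltaAt (n + 1)) (seedsAt ω (n + 1))
      = ∑ r ∈ Finset.range (A.rounds (A.rpuAt ω n) (epsAt (n + 1)) (A.deltaAt (n + 1))
          (seedsAt ω (n + 1))), A.roundLabels ω n r := rfl

/-- The labels queried in an epoch before the last one, if the previous epoch has succeeded. -/
lemma labelsRPU_le (hH : PointwiseMeasurable A.H) {ω : Tape X k} {n : ℕ}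
    (hω : ω ∉ A.badEpoch hstar n) (hf : Reliable hstar (A.rpuAt ω n))
    (habs : ∀ i, (A.D i).fst {x | A.rpuAt ω n x = none} ≤ ENNReal.ofReal (2 * epsAt (n + 1))) :
    (A.labelsRPU (A.rpuAt ω n) (epsAt (n + 1)) (A.deltaAt (n + 1)) (seedsAt ω (n + 1)) : ℝ)
      ≤ ∑ r ∈ Finset.range (maxRounds k),
          1440 * (⌈Real.log (1 / A.roundDelta n r)⌉₊ : ℝ) * A.s := by
  rw [labelsRPU_eq]
  push_cast
  refine (Finset.sum_le_sum fun r _ => ?_).trans (Finset.sum_le_sum_of_subset_of_nonneg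
    (Finset.range_mono (rounds_le_maxRounds hH hω hf)) fun r _ _ => by positivity)
  by_contra hcon
  refine hω (Set.mem_iUnion.2 ⟨r, Or.inr ⟨habs, ?_⟩⟩)
  linarith [not_le.1 hcon]

/-- On the complement of the failure events, the classifiers of all epochs are reliable and abstain
as seldom as they should. -/
lemma rpuAt_spec (hH : PointwiseMeasurable A.H) (hs : hstar ∈ A.H) {ω : Tape X k} {n : ℕ}
    (hω : ∀ n' < n, ω ∉ A.badEpoch hstar n') :
    Reliable hstar (A.rpuAt ω n) ∧
      ∀ i, (A.D i).fst {x | A.rpuAt ω n x = none} ≤ ENNReal.ofReal (epsAt n) := by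
  induction n with
  | zero =>
    refine ⟨fun x => by simp [rpuAt], fun i => ?_⟩
    simp only [epsAt, pow_zero, ENNReal.ofReal_one]
    exact prob_le_one
  | succ n ih =>
    have h1 := (ih fun n' hn' => hω n' (by omega)).1
    exact ⟨reliable_rpuAt_succ hs (hω n (by omega)) h1,
      abstains_rpuAt_succ hH (hω n (by omega)) h1⟩

end Run

end Setup

/-! ### Multiplicative weights and the majority vote -/

section Weights

variable {k : ℕ} {w : ℕ → Fin k → ℕ} {F : ℕ → Finset (Fin k)}

lemma weight_eq_two_pow (h0 : ∀ i, w 0 i = 1)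
    (hw : ∀ r i, w (r + 1) i = if i ∈ F r then 2 * w r i else w r i) (r : ℕ) (i : Fin k) :
    w r i = 2 ^ ((Finset.range r).filter fun r' => i ∈ F r').card := by
  induction r with
  | zero => simp [h0]
  | succ r ih =>
    rw [hw, Finset.range_add_one, Finset.filter_insert]
    split_ifs with h
    · rw [Finset.card_insert_of_notMem (by simp), pow_succ, ih, mul_comm]
    · exact ih

/-- If at most an eleventh of the weight fails in each round, then the total weight grows by a
factor of at most `12 / 11`. -/
lemma sum_weight_le (h0 : ∀ i, w 0 i = 1)
    (hw : ∀ r i, w (r + 1) i = if i ∈ F r then 2 * w r i else w r i) {t : ℕ}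
    (hF : ∀ r < t, 11 * ∑ i ∈ F r, w r i ≤ ∑ i, w r i) :
    11 ^ t * ∑ i, w t i ≤ 12 ^ t * k := by
  induction t with
  | zero => simp [h0]
  | succ t ih =>
    have h1 := ih fun r hr => hF r (by omega)
    have h2 : ∑ i, w (t + 1) i = ∑ i, w t i + ∑ i ∈ F t, w t i := by
      rw [← Finset.sum_filter_add_sum_filter_not Finset.univ (· ∈ F t)
        (fun i => w (t + 1) i), ← Finset.sum_filter_add_sum_filter_not Finset.univ (· ∈ F t)
        (fun i => w t i)]
      have e : Finset.univ.filter (· ∈ F t) = F t := by ext; simp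
      have h3 : ∀ i ∈ F t, w (t + 1) i = 2 * w t i := fun i hi => by rw [hw, if_pos hi]
      have h4 : ∀ i ∈ Finset.univ.filter (fun i => ¬ i ∈ F t), w (t + 1) i = w t i := fun i hi => by
        rw [hw, if_neg (Finset.mem_filter.1 hi).2]
      rw [e, Finset.sum_congr rfl h3, Finset.sum_congr rfl h4, ← Finset.mul_sum]
      ring
    have h3 := hF t (by omega)
    calc 11 ^ (t + 1) * ∑ i, w (t + 1) i
        = 11 ^ t * (11 * ∑ i, w t i + 11 * ∑ i ∈ F t, w t i) := by rw [h2]; ring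
      _ ≤ 11 ^ t * (11 * ∑ i, w t i + ∑ i, w t i) := by gcongr
      _ = 12 * (11 ^ t * ∑ i, w t i) := by ring
      _ ≤ 12 * (12 ^ t * k) := by gcongr
      _ = _ := by ring

/-- If the failing distributions always have little weight, then each of them fails in at most a
third of the rounds: its weight `2 ^ e` is at most the total weight `(12 / 11) ^ t * k`. -/
lemma card_fails_le (hk : 2 ≤ k) (h0 : ∀ i, w 0 i = 1)
    (hw : ∀ r i, w (r + 1) i = if i ∈ F r then 2 * w r i else w r i)
    (hF : ∀ r < Setup.mdlRounds k, 11 * ∑ i ∈ F r, w r i ≤ ∑ i, w r i) (i : Fin k) :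
    3 * ((Finset.range (Setup.mdlRounds k)).filter fun r => i ∈ F r).card ≤ Setup.mdlRounds k := by
  have h1 := sum_weight_le h0 hw hF
  set e := ((Finset.range (Setup.mdlRounds k)).filter fun r => i ∈ F r).card
  set a := ⌈Real.logb 2 k⌉₊
  have hk' : (2 : ℝ) ≤ k := by exact_mod_cast hk
  have ha : 1 ≤ a := Nat.one_le_ceil_iff.2 (Real.logb_pos (by norm_num) (by linarith))
  have ht : Setup.mdlRounds k = 5 * a := max_eq_right (by omega)
  have hka : k ≤ 2 ^ a := by
    have h2 : Real.logb 2 k ≤ a := Nat.le_ceil _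
    rw [Real.logb_le_iff_le_rpow (by norm_num) (by linarith), Real.rpow_natCast] at h2
    exact_mod_cast h2
  have h2 : 2 ^ e ≤ ∑ i, w (Setup.mdlRounds k) i := by
    rw [← weight_eq_two_pow h0 hw]
    exact Finset.single_le_sum (f := fun i => w (Setup.mdlRounds k) i) (fun _ _ => Nat.zero_le _)
      (Finset.mem_univ i)
  have h3 : 11 ^ (5 * a) * 2 ^ e ≤ 12 ^ (5 * a) * 2 ^ a := by
    rw [ht] at h1 h2
    calc _ ≤ 11 ^ (5 * a) * ∑ i, w (5 * a) i := by gcongr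
      _ ≤ 12 ^ (5 * a) * k := h1
      _ ≤ _ := by gcongr
  have h4 : (11 ^ 15) ^ a * 2 ^ (3 * e) ≤ (11 ^ 15) ^ a * 2 ^ (5 * a) :=
    calc (11 ^ 15) ^ a * 2 ^ (3 * e) = (11 ^ (5 * a) * 2 ^ e) ^ 3 := by
          rw [mul_pow, ← pow_mul, ← pow_mul, ← pow_mul]
          ring_nf
      _ ≤ (12 ^ (5 * a) * 2 ^ a) ^ 3 := by gcongr
      _ = (12 ^ 15 * 2 ^ 3) ^ a := by
          rw [mul_pow, mul_pow, ← pow_mul, ← pow_mul, ← pow_mul, ← pow_mul]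
          ring_nf
      -- five rounds for each bit of `k` are enough because `(12 / 11) ^ 15 ≤ 4`
      _ ≤ (11 ^ 15 * 2 ^ 5) ^ a := Nat.pow_le_pow_left (by norm_num) _
      _ = _ := by rw [mul_pow, pow_mul 2 5 a]
  have h5 := Nat.le_of_mul_le_mul_left h4 (by positivity)
  rw [ht]
  exact (Nat.pow_le_pow_iff_right (by norm_num)).1 h5

end Weights

lemma le_card_of_majority_ne {t : ℕ} {v : ℕ → Bool} {y : Bool}
    (h : decide (t < 2 * ((Finset.range t).filter fun r => v r = true).card) ≠ y) :
    t ≤ 2 * ((Finset.range t).filter fun r => v r ≠ y).card := by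
  have h1 := Finset.card_filter_add_card_filter_not (s := Finset.range t) (fun r => v r = true)
  rw [Finset.card_range] at h1
  cases y <;> simp_all <;> omega

/-- If all but a third of `t` voters err with probability at most `ζ / 6`, then the majority vote
errs with probability at most `ζ`: it needs `t / 2` wrong voters, of which `t / 6` are good ones.
-/
lemma measureReal_majority_le {Z : Type*} [MeasurableSpace Z] (μ : Measure Z)
    [IsProbabilityMeasure μ] {B : ℕ → Set Z} (hB : ∀ r, MeasurableSet (B r)) {t : ℕ} (ht : 1 ≤ t)
    {F : ℕ → Prop} (hF : 3 * ((Finset.range t).filter F).card ≤ t) {ζ : ℝ} (hζ : 0 ≤ ζ)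
    (h : ∀ r < t, ¬ F r → μ.real (B r) ≤ ζ / 6) :
    μ.real {z | t ≤ 2 * ((Finset.range t).filter fun r => z ∈ B r).card} ≤ ζ := by
  set G := (Finset.range t).filter fun r => ¬ F r
  have hG : G.card ≤ t := (Finset.card_filter_le _ _).trans (Finset.card_range t).le
  have h1 : (t : ENNReal) * μ {z | (t : ENNReal) ≤ ∑ r ∈ G, (B r).indicator (fun _ => 6) z}
      ≤ ∫⁻ z, ∑ r ∈ G, (B r).indicator (fun _ => 6) z ∂μ :=
    mul_meas_ge_le_lintegral (Finset.measurable_sum _ fun r _ =>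
      measurable_const.indicator (hB r)) _
  rw [lintegral_finsetSum _ fun r _ => measurable_const.indicator (hB r)] at h1
  have h2 : ∑ r ∈ G, ∫⁻ z, (B r).indicator (fun _ => 6) z ∂μ ≤ t * ENNReal.ofReal ζ := by
    calc _ ≤ ∑ r ∈ G, ENNReal.ofReal ζ := by
          refine Finset.sum_le_sum fun r hr => ?_
          have hr' := Finset.mem_filter.1 hr
          rw [lintegral_indicator_const (hB r), ← ofReal_measureReal,
            show (6 : ENNReal) = ENNReal.ofReal 6 by simp, ← ENNReal.ofReal_mul (by norm_num)]
          refine ENNReal.ofReal_le_ofReal ?_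
          linarith [h r (Finset.mem_range.1 hr'.1) hr'.2]
      _ = G.card * ENNReal.ofReal ζ := by simp
      _ ≤ _ := by gcongr
  have h3 : μ {z | (t : ENNReal) ≤ ∑ r ∈ G, (B r).indicator (fun _ => 6) z}
      ≤ ENNReal.ofReal ζ := by
    have ht0 : (t : ENNReal) ≠ 0 := by exact_mod_cast (by omega : t ≠ 0)
    exact (ENNReal.mul_le_mul_iff_right ht0 (ENNReal.natCast_ne_top t)).1 (h1.trans h2)
  refine ENNReal.toReal_le_of_le_ofReal hζ ((measure_mono fun z hz => ?_).trans h3)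
  have h4 : ((Finset.range t).filter fun r => z ∈ B r).card
      ≤ ((Finset.range t).filter F).card + (G.filter fun r => z ∈ B r).card := by
    refine (Finset.card_le_card ?_).trans (Finset.card_union_le _ _)
    intro r hr
    simp only [G, Finset.mem_union, Finset.mem_filter] at hr ⊢
    tauto
  have h5 : ∑ r ∈ G, (B r).indicator (fun _ => (6 : ENNReal)) z
      = ((6 * (G.filter fun r => z ∈ B r).card : ℕ) : ENNReal) := by
    rw [Finset.card_filter]
    push_cast
    rw [Finset.mul_sum]
    refine Finset.sum_congr rfl fun r _ => ?_
    by_cases hr : z ∈ B r <;> simp [hr]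
  rw [Set.mem_ofPred_eq] at hz ⊢
  rw [h5]
  exact_mod_cast (by omega : t ≤ 6 * (G.filter fun r => z ∈ B r).card)

/-! ### Passive-MDL within a run -/

section Tape

variable {X : Type*} [MeasurableSpace X] {k : ℕ} (D : Fin k → Measure (X × Bool))
  [∀ i, IsProbabilityMeasure (D i)]

lemma map_sample {κ : Type*} {e : κ → Slot k} (he : Function.Injective e) {Z : Type*}
    [MeasurableSpace Z] {g : Seed X k → Z} (hg : Measurable g) :
    (tapeMeasure D).map (fun ω q => g (ω (e q)))
      = Measure.infinitePi fun _ : κ => (seedMeasure D).map g := by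
  rw [← Measure.infinitePi_map_pi (fun _ : κ => seedMeasure D) (fun _ => hg), ← map_slots D he,
    Measure.map_map (by fun_prop) (by fun_prop)]
  rfl

lemma seedMeasure_eval (i : Fin k) {W : Set (X × Bool)} (hW : MeasurableSet W) :
    seedMeasure D {σ | σ.2 i ∈ W} = D i W := by
  have h1 : {σ : Seed X k | σ.2 i ∈ W} = Set.univ ×ˢ (Function.eval i ⁻¹' W) := by
    ext; simp
  rw [h1, seedMeasure, Measure.prod_prod, measure_univ, one_mul]
  exact (measurePreserving_eval D i).measure_preimage hW.nullMeasurableSet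

end Tape

namespace Setup

section Congr

variable {X : Type*} [MeasurableSpace X] {k : ℕ} [NeZero k] (A : Setup X k)

/-- The weights at the start of round `r` depend only on the seeds of earlier rounds. -/
lemma weights_congr (f : X → Option Bool) (ζ δ : ℝ) {τ τ' : ℕ → ℕ → Seed X k}
    {θ θ' : ℕ → Fin k → ℕ → Seed X k} {r : ℕ} (hτ : ∀ r' < r, τ r' = τ' r')
    (hθ : ∀ r' < r, θ r' = θ' r') : A.weights f ζ δ τ θ r = A.weights f ζ δ τ' θ' r := by
  induction r with
  | zero => rfl
  | succ r ih =>
    have h1 := ih (fun r' hr' => hτ r' (hr'.trans r.lt_succ_self))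
      (fun r' hr' => hθ r' (hr'.trans r.lt_succ_self))
    have h2 : ∀ w, A.mdlHyp f ζ δ τ r w = A.mdlHyp f ζ δ τ' r w := fun w => by
      simp only [mdlHyp, hτ r r.lt_succ_self]
    funext i
    simp only [weights, h1, h2, hθ r r.lt_succ_self]

end Congr

section MDL

variable {X : Type*} [MeasurableSpace X] {k : ℕ} [NeZero k] (A : Setup X k)

/-- The classifier used for imputation in the final call to Passive-MDL. -/
def finalRPU (ω : Tape X k) : X → Option Bool := A.rpuAt ω (A.epochs - 1)

/-- The weights at the start of round `r` of Passive-MDL. -/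
def weightsAt (ω : Tape X k) (r : ℕ) : Fin k → ℕ :=
  A.weights (A.finalRPU ω) A.ε (A.deltaAt A.epochs) (fun r j => ω (Slot.train r j))
    (fun r i j => ω (Slot.test r i j)) r

/-- The hypothesis learned in round `r` of Passive-MDL. -/
def hypAt (ω : Tape X k) (r : ℕ) : X → Bool :=
  A.mdlHyp (A.finalRPU ω) A.ε (A.deltaAt A.epochs) (fun r j => ω (Slot.train r j)) r
    (A.weightsAt ω r)

/-- The hypothesis of round `r` passes the test on the `i`-th distribution. -/
def PassesAt (ω : Tape X k) (r : ℕ) (i : Fin k) : Prop :=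
  A.PassesTest (A.finalRPU ω) A.ε (A.deltaAt A.epochs) (fun i j => ω (Slot.test r i j)) i
    (A.hypAt ω r)

/-- The examples whose imputed label is not predicted by the hypothesis of round `r`. -/
def wrongAt (ω : Tape X k) (r : ℕ) : Set (X × Bool) :=
  {z | A.hypAt ω r z.1 ≠ (impute (A.finalRPU ω) z).2}

/-- The number of labels queried for training in round `r` of Passive-MDL. -/
def trainLabelsAt (ω : Tape X k) (r : ℕ) : ℕ :=
  ∑ j ∈ Finset.range (A.trainSize A.ε (A.deltaAt A.epochs)),
    cost (A.finalRPU ω) (mix (A.weightsAt ω r) (ω (Slot.train r j)))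

/-- The number of labels queried for testing in round `r` of Passive-MDL. -/
def testLabelsAt (ω : Tape X k) (r : ℕ) : ℕ :=
  ∑ i, ∑ j ∈ Finset.range (A.testSize A.ε (A.deltaAt A.epochs)),
    cost (A.finalRPU ω) ((ω (Slot.test r i j)).2 i)

/-- Imputation has not increased the error of `hstar`, but the hypothesis of round `r` has error
more than `α` on the mixture. -/
def badTrain (hstar : X → Bool) (α : ℝ) (r : ℕ) : Set (Tape X k) :=
  {ω | (∀ i, A.D i {z | hstar z.1 ≠ (impute (A.finalRPU ω) z).2}
        ≤ ENNReal.ofReal (mdErr A.D hstar)) ∧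
    ENNReal.ofReal α < seedMeasure A.D (mix (A.weightsAt ω r) ⁻¹' A.wrongAt ω r)}

/-- The test of round `r` on the `i`-th distribution has the wrong outcome: a bad hypothesis passes
or a good one fails. -/
def badTest (r : ℕ) (i : Fin k) : Set (Tape X k) :=
  {ω | (A.PassesAt ω r i ∧ ENNReal.ofReal (A.ε / 6) < A.D i (A.wrongAt ω r)) ∨
    (¬ A.PassesAt ω r i ∧ A.D i (A.wrongAt ω r) ≤ ENNReal.ofReal (A.ε / 10))}

/-- Imputation saves labels, but many are queried for training in round `r`. -/
def badTrainLabels (B : ℝ) (r : ℕ) : Set (Tape X k) :=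
  {ω | (∀ i, (A.D i).fst {x | A.finalRPU ω x = none} ≤ ENNReal.ofReal (epsAt (A.epochs - 1))) ∧
    3 * B ≤ A.trainLabelsAt ω r}

/-- Imputation saves labels, but many are queried for testing in round `r`. -/
def badTestLabels (B : ℝ) (r : ℕ) : Set (Tape X k) :=
  {ω | (∀ i, (A.D i).fst {x | A.finalRPU ω x = none} ≤ ENNReal.ofReal (epsAt (A.epochs - 1))) ∧
    3 * B ≤ A.testLabelsAt ω r}

/-- The slots of the training examples of round `r`. -/
def trainSlots (k r : ℕ) : Set (Slot k) := Set.range fun j => Slot.train r j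

/-- The slots of the test examples of round `r`. -/
def testSlots (k r : ℕ) : Set (Slot k) := Set.range fun q : Fin k × ℕ => Slot.test r q.1 q.2

lemma finalRPU_merge_train (ω ω' : Tape X k) (r : ℕ) :
    A.finalRPU (merge (trainSlots k r) ω ω') = A.finalRPU ω :=
  A.rpuAt_congr fun _ _ _ _ _ => merge_of_notMem (by rintro ⟨q, hq⟩; cases hq) _ _

lemma finalRPU_merge_test (ω ω' : Tape X k) (r : ℕ) :
    A.finalRPU (merge (testSlots k r) ω ω') = A.finalRPU ω :=
  A.rpuAt_congr fun _ _ _ _ _ => merge_of_notMem (by rintro ⟨q, hq⟩; cases hq) _ _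

lemma weightsAt_merge_train (ω ω' : Tape X k) (r : ℕ) :
    A.weightsAt (merge (trainSlots k r) ω ω') r = A.weightsAt ω r := by
  rw [weightsAt, finalRPU_merge_train]
  refine A.weights_congr _ _ _ (fun r' hr' => ?_) (fun r' hr' => ?_)
  · funext j
    refine merge_of_notMem ?_ _ _
    rintro ⟨q, hq⟩
    simp only [Slot.train.injEq] at hq
    omega
  · funext i j
    refine merge_of_notMem ?_ _ _
    rintro ⟨q, hq⟩
    cases hq

lemma weightsAt_merge_test (ω ω' : Tape X k) (r : ℕ) :
    A.weightsAt (merge (testSlots k r) ω ω') r = A.weightsAt ω r := by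
  rw [weightsAt, finalRPU_merge_test]
  refine A.weights_congr _ _ _ (fun r' hr' => ?_) (fun r' hr' => ?_)
  · funext j
    refine merge_of_notMem ?_ _ _
    rintro ⟨q, hq⟩
    cases hq
  · funext i j
    refine merge_of_notMem ?_ _ _
    rintro ⟨q, hq⟩
    simp only [Slot.test.injEq] at hq
    omega

lemma hypAt_merge_test (ω ω' : Tape X k) (r : ℕ) :
    A.hypAt (merge (testSlots k r) ω ω') r = A.hypAt ω r := by
  rw [hypAt, weightsAt_merge_test, finalRPU_merge_test]
  have : (fun j => merge (testSlots k r) ω ω' (Slot.train r j)) = fun j => ω (Slot.train r j) := by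
    funext j
    refine merge_of_notMem ?_ _ _
    rintro ⟨q, hq⟩
    cases hq
  simp only [mdlHyp, hypAt]
  simp only [funext_iff] at this
  simp only [this]

lemma hypAt_merge_train (ω ω' : Tape X k) (r : ℕ) :
    A.hypAt (merge (trainSlots k r) ω ω') r
      = A.erm (A.trainSize A.ε (A.deltaAt A.epochs)) fun j =>
        impute (A.finalRPU ω) (mix (A.weightsAt ω r) (ω' (Slot.train r j))) := by
  have : ∀ j, merge (trainSlots k r) ω ω' (Slot.train r j) = ω' (Slot.train r j) := fun j =>
    merge_of_mem (I := trainSlots k r) ⟨j, rfl⟩ _ _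
  rw [hypAt, weightsAt_merge_train, finalRPU_merge_train]
  simp only [mdlHyp, this]

variable {A} (hH : PointwiseMeasurable A.H) (hE : IsERM A.H A.erm)
  [∀ i, IsProbabilityMeasure (A.D i)]

include hH

lemma measurable_finalRPU : Measurable fun q : Tape X k × X => A.finalRPU q.1 q.2 :=
  A.measurable_rpuAt hH _

lemma measurable_finalRPU_right (ω : Tape X k) : Measurable (A.finalRPU ω) :=
  measurable_rpuAt_right hH ω _

include hE

lemma measurable_weightsAt (r : ℕ) : Measurable fun ω => A.weightsAt ω r :=
  A.measurable_weights hE (f := A.finalRPU) (measurable_finalRPU hH) _ _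
    (τ := fun ω r j => ω (Slot.train r j)) (by fun_prop)
    (θ := fun ω r i j => ω (Slot.test r i j)) (by fun_prop) r

lemma measurable_hypAt (r : ℕ) : Measurable fun q : Tape X k × X => A.hypAt q.1 r q.2 := by
  have h := A.measurable_mdlHyp hE (f := A.finalRPU) (measurable_finalRPU hH) A.ε
    (A.deltaAt A.epochs) (τ := fun ω r j => ω (Slot.train r j)) (by fun_prop) r
    (w := fun ω => A.weightsAt ω r) (measurable_weightsAt hH hE r)
  exact h

lemma measurableSet_wrongAt (r : ℕ) :
    MeasurableSet {q : Tape X k × (X × Bool) | q.2 ∈ A.wrongAt q.1 r} := by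
  have h1 : Measurable fun q : Tape X k × (X × Bool) => impute (A.finalRPU q.1) q.2 :=
    measurable_impute (Ω := Tape X k × (X × Bool)) (f := fun q => A.finalRPU q.1)
      ((measurable_finalRPU hH).comp
        ((measurable_fst.comp measurable_fst).prodMk measurable_snd)) measurable_snd
  have h2 : Measurable fun q : Tape X k × (X × Bool) => A.hypAt q.1 r q.2.1 :=
    (measurable_hypAt hH hE r).comp
      (measurable_fst.prodMk (measurable_fst.comp measurable_snd))
  exact (measurableSet_eq_fun h2 (measurable_snd.comp h1)).compl

lemma measurableSet_wrongAt_right (ω : Tape X k) (r : ℕ) : MeasurableSet (A.wrongAt ω r) :=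
  measurable_prodMk_left (measurableSet_wrongAt hH hE r)

lemma measurableSet_badTrain {hstar : X → Bool} (hs : hstar ∈ A.H) (α : ℝ) (r : ℕ) :
    MeasurableSet (A.badTrain hstar α r) := by
  have h1 : Measurable fun q : Tape X k × Seed X k => mix (A.weightsAt q.1 r) q.2 :=
    measurable_mix ((measurable_weightsAt hH hE r).comp measurable_fst) measurable_snd
  have h2 : MeasurableSet {q : Tape X k × Seed X k |
      mix (A.weightsAt q.1 r) q.2 ∈ A.wrongAt q.1 r} :=
    (measurable_fst.prodMk h1) (measurableSet_wrongAt hH hE r)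
  exact (measurableSet_noiseOK hH hs _).inter
    (measurableSet_lt measurable_const (measurable_measure_prodMk_left h2))

lemma measurableSet_badTest (r : ℕ) (i : Fin k) : MeasurableSet (A.badTest r i) := by
  have h1 : MeasurableSet {ω | A.PassesAt ω r i} :=
    A.measurableSet_passesTest (f := A.finalRPU) (measurable_finalRPU hH) _ _
      (θ := fun ω i j => ω (Slot.test r i j)) (by fun_prop) i (h := fun ω => A.hypAt ω r)
      (measurable_hypAt hH hE r)
  have h2 : Measurable fun ω => A.D i (A.wrongAt ω r) :=
    measurable_measure_prodMk_left (measurableSet_wrongAt hH hE r)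
  exact (h1.inter (measurableSet_lt measurable_const h2)).union
    (h1.compl.inter (measurableSet_le h2 measurable_const))

lemma measurableSet_badTrainLabels (B : ℝ) (r : ℕ) :
    MeasurableSet (A.badTrainLabels B r) := by
  have h1 : Measurable fun ω => A.trainLabelsAt ω r := by
    refine Finset.measurable_sum _ fun j _ => ?_
    have h1 : Measurable fun ω : Tape X k => ω (Slot.train r j) := by fun_prop
    exact measurable_cost (f := A.finalRPU) (measurable_finalRPU hH)
      (measurable_mix (measurable_weightsAt hH hE r) h1)
  have h2 : Measurable fun ω => (A.trainLabelsAt ω r : ℝ) := measurable_from_top.comp h1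
  exact (measurableSet_abstainsOK hH _ _).inter (measurableSet_le measurable_const h2)

omit hE in
lemma measurableSet_badTestLabels (B : ℝ) (r : ℕ) :
    MeasurableSet (A.badTestLabels B r) := by
  have h1 : Measurable fun ω => A.testLabelsAt ω r := by
    refine Finset.measurable_sum _ fun i _ => Finset.measurable_sum _ fun j _ => ?_
    have h1 : Measurable fun ω : Tape X k => (ω (Slot.test r i j)).2 i := by fun_prop
    exact measurable_cost (f := A.finalRPU) (measurable_finalRPU hH) h1
  have h2 : Measurable fun ω => (A.testLabelsAt ω r : ℝ) := measurable_from_top.comp h1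
  exact (measurableSet_abstainsOK hH _ _).inter (measurableSet_le measurable_const h2)

/-- Given the seeds of all other slots, the hypothesis of round `r` is an empirical risk minimizer
on independent draws from the mixture, and `erm_tail` applies. -/
lemma badTrain_le (hd : vcDim A.H = A.d) {hstar : X → Bool} (hs : hstar ∈ A.H) {α : ℝ}
    (hα : 0 < α) (hα1 : α ≤ 1) (hν : mdErr A.D hstar ≤ 11 / 20 * α)
    (hm : 1000 ≤ α * A.trainSize A.ε (A.deltaAt A.epochs)) (r : ℕ) :
    tapeMeasure A.D (A.badTrain hstar α r)
      ≤ ENNReal.ofReal (Real.exp (-(α * A.trainSize A.ε (A.deltaAt A.epochs)) / 1000)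
          + 2 * ((1000 / α) ^ A.d
            * Real.exp (-(α * A.trainSize A.ε (A.deltaAt A.epochs)) / 200))) := by
  set m := A.trainSize A.ε (A.deltaAt A.epochs)
  refine tape_le_of_resample A.D (trainSlots k r) (measurableSet_badTrain hH hE hs α r) fun ω => ?_
  by_cases hnoise : ∀ i, A.D i {z | hstar z.1 ≠ (impute (A.finalRPU ω) z).2}
        ≤ ENNReal.ofReal (mdErr A.D hstar)
  swap
  · rw [show {ω' | merge (trainSlots k r) ω ω' ∈ A.badTrain hstar α r} = ∅ from
      Set.eq_empty_of_forall_notMem fun ω' hω' => hnoise (by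
        have := hω'.1
        rwa [finalRPU_merge_train] at this)]
    simp
  have hf := measurable_finalRPU_right hH ω
  let g : Seed X k → X × Bool := fun σ => impute (A.finalRPU ω) (mix (A.weightsAt ω r) σ)
  have hg : Measurable g := (measurable_impute_right hf).comp (measurable_mix_right _)
  have hprob : IsProbabilityMeasure ((seedMeasure A.D).map g) :=
    Measure.isProbabilityMeasure_map hg.aemeasurable
  have herr : err ((seedMeasure A.D).map g) hstar ≤ mdErr A.D hstar := by
    have hA : MeasurableSet {z : X × Bool | hstar z.1 ≠ (impute (A.finalRPU ω) z).2} :=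
      measurable_prodMk_left (measurableSet_noise hH hs (A.epochs - 1))
    have h1 := seedMeasure_mix_le A.D (A.weightsAt ω r) hA hnoise
    rw [err, map_measureReal_apply hg (measurableSet_wrong (hH.1 _ hs))]
    exact ENNReal.toReal_le_of_le_ofReal (mdErr_nonneg _) h1
  have key := erm_tail hH hE hd hs ((seedMeasure A.D).map g) m hα hα1 (herr.trans hν) hm
  have he : Function.Injective fun j : Fin m => (Slot.train r j : Slot k) := fun j j' h => by
    simpa [Fin.ext_iff] using h
  rw [← map_sample A.D he hg] at key
  have hΨ : Measurable fun (ω' : Tape X k) (j : Fin m) => g (ω' (Slot.train r j)) := by fun_prop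
  refine (measure_mono ?_).trans ((Measure.le_map_apply hΨ.aemeasurable _).trans key)
  rintro ω' ⟨-, hω'⟩
  rw [weightsAt_merge_train, wrongAt, finalRPU_merge_train, hypAt_merge_train] at hω'
  have hmem := hE.mem m fun j => g (ω' (Slot.train r j))
  change α < err _ _
  rw [err, map_measureReal_apply hg (measurableSet_wrong (hH.1 _ hmem))]
  exact (ENNReal.ofReal_lt_iff_lt_toReal hα.le (measure_ne_top _ _)).1 hω'

/-- Given the seeds of all other slots, the hypothesis of round `r` is fixed, and the number of its
mistakes in the test is binomial. -/
lemma badTest_le (hε : 0 < A.ε) (r : ℕ) (i : Fin k) :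
    tapeMeasure A.D (A.badTest r i)
      ≤ ENNReal.ofReal
        (Real.exp (-(A.ε * A.testSize A.ε (A.deltaAt A.epochs)) / 1250)) := by
  set n := A.testSize A.ε (A.deltaAt A.epochs) with hn
  refine tape_le_of_resample A.D (testSlots k r) (measurableSet_badTest hH hE r i) fun ω => ?_
  have hW := measurableSet_wrongAt_right hH hE ω r
  have hS : MeasurableSet {σ : Seed X k | σ.2 i ∈ A.wrongAt ω r} :=
    ((measurable_pi_apply i).comp measurable_snd) hW
  have hreal : (seedMeasure A.D).real {σ : Seed X k | σ.2 i ∈ A.wrongAt ω r}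
      = (A.D i).real (A.wrongAt ω r) := by
    rw [Measure.real, seedMeasure_eval A.D i hW, Measure.real]
  have he : Function.Injective fun j : Fin n => (Slot.test r i j : Slot k) := fun j j' h => by
    simpa [Fin.ext_iff] using h
  have hΨ : Measurable fun (ω' : Tape X k) (j : Fin n) => ω' (Slot.test r i j) := by fun_prop
  have hwrong : ∀ ω', A.wrongAt (merge (testSlots k r) ω ω') r = A.wrongAt ω r := fun ω' => by
    rw [wrongAt, hypAt_merge_test, finalRPU_merge_test, wrongAt]
  have hpass : ∀ ω', A.PassesAt (merge (testSlots k r) ω ω') r i ↔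
      (hits Finset.univ (fun _ : Fin n => {σ : Seed X k | σ.2 i ∈ A.wrongAt ω r})
        (fun j => ω' (Slot.test r i j)) : ℝ) ≤ 3 / 4 * (A.ε / 6) * n := fun ω' => by
    have : ∀ j, merge (testSlots k r) ω ω' (Slot.test r i j) = ω' (Slot.test r i j) := fun j =>
      merge_of_mem (I := testSlots k r) ⟨(i, j), rfl⟩ _ _
    rw [PassesAt, hypAt_merge_test, finalRPU_merge_test, PassesTest, mistakes_eq_hits]
    simp only [this]
    rfl
  have hlaw : ∀ E : Set (Fin n → Seed X k), tapeMeasure A.D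
      ((fun (ω' : Tape X k) (j : Fin n) => ω' (Slot.test r i j)) ⁻¹' E)
      ≤ (Measure.infinitePi fun _ : Fin n => seedMeasure A.D) E := fun E => by
    rw [← map_slots A.D he]
    exact Measure.le_map_apply hΨ.aemeasurable _
  have hεn : 0 ≤ A.ε * n := by positivity
  -- a good hypothesis, one between the thresholds, or a bad one
  rcases le_or_gt (A.D i (A.wrongAt ω r)) (ENNReal.ofReal (A.ε / 10)) with h10 | h10
  · have hp : (seedMeasure A.D).real {σ : Seed X k | σ.2 i ∈ A.wrongAt ω r} ≤ A.ε / 10 := by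
      rw [hreal]
      exact ENNReal.toReal_le_of_le_ofReal (by positivity) h10
    have key := chernoff_ge (μ := seedMeasure A.D) (Finset.univ : Finset (Fin n))
      (A := fun _ => {σ : Seed X k | σ.2 i ∈ A.wrongAt ω r}) (fun _ => hS)
      (z := 5 / 4) (by norm_num) (fun _ _ => hp) (3 / 4 * (A.ε / 6) * n)
    refine (measure_mono ?_).trans ((hlaw _).trans (key.trans (ENNReal.ofReal_le_ofReal
      (Real.exp_le_exp.2 ?_))))
    · rintro ω' (⟨-, hω'⟩ | ⟨hω', -⟩)
      · rw [hwrong] at hω'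
        exact absurd (hω'.trans_le h10)
          (not_lt.2 (ENNReal.ofReal_le_ofReal (by linarith)))
      · rw [hpass] at hω'
        exact (not_le.1 hω').le
    · have hlog : (0.2079 : ℝ) ≤ Real.log (5 / 4) := by
        have h1 : Real.log (2 ^ 3) ≤ Real.log ((5 / 4) ^ 10) :=
          Real.log_le_log (by norm_num) (by norm_num)
        rw [Real.log_pow, Real.log_pow] at h1
        have := Real.log_two_gt_d9
        push_cast at h1
        linarith
      rw [Finset.card_univ, Fintype.card_fin]
      nlinarith [mul_le_mul_of_nonneg_left hlog hεn]
  · rcases le_or_gt (A.D i (A.wrongAt ω r)) (ENNReal.ofReal (A.ε / 6)) with h6 | h6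
    · rw [show {ω' | merge (testSlots k r) ω ω' ∈ A.badTest r i} = ∅ from
        Set.eq_empty_of_forall_notMem fun ω' hω' => by
          rcases hω' with ⟨-, h⟩ | ⟨-, h⟩
          · rw [hwrong] at h
            exact absurd h h6.not_gt
          · rw [hwrong] at h
            exact absurd h h10.not_ge]
      simp
    have hp : A.ε / 6 ≤ (seedMeasure A.D).real {σ : Seed X k | σ.2 i ∈ A.wrongAt ω r} := by
      rw [hreal]
      exact (ENNReal.ofReal_le_iff_le_toReal (measure_ne_top _ _)).1 h6.le
    have key := chernoff_le (μ := seedMeasure A.D) (Finset.univ : Finset (Fin n))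
      (A := fun _ => {σ : Seed X k | σ.2 i ∈ A.wrongAt ω r}) (fun _ => hS)
      (z := 3 / 4) (by norm_num) (by norm_num) (fun _ _ => hp) (3 / 4 * (A.ε / 6) * n)
    refine (measure_mono ?_).trans ((hlaw _).trans (key.trans (ENNReal.ofReal_le_ofReal
      (Real.exp_le_exp.2 ?_))))
    · rintro ω' (⟨hω', -⟩ | ⟨-, hω'⟩)
      · rw [hpass] at hω'
        exact hω'
      · rw [hwrong] at hω'
        exact absurd hω' h10.not_ge
    · have hlog : (-0.2972 : ℝ) ≤ Real.log (3 / 4) := by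
        have h1 : Real.log ((4 / 3) ^ 7) ≤ Real.log (2 ^ 3) :=
          Real.log_le_log (by norm_num) (by norm_num)
        rw [Real.log_pow, Real.log_pow] at h1
        have := Real.log_two_lt_d9
        have e : Real.log (3 / 4) = -Real.log (4 / 3) := by
          rw [← Real.log_inv]
          norm_num
        push_cast at h1
        linarith
      rw [Finset.card_univ, Fintype.card_fin]
      nlinarith [mul_le_mul_of_nonneg_left hlog hεn]

lemma badTrainLabels_le {B : ℝ}
    (hB : epsAt (A.epochs - 1) * A.trainSize A.ε (A.deltaAt A.epochs) ≤ B) (r : ℕ) :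
    tapeMeasure A.D (A.badTrainLabels B r) ≤ ENNReal.ofReal (Real.exp (-B)) := by
  have hξ0 : (0 : ℝ) < epsAt (A.epochs - 1) := by unfold epsAt; positivity
  have hB0 : 0 ≤ B := le_trans (by positivity) hB
  refine tape_le_of_resample A.D (trainSlots k r) (measurableSet_badTrainLabels hH hE B r)
    fun ω => ?_
  by_cases habs : ∀ i, (A.D i).fst {x | A.finalRPU ω x = none}
      ≤ ENNReal.ofReal (epsAt (A.epochs - 1))
  swap
  · rw [show {ω' | merge (trainSlots k r) ω ω' ∈ A.badTrainLabels B r} = ∅ from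
      Set.eq_empty_of_forall_notMem fun ω' hω' => habs (by
        have := hω'.1
        rwa [finalRPU_merge_train] at this)]
    simp
  have hR : MeasurableSet {x | A.finalRPU ω x = none} :=
    measurable_finalRPU_right hH ω (measurableSet_singleton none)
  have hW : MeasurableSet {z : X × Bool | A.finalRPU ω z.1 = none} := measurable_fst hR
  have hp : (seedMeasure A.D).real (mix (A.weightsAt ω r) ⁻¹'
      {z : X × Bool | A.finalRPU ω z.1 = none}) ≤ epsAt (A.epochs - 1) := by
    refine ENNReal.toReal_le_of_le_ofReal hξ0.le ?_
    refine seedMeasure_mix_le A.D _ hW fun i => ?_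
    have h1 := habs i
    rwa [Measure.fst_apply hR] at h1
  have he : Function.Injective fun j => (Slot.train r j : Slot k) := fun j j' h => by
    simpa using h
  have key := tape_hits_tail A.D he (Finset.range (A.trainSize A.ε (A.deltaAt A.epochs)))
    (A := fun _ => mix (A.weightsAt ω r) ⁻¹' {z : X × Bool | A.finalRPU ω z.1 = none})
    (fun _ => measurable_mix_right _ hW) (fun _ _ => hp) (B := B)
    (by rwa [Finset.card_range]) hB0
  refine (measure_mono ?_).trans key
  rintro ω' ⟨-, hω'⟩
  refine hω'.trans (le_of_eq ?_)
  congr 1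
  rw [trainLabelsAt, hits, Finset.card_filter, finalRPU_merge_train, weightsAt_merge_train]
  refine Finset.sum_congr rfl fun j _ => ?_
  have : merge (trainSlots k r) ω ω' (Slot.train r j) = ω' (Slot.train r j) :=
    merge_of_mem (I := trainSlots k r) ⟨j, rfl⟩ _ _
  rw [this, cost]
  exact if_congr Iff.rfl rfl rfl

omit hE in
lemma badTestLabels_le {B : ℝ}
    (hB : epsAt (A.epochs - 1) * (k * A.testSize A.ε (A.deltaAt A.epochs)) ≤ B) (r : ℕ) :
    tapeMeasure A.D (A.badTestLabels B r) ≤ ENNReal.ofReal (Real.exp (-B)) := by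
  have hξ0 : (0 : ℝ) < epsAt (A.epochs - 1) := by unfold epsAt; positivity
  have hB0 : 0 ≤ B := le_trans (by positivity) hB
  refine tape_le_of_resample A.D (testSlots k r) (measurableSet_badTestLabels hH B r)
    fun ω => ?_
  by_cases habs : ∀ i, (A.D i).fst {x | A.finalRPU ω x = none}
      ≤ ENNReal.ofReal (epsAt (A.epochs - 1))
  swap
  · rw [show {ω' | merge (testSlots k r) ω ω' ∈ A.badTestLabels B r} = ∅ from
      Set.eq_empty_of_forall_notMem fun ω' hω' => habs (by
        have := hω'.1
        rwa [finalRPU_merge_test] at this)]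
    simp
  have hR : MeasurableSet {x | A.finalRPU ω x = none} :=
    measurable_finalRPU_right hH ω (measurableSet_singleton none)
  have hW : MeasurableSet {z : X × Bool | A.finalRPU ω z.1 = none} := measurable_fst hR
  have hS : ∀ q : Fin k × ℕ,
      MeasurableSet {σ : Seed X k | σ.2 q.1 ∈ {z : X × Bool | A.finalRPU ω z.1 = none}} :=
    fun q => ((measurable_pi_apply q.1).comp measurable_snd) hW
  have hp : ∀ q : Fin k × ℕ, (seedMeasure A.D).real
      {σ : Seed X k | σ.2 q.1 ∈ {z : X × Bool | A.finalRPU ω z.1 = none}}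
      ≤ epsAt (A.epochs - 1) := by
    intro q
    refine ENNReal.toReal_le_of_le_ofReal hξ0.le ?_
    rw [seedMeasure_eval A.D q.1 hW]
    have h1 := habs q.1
    rwa [Measure.fst_apply hR] at h1
  have he : Function.Injective fun q : Fin k × ℕ => (Slot.test r q.1 q.2 : Slot k) := by
    rintro ⟨i, j⟩ ⟨i', j'⟩ h
    simpa using h
  have key := tape_hits_tail A.D he
    (Finset.univ ×ˢ Finset.range (A.testSize A.ε (A.deltaAt A.epochs))) hS (fun q _ => hp q)
    (B := B) (by simpa using hB) hB0
  refine (measure_mono ?_).trans key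
  rintro ω' ⟨-, hω'⟩
  refine hω'.trans (le_of_eq ?_)
  congr 1
  rw [testLabelsAt, hits, Finset.card_filter, Finset.sum_product, finalRPU_merge_test]
  refine Finset.sum_congr rfl fun i _ => Finset.sum_congr rfl fun j _ => ?_
  have : merge (testSlots k r) ω ω' (Slot.test r i j) = ω' (Slot.test r i j) :=
    merge_of_mem (I := testSlots k r) ⟨(i, j), rfl⟩ _ _
  rw [show cost (A.finalRPU ω) ((merge (testSlots k r) ω ω' (Slot.test r i j)).2 i)
    = cost (A.finalRPU ω) ((ω' (Slot.test r i j)).2 i) by rw [this]]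
  rw [cost]
  convert rfl
  exact Iff.rfl

end MDL

end Setup

/-! ### The error of the output -/

namespace Setup

section Output

variable {X : Type*} [MeasurableSpace X] {k : ℕ} [NeZero k] {A : Setup X k}
  [∀ i, IsProbabilityMeasure (A.D i)] {hstar : X → Bool}

omit [∀ i, IsProbabilityMeasure (A.D i)] in
lemma weightsAt_succ (ω : Tape X k) (r : ℕ) (i : Fin k) :
    A.weightsAt ω (r + 1) i = if i ∈ Finset.univ.filter (fun i => ¬ A.PassesAt ω r i)
      then 2 * A.weightsAt ω r i else A.weightsAt ω r i := by
  by_cases h : A.PassesAt ω r i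
  · rw [if_neg (by simpa using h)]
    exact if_pos h
  · rw [if_pos (by simpa using h)]
    exact if_neg h

/-- A distribution that fails the test has a large error, so that such distributions carry little
of the weight of a mixture on which the error is at most `α`. -/
lemma fails_mul_le (hH : PointwiseMeasurable A.H) (hE : IsERM A.H A.erm) {α : ℝ}
    (hα : 0 ≤ α) {ω : Tape X k} {r : ℕ}
    (hnoise : ∀ i, A.D i {z | hstar z.1 ≠ (impute (A.finalRPU ω) z).2}
        ≤ ENNReal.ofReal (mdErr A.D hstar))
    (htrain : ω ∉ A.badTrain hstar α r) (htest : ∀ i, ω ∉ A.badTest r i) :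
    A.ε / 10 * ∑ i ∈ Finset.univ.filter (fun i => ¬ A.PassesAt ω r i), (A.weightsAt ω r i : ℝ)
      ≤ (∑ i, (A.weightsAt ω r i : ℝ)) * α := by
  have hW := measurableSet_wrongAt_right hH hE ω r
  have h1 := sum_weights_le A.D (A.weightsAt ω r) hW
  have h2 : seedMeasure A.D (mix (A.weightsAt ω r) ⁻¹' A.wrongAt ω r) ≤ ENNReal.ofReal α :=
    not_lt.1 fun h => htrain ⟨hnoise, h⟩
  have h3 : (seedMeasure A.D).real (mix (A.weightsAt ω r) ⁻¹' A.wrongAt ω r) ≤ α :=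
    ENNReal.toReal_le_of_le_ofReal hα h2
  calc _ = ∑ i ∈ Finset.univ.filter (fun i => ¬ A.PassesAt ω r i),
        (A.weightsAt ω r i : ℝ) * (A.ε / 10) := by rw [mul_comm, Finset.sum_mul]
    _ ≤ ∑ i ∈ Finset.univ.filter (fun i => ¬ A.PassesAt ω r i),
        (A.weightsAt ω r i : ℝ) * (A.D i).real (A.wrongAt ω r) := by
        refine Finset.sum_le_sum fun i hi => mul_le_mul_of_nonneg_left ?_ (Nat.cast_nonneg _)
        have h4 : ENNReal.ofReal (A.ε / 10) < A.D i (A.wrongAt ω r) :=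
          not_le.1 fun h => htest i (Or.inr ⟨(Finset.mem_filter.1 hi).2, h⟩)
        exact (ENNReal.ofReal_le_iff_le_toReal (measure_ne_top _ _)).1 h4.le
    _ ≤ ∑ i, (A.weightsAt ω r i : ℝ) * (A.D i).real (A.wrongAt ω r) :=
        Finset.sum_le_sum_of_subset_of_nonneg (Finset.subset_univ _) fun i _ _ =>
          mul_nonneg (Nat.cast_nonneg _) measureReal_nonneg
    _ ≤ _ := h1.trans (mul_le_mul_of_nonneg_left h3 (Finset.sum_nonneg fun i _ =>
        Nat.cast_nonneg _))

/-- Outside the failure events, each distribution fails at most a third of the tests. For `k = 1`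
there is a single round, and a weaker bound on the error of the learned hypothesis is enough. -/
lemma card_fails_le_of_notMem (hH : PointwiseMeasurable A.H) (hE : IsERM A.H A.erm) (hε : 0 < A.ε)
    {α : ℝ} (hα : 0 ≤ α) (hα55 : 55 * α ≤ A.ε) (hα110 : k ≠ 1 → 110 * α ≤ A.ε) {ω : Tape X k}
    (hrel : Reliable hstar (A.finalRPU ω))
    (htrain : ∀ r < mdlRounds k, ω ∉ A.badTrain hstar α r)
    (htest : ∀ r < mdlRounds k, ∀ i, ω ∉ A.badTest r i) (i : Fin k) :
    3 * ((Finset.range (mdlRounds k)).filter fun r =>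
      i ∈ Finset.univ.filter (fun i => ¬ A.PassesAt ω r i)).card ≤ mdlRounds k := by
  have hnoise := noise_le_of_reliable (A := A) hrel
  have hmass : ∀ r < mdlRounds k,
      A.ε / 10 * ∑ i ∈ Finset.univ.filter (fun i => ¬ A.PassesAt ω r i), (A.weightsAt ω r i : ℝ)
        ≤ (∑ i, (A.weightsAt ω r i : ℝ)) * α := fun r hr =>
    fails_mul_le hH hE hα hnoise (htrain r hr) (htest r hr)
  by_cases hk : k = 1
  · subst hk
    rw [Finset.filter_false_of_mem, Finset.card_empty]
    · exact Nat.zero_le _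
    · intro r hr hi
      have h1 := hmass r (Finset.mem_range.1 hr)
      have hwpos : (0 : ℝ) < A.weightsAt ω r i := by
        rw [weight_eq_two_pow (w := A.weightsAt ω) (fun _ => rfl) (weightsAt_succ ω)]
        positivity
      have e : Finset.univ.filter (fun i => ¬ A.PassesAt ω r i) = {i} := by
        ext j
        rw [Subsingleton.elim j i]
        simpa using hi
      rw [e, Finset.sum_singleton, Fintype.sum_subsingleton _ i] at h1
      nlinarith
  · have hk2 : 2 ≤ k := by have := NeZero.ne k; omega
    refine card_fails_le (w := A.weightsAt ω) hk2 (fun _ => rfl) (weightsAt_succ ω)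
      (fun r hr => ?_) i
    have h1 := hmass r hr
    have h2 : (0 : ℝ) ≤ ∑ i, (A.weightsAt ω r i : ℝ) :=
      Finset.sum_nonneg fun i _ => Nat.cast_nonneg _
    have h3 := mul_le_mul_of_nonneg_left (hα110 hk) h2
    have h4 : A.ε * (11 * ∑ i ∈ Finset.univ.filter (fun i => ¬ A.PassesAt ω r i),
        (A.weightsAt ω r i : ℝ)) ≤ A.ε * ∑ i, (A.weightsAt ω r i : ℝ) := by linarith
    exact_mod_cast le_of_mul_le_mul_left h4 hε

omit [∀ i, IsProbabilityMeasure (A.D i)] in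
/-- A mistake of the output is a mistake of `hstar`, or a majority of the learned hypotheses
disagrees with the imputed label. -/
lemma output_ne_imp {ω : Tape X k} (hrel : Reliable hstar (A.finalRPU ω)) {z : X × Bool}
    (hz : A.output ω z.1 ≠ z.2) : hstar z.1 ≠ z.2 ∨
      mdlRounds k ≤ 2 * ((Finset.range (mdlRounds k)).filter fun r => z ∈ A.wrongAt ω r).card := by
  by_cases himp : (impute (A.finalRPU ω) z).2 = z.2
  · right
    rw [← himp] at hz
    have h2 := le_card_of_majority_ne (v := fun r => A.hypAt ω r z.1) hz
    convert h2
  · left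
    have hn : A.finalRPU ω z.1 ≠ none := fun hn => himp (by simp [impute, hn])
    rw [impute, hrel.getD_eq hn] at himp
    exact himp

/-- Outside the failure events, the output of the run is as good as it should be. -/
lemma mdErr_output_le (hH : PointwiseMeasurable A.H) (hE : IsERM A.H A.erm) (hε : 0 < A.ε)
    {α : ℝ} (hα : 0 ≤ α) (hα55 : 55 * α ≤ A.ε) (hα110 : k ≠ 1 → 110 * α ≤ A.ε) {ω : Tape X k}
    (hrel : Reliable hstar (A.finalRPU ω))
    (htrain : ∀ r < mdlRounds k, ω ∉ A.badTrain hstar α r)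
    (htest : ∀ r < mdlRounds k, ∀ i, ω ∉ A.badTest r i) :
    mdErr A.D (A.output ω) ≤ mdErr A.D hstar + A.ε := by
  have ht : 1 ≤ mdlRounds k := le_max_left _ _
  refine ciSup_le fun i => ?_
  have hpass : ∀ r < mdlRounds k, ¬ i ∈ Finset.univ.filter (fun i => ¬ A.PassesAt ω r i) →
      (A.D i).real (A.wrongAt ω r) ≤ A.ε / 6 := by
    intro r hr hi
    have hp : A.PassesAt ω r i := by simpa using hi
    have h1 : A.D i (A.wrongAt ω r) ≤ ENNReal.ofReal (A.ε / 6) :=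
      not_lt.1 fun h => htest r hr i (Or.inl ⟨hp, h⟩)
    exact ENNReal.toReal_le_of_le_ofReal (by positivity) h1
  have hmaj := measureReal_majority_le (A.D i) (B := A.wrongAt ω)
    (measurableSet_wrongAt_right hH hE ω) ht
    (F := fun r => i ∈ Finset.univ.filter (fun i => ¬ A.PassesAt ω r i))
    (by convert card_fails_le_of_notMem hH hE hε hα hα55 hα110 hrel htrain htest i) hε.le hpass
  have hsub : {z : X × Bool | A.output ω z.1 ≠ z.2} ⊆ {z | hstar z.1 ≠ z.2} ∪
      {z | mdlRounds k ≤ 2 *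
        ((Finset.range (mdlRounds k)).filter fun r => z ∈ A.wrongAt ω r).card} :=
    fun z hz => output_ne_imp hrel hz
  have h1 : err (A.D i) (A.output ω) ≤ _ := (measureReal_mono hsub).trans (measureReal_union_le _ _)
  exact h1.trans (add_le_add (err_le_mdErr A.D hstar i) hmaj)

end Output

/-! ### Sample sizes and confidences -/

section Sizes

variable {X : Type*} [MeasurableSpace X] {k : ℕ} [NeZero k] {A : Setup X k}

omit [MeasurableSpace X] in
lemma one_le_cast_of_neZero : (1 : ℝ) ≤ k := by
  exact_mod_cast Nat.one_le_iff_ne_zero.2 (NeZero.ne k)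

/-- A quantity whose powers bound all the logarithmic factors, except for `1 + log (1 / ε)`. -/
def logFactor (k : ℕ) (ε δ : ℝ) : ℝ :=
  1 + Real.log k + Real.log (1 / δ) + Real.log (1 + Real.log (1 / ε))

omit [NeZero k] in
lemma epochs_pos : 1 ≤ A.epochs := le_max_left _ _

/-- The classifier used for imputation in the last epoch abstains so seldom that the label cost of
Passive-MDL is proportional to `s` instead of `d + k`. -/
lemma epsAt_mul_le (hs : 1 ≤ A.s) (hε : 0 < A.ε) :
    epsAt (A.epochs - 1) * (A.d + k) ≤ 2 * A.s * A.ε := by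
  have hs' : (1 : ℝ) ≤ A.s := by exact_mod_cast hs
  have hk := one_le_cast_of_neZero (k := k)
  have h2 : (0 : ℝ) < ((A.d : ℝ) + k) / (A.s * A.ε) := by positivity
  have h1 : Real.logb 2 (((A.d : ℝ) + k) / (A.s * A.ε)) ≤ A.epochs :=
    (Nat.le_ceil _).trans (Nat.cast_le.2 (le_max_right _ _))
  rw [Real.logb_le_iff_le_rpow (by norm_num) h2, Real.rpow_natCast,
    div_le_iff₀ (by positivity)] at h1
  have h3 : (2 : ℝ) ^ A.epochs = 2 * 2 ^ (A.epochs - 1) := by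
    rw [← pow_succ', Nat.sub_add_cancel epochs_pos]
  rw [epsAt, one_div, inv_pow, inv_mul_le_iff₀ (by positivity)]
  rw [h3] at h1
  linarith

lemma epochs_le (hs : 1 ≤ A.s) (hds : A.d ≤ A.s) (hε : 0 < A.ε) (hε1 : A.ε < 1) :
    (A.epochs : ℝ) ≤ 4 * (1 + Real.log k) * (1 + Real.log (1 / A.ε)) := by
  have hs' : (1 : ℝ) ≤ A.s := by exact_mod_cast hs
  have hds' : (A.d : ℝ) ≤ A.s := by exact_mod_cast hds
  have hk := one_le_cast_of_neZero (k := k)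
  have hlk := Real.log_nonneg hk
  have hle : 0 ≤ Real.log (1 / A.ε) := Real.log_nonneg (by rw [le_div_iff₀ hε]; linarith)
  have hsmall : (1 : ℝ) ≤ 4 * (1 + Real.log k) * (1 + Real.log (1 / A.ε)) := by nlinarith
  have hmul := mul_nonneg hlk hle
  rw [epochs, Nat.cast_max]
  refine max_le (by simpa using hsmall) ?_
  rcases le_or_gt (Real.logb 2 (((A.d : ℝ) + k) / (A.s * A.ε))) 0 with h0 | h0
  · rw [Nat.ceil_eq_zero.2 h0, Nat.cast_zero]
    linarith
  refine (Nat.ceil_lt_add_one h0.le).le.trans ?_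
  have h1 : ((A.d : ℝ) + k) / (A.s * A.ε) ≤ 2 * k * (1 / A.ε) := by
    rw [mul_one_div, div_le_div_iff₀ (by positivity) hε]
    have h3 : (A.d : ℝ) + k ≤ 2 * k * A.s := by nlinarith
    nlinarith [mul_le_mul_of_nonneg_right h3 hε.le]
  have h2 : Real.logb 2 (((A.d : ℝ) + k) / (A.s * A.ε))
      ≤ (Real.log 2 + Real.log k + Real.log (1 / A.ε)) / Real.log 2 := by
    rw [← Real.log_mul (by norm_num) (by positivity),
      ← Real.log_mul (by positivity) (by positivity)]
    exact Real.logb_le_logb_of_le (by norm_num) (by positivity) h1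
  refine (add_le_add_left h2 1).trans ?_
  have h3 := Real.log_two_gt_d9
  have h4 : (Real.log 2 + Real.log k + Real.log (1 / A.ε)) / Real.log 2
      ≤ 1 + 2 * Real.log k + 2 * Real.log (1 / A.ε) := by
    rw [div_le_iff₀ (by linarith)]
    nlinarith
  nlinarith

variable (hε : 0 < A.ε) (hε1 : A.ε < 1) (hδ : 0 < A.δ) (hδ1 : A.δ < 1)

omit [MeasurableSpace X] [NeZero k] in
lemma log_one_div_nonneg {x : ℝ} (h0 : 0 < x) (h1 : x < 1) : 0 ≤ Real.log (1 / x) :=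
  Real.log_nonneg (by rw [le_div_iff₀ h0]; linarith)

include hε hε1 hδ hδ1

lemma one_le_logFactor : 1 ≤ logFactor k A.ε A.δ ∧ Real.log k ≤ logFactor k A.ε A.δ - 1 := by
  have h1 := Real.log_nonneg (one_le_cast_of_neZero (k := k))
  have h2 := log_one_div_nonneg hδ hδ1
  have h3 : 0 ≤ Real.log (1 + Real.log (1 / A.ε)) :=
    Real.log_nonneg (by linarith [log_one_div_nonneg hε hε1])
  unfold logFactor
  constructor <;> linarith

lemma log_one_div_deltaAt_le (hs : 1 ≤ A.s) (hds : A.d ≤ A.s) {n : ℕ} (hn : 1 ≤ n)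
    (hn' : n ≤ A.epochs) : Real.log (1 / A.deltaAt n) ≤ 4 * logFactor k A.ε A.δ := by
  have hk := one_le_cast_of_neZero (k := k)
  have hlk := Real.log_nonneg hk
  have hle := log_one_div_nonneg hε hε1
  have hld := log_one_div_nonneg hδ hδ1
  have hll : 0 ≤ Real.log (1 + Real.log (1 / A.ε)) := Real.log_nonneg (by linarith)
  have hn0 : (1 : ℝ) ≤ n := by exact_mod_cast hn
  have h1 : Real.log n ≤ 2 * Real.log 2 + Real.log k + Real.log (1 + Real.log (1 / A.ε)) := by
    have h2 : (n : ℝ) ≤ 4 * (1 + Real.log k) * (1 + Real.log (1 / A.ε)) :=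
      (by exact_mod_cast hn' : (n : ℝ) ≤ A.epochs).trans (epochs_le hs hds hε hε1)
    have h3 := Real.log_le_log (by linarith) h2
    rw [Real.log_mul (by positivity) (by positivity), Real.log_mul (by norm_num) (by positivity),
      show (4 : ℝ) = 2 ^ 2 by norm_num, Real.log_pow] at h3
    have h4 := Real.log_le_sub_one_of_pos (by positivity : 0 < 1 + Real.log k)
    push_cast at h3
    linarith
  have h2 : Real.log (1 / A.deltaAt n) = Real.log 2 + 2 * Real.log n + Real.log (1 / A.δ) := by
    rw [deltaAt, one_div_div, div_eq_mul_one_div, Real.log_mul (by positivity) (by positivity),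
      Real.log_mul (by norm_num) (by positivity), Real.log_pow]
    push_cast
    ring
  have h3 := Real.log_two_lt_d9
  rw [h2, logFactor]
  linarith

omit hε hε1 hδ hδ1 [MeasurableSpace X] [NeZero k] in
lemma one_le_mdlRounds : (1 : ℝ) ≤ mdlRounds k := by
  have h : 1 ≤ mdlRounds k := le_max_left _ _
  exact_mod_cast h

lemma mdlRounds_le : (mdlRounds k : ℝ) ≤ 8 * logFactor k A.ε A.δ := by
  have hk := one_le_cast_of_neZero (k := k)
  have hlk := Real.log_nonneg hk
  obtain ⟨hQ, hkQ⟩ := one_le_logFactor hε hε1 hδ hδ1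
  rw [mdlRounds, Nat.cast_max]
  refine max_le (by push_cast; linarith) ?_
  have h1 := (Nat.ceil_lt_add_one (Real.logb_nonneg (b := 2) (by norm_num) hk)).le
  have h2 : Real.logb 2 k ≤ 3 / 2 * Real.log k := by
    have := Real.log_two_gt_d9
    rw [Real.logb, div_le_iff₀ (by linarith)]
    nlinarith
  push_cast
  linarith

/-- The logarithms in the sample sizes of Passive-MDL. -/
lemma log_rounds_div_deltaAt (hs : 1 ≤ A.s) (hds : A.d ≤ A.s) :
    Real.log 2 ≤ Real.log (mdlRounds k / A.deltaAt A.epochs) ∧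
    Real.log (k * mdlRounds k / A.deltaAt A.epochs)
      = Real.log k + Real.log (mdlRounds k / A.deltaAt A.epochs) ∧
    Real.log (k * mdlRounds k / A.deltaAt A.epochs) ≤ 13 * logFactor k A.ε A.δ := by
  have hk := one_le_cast_of_neZero (k := k)
  have ht := one_le_mdlRounds (k := k)
  obtain ⟨hQ, hkQ⟩ := one_le_logFactor hε hε1 hδ hδ1
  have he1 : 1 ≤ A.epochs := epochs_pos
  have he : (1 : ℝ) ≤ A.epochs := by exact_mod_cast he1
  have hd0 : 0 < A.deltaAt A.epochs := by unfold deltaAt; positivity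
  have hd1 : A.deltaAt A.epochs ≤ 1 / 2 := by
    have := deltaAt_le hδ (A.epochs - 1)
    rw [Nat.sub_add_cancel he1] at this
    linarith
  have e : Real.log (k * mdlRounds k / A.deltaAt A.epochs)
      = Real.log k + Real.log (mdlRounds k / A.deltaAt A.epochs) := by
    rw [mul_div_assoc, Real.log_mul (by positivity) (by positivity)]
  refine ⟨?_, e, ?_⟩
  · refine Real.log_le_log (by norm_num) ?_
    rw [le_div_iff₀ hd0]
    linarith
  · rw [e, div_eq_mul_one_div, Real.log_mul (by positivity) (by positivity)]
    have h1 := log_one_div_deltaAt_le hε hε1 hδ hδ1 hs hds he1 le_rfl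
    have h2 := Real.log_le_sub_one_of_pos (by linarith : (0 : ℝ) < mdlRounds k)
    have h3 := mdlRounds_le hε hε1 hδ hδ1 (k := k)
    linarith

end Sizes

end Setup

/-! ### Failure probability and number of labels -/

namespace Setup

section Total

variable {X : Type*} [MeasurableSpace X] {k : ℕ} [NeZero k] {A : Setup X k}
  (hε : 0 < A.ε) (hε1 : A.ε < 1) (hδ : 0 < A.δ) (hδ1 : A.δ < 1) (hs : 1 ≤ A.s)
  (hds : A.d ≤ A.s) (hC : A.C = 10 ^ 7)

/-- A bound on the expected numbers of label queries for training and for testing in a round of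
Passive-MDL. -/
def labelBound (A : Setup X k) : ℝ :=
  4 * 10 ^ 7 * A.s * (1 + Real.log (1 / A.ε)
    + Real.log (k * mdlRounds k / A.deltaAt A.epochs))

include hε hε1 hδ hδ1 hs hds hC

lemma trainSize_bounds :
    10 ^ 7 * (A.d * (1 + Real.log (1 / A.ε)) + Real.log (mdlRounds k / A.deltaAt A.epochs))
      ≤ A.ε * A.trainSize A.ε (A.deltaAt A.epochs) ∧
    epsAt (A.epochs - 1) * A.trainSize A.ε (A.deltaAt A.epochs) ≤ A.labelBound := by
  have hk := one_le_cast_of_neZero (k := k)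
  have hlk := Real.log_nonneg hk
  have hle := log_one_div_nonneg hε hε1
  obtain ⟨hΛ, hM, -⟩ := log_rounds_div_deltaAt hε hε1 hδ hδ1 hs hds
  have hlog2 := Real.log_two_gt_d9
  have hb0 : (0 : ℝ) < epsAt (A.epochs - 1) := by unfold epsAt; positivity
  have hb := epsAt_mul_le hs hε
  set b : ℝ := epsAt (A.epochs - 1)
  set Λ := Real.log (mdlRounds k / A.deltaAt A.epochs)
  have hℓ : 0 ≤ Real.log (1 / A.ε) := hle
  set Y := 10 ^ 7 * (A.d * (1 + Real.log (1 / A.ε)) + Λ) with hY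
  have hY1 : 1 ≤ Y := by
    have : (0 : ℝ) ≤ A.d * (1 + Real.log (1 / A.ε)) := by positivity
    linarith
  have hsize : A.trainSize A.ε (A.deltaAt A.epochs) = ⌈Y / A.ε⌉₊ := by rw [trainSize, hC]
  have h1 : Y / A.ε ≤ ⌈Y / A.ε⌉₊ := Nat.le_ceil _
  have h2 : (⌈Y / A.ε⌉₊ : ℝ) ≤ 2 * (Y / A.ε) := by
    have h3 := (Nat.ceil_lt_add_one (by positivity : 0 ≤ Y / A.ε)).le
    have h4 : 1 ≤ Y / A.ε := by rw [le_div_iff₀ hε]; linarith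
    linarith
  rw [hsize]
  refine ⟨by rw [div_le_iff₀ hε] at h1; linarith, ?_⟩
  have hYle : Y ≤ 10 ^ 7 * ((A.d + k) * (1 + Real.log (1 / A.ε) + Λ)) := by
    rw [hY]
    have hΛ0 : 0 ≤ Λ := by linarith
    have h5 : (0 : ℝ) ≤ A.d * Λ := by positivity
    have h6 : Λ ≤ k * Λ := by nlinarith
    have h7 : (0 : ℝ) ≤ k * (1 + Real.log (1 / A.ε)) := by positivity
    nlinarith
  calc b * ⌈Y / A.ε⌉₊ ≤ b * (2 * (Y / A.ε)) := mul_le_mul_of_nonneg_left h2 hb0.le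
    _ ≤ b * (2 * (10 ^ 7 * ((A.d + k) * (1 + Real.log (1 / A.ε) + Λ)) / A.ε)) := by gcongr
    _ = (b * (A.d + k)) * (2 * 10 ^ 7 * (1 + Real.log (1 / A.ε) + Λ) / A.ε) := by ring
    _ ≤ (2 * A.s * A.ε) * (2 * 10 ^ 7 * (1 + Real.log (1 / A.ε) + Λ) / A.ε) := by
        have : 0 ≤ Λ := by linarith
        gcongr
    _ = 4 * 10 ^ 7 * A.s * (1 + Real.log (1 / A.ε) + Λ) := by
        field_simp
        ring
    _ ≤ A.labelBound := by
        rw [labelBound, hM]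
        gcongr
        linarith

lemma testSize_bounds :
    10 ^ 7 * Real.log (k * mdlRounds k / A.deltaAt A.epochs)
      ≤ A.ε * A.testSize A.ε (A.deltaAt A.epochs) ∧
    epsAt (A.epochs - 1) * (k * A.testSize A.ε (A.deltaAt A.epochs)) ≤ A.labelBound := by
  have hk := one_le_cast_of_neZero (k := k)
  have hlk := Real.log_nonneg hk
  have hle := log_one_div_nonneg hε hε1
  obtain ⟨hΛ, hM, -⟩ := log_rounds_div_deltaAt hε hε1 hδ hδ1 hs hds
  have hlog2 := Real.log_two_gt_d9
  have hb0 : (0 : ℝ) < epsAt (A.epochs - 1) := by unfold epsAt; positivity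
  have hb := epsAt_mul_le hs hε
  set b : ℝ := epsAt (A.epochs - 1)
  have hM0 : Real.log 2 ≤ Real.log (k * mdlRounds k / A.deltaAt A.epochs) := by linarith
  rw [labelBound]
  set M := Real.log (k * mdlRounds k / A.deltaAt A.epochs)
  have hsize : A.testSize A.ε (A.deltaAt A.epochs) = ⌈10 ^ 7 * M / A.ε⌉₊ := by
    rw [testSize, hC]
  have h1 : 10 ^ 7 * M / A.ε ≤ ⌈10 ^ 7 * M / A.ε⌉₊ := Nat.le_ceil _
  have hM00 : 0 ≤ M := by linarith
  have h2 : (⌈10 ^ 7 * M / A.ε⌉₊ : ℝ) ≤ 2 * (10 ^ 7 * M / A.ε) := by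
    have h3 := (Nat.ceil_lt_add_one (by positivity : 0 ≤ 10 ^ 7 * M / A.ε)).le
    have h4 : 1 ≤ 10 ^ 7 * M / A.ε := by rw [le_div_iff₀ hε]; linarith
    linarith
  rw [hsize]
  refine ⟨by rw [div_le_iff₀ hε] at h1; linarith, ?_⟩
  calc b * (k * ⌈10 ^ 7 * M / A.ε⌉₊) ≤ b * ((A.d + k) * (2 * (10 ^ 7 * M / A.ε))) := by
        gcongr
        have : (0 : ℝ) ≤ A.d := Nat.cast_nonneg _
        linarith
    _ = (b * (A.d + k)) * (2 * (10 ^ 7 * M / A.ε)) := by ring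
    _ ≤ (2 * A.s * A.ε) * (2 * (10 ^ 7 * M / A.ε)) := by gcongr
    _ = 4 * 10 ^ 7 * A.s * M := by
        field_simp
        ring
    _ ≤ _ := by
        gcongr
        linarith

omit hC in
lemma labelBound_le :
    A.labelBound ≤ 56 * 10 ^ 7 * A.s * (1 + Real.log (1 / A.ε)) * logFactor k A.ε A.δ := by
  have hle := log_one_div_nonneg hε hε1
  obtain ⟨-, -, hM⟩ := log_rounds_div_deltaAt hε hε1 hδ hδ1 hs hds
  obtain ⟨hQ, -⟩ := one_le_logFactor (k := k) hε hε1 hδ hδ1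
  rw [labelBound]
  set M := Real.log (k * mdlRounds k / A.deltaAt A.epochs)
  set ℓ := Real.log (1 / A.ε)
  set Q := logFactor k A.ε A.δ
  have h1 : 1 + ℓ + M ≤ 14 * ((1 + ℓ) * Q) := by nlinarith
  calc _ ≤ 4 * 10 ^ 7 * A.s * (14 * ((1 + ℓ) * Q)) := by gcongr
    _ = _ := by ring

omit hC in
lemma exp_labelBound_le :
    Real.exp (-A.labelBound)
      ≤ Real.exp (-(10 * Real.log (mdlRounds k / A.deltaAt A.epochs))) := by
  have hk := one_le_cast_of_neZero (k := k)
  have hlk := Real.log_nonneg hk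
  have hle := log_one_div_nonneg hε hε1
  obtain ⟨hΛ, hM, -⟩ := log_rounds_div_deltaAt hε hε1 hδ hδ1 hs hds
  have hlog2 := Real.log_two_gt_d9
  have hs' : (1 : ℝ) ≤ A.s := by exact_mod_cast hs
  refine Real.exp_le_exp.2 (neg_le_neg ?_)
  rw [labelBound, hM]
  nlinarith

variable [∀ i, IsProbabilityMeasure (A.D i)] {hstar : X → Bool}

omit hε hε1 hδ hδ1 hs hds hC

/-- The union of the failure events of Passive-MDL. -/
def badMDL (A : Setup X k) (hstar : X → Bool) (α B : ℝ) : Set (Tape X k) :=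
  ⋃ r ∈ Finset.range (mdlRounds k), (A.badTrain hstar α r ∪ ⋃ i, A.badTest r i) ∪
    (A.badTrainLabels B r ∪ A.badTestLabels B r)

include hε hε1 hδ hδ1 hs hds hC

/-- The sample size for training makes the failure of empirical risk minimization unlikely: it is a
large multiple of `(d log (1 / ε) + log (t / δ)) / ε`, where `t` is the number of rounds. -/
lemma badTrain_le_exp (hH : PointwiseMeasurable A.H) (hE : IsERM A.H A.erm)
    (hd : vcDim A.H = A.d) (hst : hstar ∈ A.H) {α : ℝ} (hα0 : A.ε ≤ 110 * α) (hα1 : α ≤ 1)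
    (hν : mdErr A.D hstar ≤ 11 / 20 * α) (r : ℕ) :
    tapeMeasure A.D (A.badTrain hstar α r)
      ≤ ENNReal.ofReal (3 * Real.exp (-(10 * Real.log (mdlRounds k / A.deltaAt A.epochs)))) := by
  have hle := log_one_div_nonneg hε hε1
  obtain ⟨hΛ, -, -⟩ := log_rounds_div_deltaAt hε hε1 hδ hδ1 hs hds
  have hlog2 := Real.log_two_gt_d9
  have hα : 0 < α := by linarith
  have hm := (trainSize_bounds hε hε1 hδ hδ1 hs hds hC).1
  have hd0 : (0 : ℝ) ≤ A.d := Nat.cast_nonneg _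
  have hdl : (0 : ℝ) ≤ A.d * (1 + Real.log (1 / A.ε)) := by positivity
  have hαm : 90000 * (A.d * (1 + Real.log (1 / A.ε))
      + Real.log (mdlRounds k / A.deltaAt A.epochs))
      ≤ α * A.trainSize A.ε (A.deltaAt A.epochs) := by
    have := mul_le_mul_of_nonneg_right hα0
      (Nat.cast_nonneg (A.trainSize A.ε (A.deltaAt A.epochs)) : (0 : ℝ) ≤ _)
    linarith
  refine (badTrain_le hH hE hd hst hα hα1 hν (by linarith) r).trans (ENNReal.ofReal_le_ofReal ?_)
  set Λ := Real.log (mdlRounds k / A.deltaAt A.epochs)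
  set m := A.trainSize A.ε (A.deltaAt A.epochs)
  have hpow : (1000 / α) ^ A.d ≤ Real.exp (12 * (A.d * (1 + Real.log (1 / A.ε)))) := by
    have h1 : 1000 / α ≤ Real.exp (12 * (1 + Real.log (1 / A.ε))) := by
      have h2 : 1000 / α ≤ 110000 * (1 / A.ε) := by
        rw [mul_one_div, div_le_div_iff₀ hα hε]
        linarith
      have h3 : (110000 : ℝ) ≤ Real.exp 12 := by
        have h4 : (2.7 : ℝ) ≤ Real.exp 1 := by linarith [Real.exp_one_gt_d9]
        calc (110000 : ℝ) ≤ 2.7 ^ 12 := by norm_num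
          _ ≤ Real.exp 1 ^ 12 := pow_le_pow_left₀ (by norm_num) h4 _
          _ = Real.exp 12 := by rw [← Real.exp_nat_mul]; norm_num
      calc 1000 / α ≤ 110000 * (1 / A.ε) := h2
        _ ≤ Real.exp 12 * Real.exp (Real.log (1 / A.ε)) := by
            rw [Real.exp_log (by positivity)]
            gcongr
        _ = Real.exp (12 + Real.log (1 / A.ε)) := by rw [Real.exp_add]
        _ ≤ _ := Real.exp_le_exp.2 (by linarith)
    calc (1000 / α) ^ A.d ≤ Real.exp (12 * (1 + Real.log (1 / A.ε))) ^ A.d :=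
          pow_le_pow_left₀ (by positivity) h1 _
      _ = _ := by rw [← Real.exp_nat_mul]; ring_nf
  have h1 : Real.exp (-(α * m) / 1000) ≤ Real.exp (-(10 * Λ)) :=
    Real.exp_le_exp.2 (by linarith)
  have h2 : (1000 / α) ^ A.d * Real.exp (-(α * m) / 200) ≤ Real.exp (-(10 * Λ)) := by
    calc _ ≤ Real.exp (12 * (A.d * (1 + Real.log (1 / A.ε)))) * Real.exp (-(α * m) / 200) := by
          gcongr
      _ = Real.exp (12 * (A.d * (1 + Real.log (1 / A.ε))) + -(α * m) / 200) :=
          (Real.exp_add _ _).symm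
      _ ≤ _ := Real.exp_le_exp.2 (by linarith)
  linarith

lemma badMDL_le (hH : PointwiseMeasurable A.H) (hE : IsERM A.H A.erm)
    (hd : vcDim A.H = A.d) (hst : hstar ∈ A.H) {α : ℝ} (hα0 : A.ε ≤ 110 * α) (hα1 : α ≤ 1)
    (hν : mdErr A.D hstar ≤ 11 / 20 * α) :
    tapeMeasure A.D (A.badMDL hstar α A.labelBound) ≤ ENNReal.ofReal (A.deltaAt A.epochs) := by
  have hk := one_le_cast_of_neZero (k := k)
  have ht := one_le_mdlRounds (k := k)
  obtain ⟨hΛ, hM, -⟩ := log_rounds_div_deltaAt hε hε1 hδ hδ1 hs hds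
  have hlog2 := Real.log_two_gt_d9
  have hlk := Real.log_nonneg hk
  have he : (1 : ℝ) ≤ A.epochs := by exact_mod_cast (epochs_pos : 1 ≤ A.epochs)
  have hd0 : 0 < A.deltaAt A.epochs := by unfold deltaAt; positivity
  have h1 := badTrain_le_exp hε hε1 hδ hδ1 hs hds hC hH hE hd hst hα0 hα1 hν
  have h2 := badTrainLabels_le hH hE (trainSize_bounds hε hε1 hδ hδ1 hs hds hC).2
  have h3 := badTestLabels_le hH (testSize_bounds hε hε1 hδ hδ1 hs hds hC).2
  have h4 := badTest_le hH hE hε (A := A)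
  have h5 := exp_labelBound_le hε hε1 hδ hδ1 hs hds
  have h6 : Real.exp (-(A.ε * A.testSize A.ε (A.deltaAt A.epochs)) / 1250)
      ≤ Real.exp (-(10 * Real.log (mdlRounds k / A.deltaAt A.epochs))) / k := by
    have h7 := (testSize_bounds hε hε1 hδ hδ1 hs hds hC).1
    calc _ ≤ Real.exp (-(10 * Real.log (mdlRounds k / A.deltaAt A.epochs)) - Real.log k) :=
          Real.exp_le_exp.2 (by rw [hM] at h7; linarith)
      _ = _ := by rw [Real.exp_sub, Real.exp_log (by positivity)]
  set u := Real.exp (-(10 * Real.log (mdlRounds k / A.deltaAt A.epochs))) with hu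
  have hu0 : 0 < u := Real.exp_pos _
  have hround : ∀ r, tapeMeasure A.D ((A.badTrain hstar α r ∪ ⋃ i, A.badTest r i) ∪
      (A.badTrainLabels A.labelBound r ∪ A.badTestLabels A.labelBound r))
      ≤ ENNReal.ofReal (6 * u) := by
    intro r
    have h8 : tapeMeasure A.D (⋃ i, A.badTest r i) ≤ ENNReal.ofReal u := by
      calc _ ≤ ∑ i, tapeMeasure A.D (A.badTest r i) := measure_iUnion_fintype_le _ _
        _ ≤ ∑ _i : Fin k, ENNReal.ofReal (u / k) :=
            Finset.sum_le_sum fun i _ => (h4 r i).trans (ENNReal.ofReal_le_ofReal h6)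
        _ = ENNReal.ofReal u := by
            rw [Finset.sum_const, Finset.card_univ, Fintype.card_fin,
              ← ENNReal.ofReal_nsmul, nsmul_eq_mul]
            congr 1
            field_simp
    have h9 := ENNReal.ofReal_le_ofReal h5
    calc _ ≤ (ENNReal.ofReal (3 * u) + ENNReal.ofReal u) + (ENNReal.ofReal u + ENNReal.ofReal u) :=
          (measure_union_le _ _).trans (add_le_add
            ((measure_union_le _ _).trans (add_le_add (h1 r) h8))
            ((measure_union_le _ _).trans (add_le_add ((h2 r).trans h9) ((h3 r).trans h9))))
      _ = ENNReal.ofReal (6 * u) := by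
          rw [← ENNReal.ofReal_add (by positivity) hu0.le, ← ENNReal.ofReal_add hu0.le hu0.le,
            ← ENNReal.ofReal_add (by positivity) (by positivity)]
          congr 1
          ring
  have hu1 : 6 * u ≤ A.deltaAt A.epochs / mdlRounds k := by
    have e1 : A.deltaAt A.epochs / mdlRounds k
        = Real.exp (-Real.log (mdlRounds k / A.deltaAt A.epochs)) := by
      rw [← Real.log_inv, Real.exp_log (by positivity), inv_div]
    have e2 : (6 : ℝ) ≤ Real.exp (9 * Real.log 2) := by
      rw [show (9 : ℝ) = (9 : ℕ) by norm_num, Real.exp_nat_mul, Real.exp_log (by norm_num)]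
      norm_num
    rw [e1]
    calc 6 * u ≤ Real.exp (9 * Real.log 2) * u := by gcongr
      _ = Real.exp (9 * Real.log 2 + -(10 * Real.log (mdlRounds k / A.deltaAt A.epochs))) := by
          rw [Real.exp_add]
      _ ≤ _ := Real.exp_le_exp.2 (by linarith)
  calc tapeMeasure A.D (A.badMDL hstar α A.labelBound)
      ≤ ∑ r ∈ Finset.range (mdlRounds k), tapeMeasure A.D
        ((A.badTrain hstar α r ∪ ⋃ i, A.badTest r i) ∪
        (A.badTrainLabels A.labelBound r ∪ A.badTestLabels A.labelBound r)) :=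
        measure_biUnion_finset_le _ _
    _ ≤ ∑ _r ∈ Finset.range (mdlRounds k),
        ENNReal.ofReal (A.deltaAt A.epochs / mdlRounds k) :=
        Finset.sum_le_sum fun r _ => (hround r).trans (ENNReal.ofReal_le_ofReal hu1)
    _ = ENNReal.ofReal (A.deltaAt A.epochs) := by
        rw [Finset.sum_const, Finset.card_range, ← ENNReal.ofReal_nsmul, nsmul_eq_mul]
        congr 1
        field_simp

omit [∀ i, IsProbabilityMeasure (A.D i)] hC

/-- A bound on the labels queried in the calls to Passive-RPU-MDL. -/
lemma sum_rpuLabels_le :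
    ∑ n ∈ Finset.range (A.epochs - 1), ∑ r ∈ Finset.range (maxRounds k),
        1440 * (⌈Real.log (1 / A.roundDelta n r)⌉₊ : ℝ) * A.s
      ≤ 2 * 10 ^ 6 * (A.s * (1 + Real.log (1 / A.ε))) * logFactor k A.ε A.δ ^ 3 := by
  have hlk := Real.log_nonneg (one_le_cast_of_neZero (k := k))
  have hle := log_one_div_nonneg hε hε1
  obtain ⟨hQ, hkQ⟩ := one_le_logFactor (k := k) hε hε1 hδ hδ1
  have hep := epochs_le hs hds hε hε1
  set Q := logFactor k A.ε A.δ
  set ℓ := Real.log (1 / A.ε)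
  have hmax : (maxRounds k : ℝ) ≤ 11 * Q := by
    rw [maxRounds]
    push_cast
    linarith [Nat.floor_le (by positivity : 0 ≤ 10 * Real.log k)]
  have hL : ∀ n ∈ Finset.range (A.epochs - 1), ∀ r ∈ Finset.range (maxRounds k),
      (⌈Real.log (1 / A.roundDelta n r)⌉₊ : ℝ) ≤ 28 * Q := by
    intro n hn r hr
    rw [Finset.mem_range] at hn hr
    have hd := log_one_div_deltaAt_le hε hε1 hδ hδ1 hs hds (n := n + 1) (by omega) (by omega)
    have hd0 : 0 < A.deltaAt (n + 1) := by unfold deltaAt; positivity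
    have h1 : Real.log (1 / A.roundDelta n r)
        = Real.log 2 + 2 * Real.log ((r : ℝ) + 1) + Real.log (1 / A.deltaAt (n + 1)) := by
      rw [roundDelta, one_div_div, div_eq_mul_one_div, Real.log_mul (by positivity) (by positivity),
        Real.log_mul (by norm_num) (by positivity), Real.log_pow]
      push_cast
      ring
    have h2 := Real.log_le_sub_one_of_pos (by positivity : (0 : ℝ) < (r : ℝ) + 1)
    have h3 : (r : ℝ) + 1 ≤ maxRounds k := by exact_mod_cast hr
    have h4 := Real.log_two_lt_d9
    have h5 : Real.log (1 / A.roundDelta n r) ≤ 27 * Q := by linarith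
    have h6 : (⌈Real.log (1 / A.roundDelta n r)⌉₊ : ℝ) ≤ ⌈27 * Q⌉₊ := by
      exact_mod_cast Nat.ceil_mono h5
    linarith [(Nat.ceil_lt_add_one (by positivity : 0 ≤ 27 * Q)).le]
  have hn : ((A.epochs - 1 : ℕ) : ℝ) ≤ 4 * Q * (1 + ℓ) := by
    have h1 : ((A.epochs - 1 : ℕ) : ℝ) ≤ A.epochs := by exact_mod_cast Nat.sub_le _ _
    refine (h1.trans hep).trans ?_
    gcongr
    linarith
  calc _ ≤ ∑ n ∈ Finset.range (A.epochs - 1), ∑ r ∈ Finset.range (maxRounds k),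
        1440 * (28 * Q) * A.s := by
        refine Finset.sum_le_sum fun n hn => Finset.sum_le_sum fun r hr => ?_
        have := hL n hn r hr
        gcongr
    _ = ((A.epochs - 1 : ℕ) : ℝ) * (maxRounds k * (1440 * (28 * Q) * A.s)) := by
        simp only [Finset.sum_const, Finset.card_range, nsmul_eq_mul]
    _ ≤ (4 * Q * (1 + ℓ)) * ((11 * Q) * (1440 * (28 * Q) * A.s)) := by gcongr
    _ = 1774080 * (A.s * (1 + ℓ)) * Q ^ 3 := by ring
    _ ≤ _ := by
        gcongr
        norm_num

include hC

/-- A bound on the labels queried in the call to Passive-MDL. -/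
lemma mdlLabels_le :
    mdlRounds k * (6 * A.labelBound)
      ≤ 27 * 10 ^ 9 * (A.s * (1 + Real.log (1 / A.ε))) * logFactor k A.ε A.δ ^ 3 := by
  have hle := log_one_div_nonneg hε hε1
  obtain ⟨hQ, -⟩ := one_le_logFactor (k := k) hε hε1 hδ hδ1
  have h1 := labelBound_le hε hε1 hδ hδ1 hs hds
  have h2 := mdlRounds_le (k := k) hε hε1 hδ hδ1
  have h0 : 0 ≤ A.labelBound := by
    have hb0 : (0 : ℝ) < epsAt (A.epochs - 1) := by unfold epsAt; positivity
    exact le_trans (by positivity) (testSize_bounds hε hε1 hδ hδ1 hs hds hC).2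
  set Q := logFactor k A.ε A.δ
  set ℓ := Real.log (1 / A.ε)
  calc _ ≤ 8 * Q * (6 * (56 * 10 ^ 7 * A.s * (1 + ℓ) * Q)) := by gcongr
    _ = 2688 * 10 ^ 7 * (A.s * (1 + ℓ)) * Q ^ 2 := by ring
    _ ≤ 27 * 10 ^ 9 * (A.s * (1 + ℓ)) * Q ^ 3 :=
        mul_le_mul (mul_le_mul_of_nonneg_right (by norm_num) (by positivity))
          (pow_le_pow_right₀ hQ (by norm_num)) (by positivity) (by positivity)

end Total

section Main

variable {X : Type*} [MeasurableSpace X] {k : ℕ} [NeZero k] {A : Setup X k}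
  [∀ i, IsProbabilityMeasure (A.D i)] {hstar : X → Bool}

omit [∀ i, IsProbabilityMeasure (A.D i)] in
lemma labelsMDL_le {α B : ℝ} {ω : Tape X k} (hω : ω ∉ A.badMDL hstar α B)
    (habs : ∀ i, (A.D i).fst {x | A.finalRPU ω x = none}
      ≤ ENNReal.ofReal (epsAt (A.epochs - 1))) :
    (A.labelsMDL (A.rpuAt ω (A.epochs - 1)) A.ε (A.deltaAt A.epochs)
      (fun r j => ω (Slot.train r j)) (fun r i j => ω (Slot.test r i j)) : ℝ)
      ≤ mdlRounds k * (6 * B) := by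
  have e : A.labelsMDL (A.rpuAt ω (A.epochs - 1)) A.ε (A.deltaAt A.epochs)
      (fun r j => ω (Slot.train r j)) (fun r i j => ω (Slot.test r i j))
      = ∑ r ∈ Finset.range (mdlRounds k), (A.trainLabelsAt ω r + A.testLabelsAt ω r) := rfl
  rw [e, Nat.cast_sum]
  calc _ ≤ ∑ _r ∈ Finset.range (mdlRounds k), 6 * B := by
        refine Finset.sum_le_sum fun r hr => ?_
        have h1 : (A.trainLabelsAt ω r : ℝ) < 3 * B := by
          refine not_le.1 fun h => hω (Set.mem_biUnion hr (Or.inr (Or.inl ⟨habs, h⟩)))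
        have h2 : (A.testLabelsAt ω r : ℝ) < 3 * B := by
          refine not_le.1 fun h => hω (Set.mem_biUnion hr (Or.inr (Or.inr ⟨habs, h⟩)))
        push_cast
        linarith
    _ = _ := by rw [Finset.sum_const, Finset.card_range, nsmul_eq_mul]

/-- The failure events of all epochs together are unlikely, and outside of them the run terminates
with a good output after few label queries. -/
lemma run_spec (hH : PointwiseMeasurable A.H) (hE : IsERM A.H A.erm) (hst : hstar ∈ A.H)
    (hd : vcDim A.H = A.d) (hs : 1 ≤ A.s) (hstarno : starNumber A.H hstar ≤ A.s)
    (hε : 0 < A.ε) (hε1 : A.ε < 1) (hδ : 0 < A.δ) (hδ1 : A.δ < 1)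
    (hν : 100 * ((k : ℝ) + A.d) * mdErr A.D hstar ≤ A.ε) (hc : A.c = 2) (hC : A.C = 10 ^ 7) :
    tapeMeasure A.D {ω | ¬ (A.Terminates ω ∧ mdErr A.D (A.output ω) ≤ mdErr A.D hstar + A.ε ∧
      (A.labels ω : ℝ) ≤ 3 * 10 ^ 10 * (A.s * (1 + Real.log (1 / A.ε)))
        * logFactor k A.ε A.δ ^ 3)} ≤ ENNReal.ofReal A.δ := by
  have hk := one_le_cast_of_neZero (k := k)
  have hds : A.d ≤ A.s := vcDim_le_of_starNumber_le hd hstarno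
  have hν0 : 0 ≤ mdErr A.D hstar := mdErr_nonneg hstar
  -- the error allowed on the mixtures; for `k = 1` the noise is only known to be at most `ε / 100`
  obtain ⟨α, hα0, hα1, hα55, hα110, hνα⟩ : ∃ α : ℝ, A.ε ≤ 110 * α ∧ α ≤ 1 ∧ 55 * α ≤ A.ε ∧
      (k ≠ 1 → 110 * α ≤ A.ε) ∧ mdErr A.D hstar ≤ 11 / 20 * α := by
    have hdν : 0 ≤ (A.d : ℝ) * mdErr A.D hstar := by positivity
    by_cases hk1 : k = 1
    · refine ⟨A.ε / 55, by linarith, by linarith, by linarith, fun h => absurd hk1 h, ?_⟩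
      nlinarith
    · have hk2 : (2 : ℝ) ≤ k := by
        have := NeZero.ne k
        exact_mod_cast (by omega : 2 ≤ k)
      refine ⟨A.ε / 110, by linarith, by linarith, by linarith, fun _ => by linarith, ?_⟩
      nlinarith
  have hnoise : ∀ n, n + 1 < A.epochs → 4 * A.s * 2 ^ (n + 1) * mdErr A.D hstar ≤ 1 / 25 := by
    intro n hn
    have h1 := two_pow_lt_of_lt_epochs hs hε hn
    have h2 := mul_le_mul_of_nonneg_right h1.le hν0
    have h3 : A.ε * (4 * A.s * 2 ^ (n + 1) * mdErr A.D hstar) ≤ A.ε * (1 / 25) := by nlinarith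
    exact le_of_mul_le_mul_left h3 hε
  set bad := (⋃ n ∈ Finset.range (A.epochs - 1), A.badEpoch hstar n) ∪
    A.badMDL hstar α A.labelBound with hbad
  have hgood : ∀ ω, ω ∉ bad → A.Terminates ω ∧
      mdErr A.D (A.output ω) ≤ mdErr A.D hstar + A.ε ∧
      (A.labels ω : ℝ) ≤ 3 * 10 ^ 10 * (A.s * (1 + Real.log (1 / A.ε)))
        * logFactor k A.ε A.δ ^ 3 := by
    intro ω hω
    have hω1 : ∀ n < A.epochs - 1, ω ∉ A.badEpoch hstar n := fun n hn h =>
      hω (Or.inl (Set.mem_biUnion (Finset.mem_range.2 hn) h))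
    have hω2 : ω ∉ A.badMDL hstar α A.labelBound := fun h => hω (Or.inr h)
    have hspec : ∀ n ≤ A.epochs - 1, Reliable hstar (A.rpuAt ω n) ∧
        ∀ i, (A.D i).fst {x | A.rpuAt ω n x = none} ≤ ENNReal.ofReal (epsAt n) :=
      fun n hn => rpuAt_spec hH hst fun n' hn' => hω1 n' (by omega)
    refine ⟨fun n hn => ?_, ?_, ?_⟩
    · exact ⟨_, actAt_rounds hH (hω1 n (by omega)) (hspec n (by omega)).1⟩
    · refine mdErr_output_le hH hE hε (by linarith) hα55 hα110 (hspec _ le_rfl).1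
        (fun r hr h => hω2 ?_) (fun r hr i h => hω2 ?_)
      · exact Set.mem_biUnion (Finset.mem_range.2 hr) (Or.inl (Or.inl h))
      · exact Set.mem_biUnion (Finset.mem_range.2 hr)
          (Or.inl (Or.inr (Set.mem_iUnion.2 ⟨i, h⟩)))
    · have h1 := labelsMDL_le hω2 (hspec _ le_rfl).2
      have h2 : ∀ n ∈ Finset.range (A.epochs - 1), (A.labelsRPU (A.rpuAt ω n) (epsAt (n + 1))
          (A.deltaAt (n + 1)) (seedsAt ω (n + 1)) : ℝ) ≤ ∑ r ∈ Finset.range (maxRounds k),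
          1440 * (⌈Real.log (1 / A.roundDelta n r)⌉₊ : ℝ) * A.s := by
        intro n hn
        rw [Finset.mem_range] at hn
        refine labelsRPU_le hH (hω1 n hn) (hspec n hn.le).1 fun i => ?_
        rw [show 2 * epsAt (n + 1) = epsAt n by unfold epsAt; rw [pow_succ]; ring]
        exact (hspec n hn.le).2 i
      have h3 := sum_rpuLabels_le hε hε1 hδ hδ1 hs hds
      have h4 := mdlLabels_le hε hε1 hδ hδ1 hs hds hC
      have h5 := Finset.sum_le_sum h2
      have h6 : 0 ≤ (A.s * (1 + Real.log (1 / A.ε))) * logFactor k A.ε A.δ ^ 3 := by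
        have h7 := log_one_div_nonneg hε hε1
        have h8 := (one_le_logFactor (k := k) hε hε1 hδ hδ1).1
        positivity
      rw [labels]
      push_cast
      linarith
  refine (measure_mono (t := bad) ?_).trans ?_
  · intro ω hω
    by_contra h
    exact hω (hgood ω h)
  calc tapeMeasure A.D bad
      ≤ ∑ n ∈ Finset.range (A.epochs - 1), tapeMeasure A.D (A.badEpoch hstar n)
        + tapeMeasure A.D (A.badMDL hstar α A.labelBound) :=
        (measure_union_le _ _).trans (add_le_add_left (measure_biUnion_finset_le _ _) _)
    _ ≤ ∑ n ∈ Finset.range (A.epochs - 1), ENNReal.ofReal (A.deltaAt (n + 1))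
        + ENNReal.ofReal (A.deltaAt (A.epochs - 1 + 1)) := by
        refine add_le_add (Finset.sum_le_sum fun n hn => ?_) ?_
        · exact badEpoch_le hH hst hstarno hc hs hδ hδ1
            (hnoise n (by rw [Finset.mem_range] at hn; omega))
        · rw [Nat.sub_add_cancel epochs_pos]
          exact badMDL_le hε hε1 hδ hδ1 hs hds hC hH hE hd hst hα0 hα1 hνα
    _ = ENNReal.ofReal (∑ n ∈ Finset.range (A.epochs - 1 + 1), A.deltaAt (n + 1)) := by
        rw [← Finset.sum_range_succ (fun n => ENNReal.ofReal (A.deltaAt (n + 1))),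
          ENNReal.ofReal_sum_of_nonneg fun n _ => by unfold deltaAt; positivity]
    _ ≤ ENNReal.ofReal A.δ := by
        refine ENNReal.ofReal_le_ofReal ?_
        have h1 := mul_le_mul_of_nonneg_left (sum_inv_sq_le (A.epochs - 1 + 1)) hδ.le
        rw [Finset.mul_sum] at h1
        calc _ = ∑ n ∈ Finset.range (A.epochs - 1 + 1), A.δ * (1 / (2 * ((n : ℝ) + 1) ^ 2)) := by
              refine Finset.sum_congr rfl fun n _ => ?_
              rw [deltaAt, mul_one_div]
              push_cast
              rfl
          _ ≤ _ := h1
          _ ≤ A.δ := by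
              have : (0 : ℝ) ≤ 1 / (((A.epochs - 1 + 1 : ℕ) : ℝ) + 1) := by positivity
              nlinarith

end Main

end Setup

end

end ActiveMDL

end

theorem mainTheorem6 :
    ∃ c > (0 : ℝ), ∃ C > (0 : ℝ), ∃ K > (0 : ℝ), ∃ p : ℕ,
    ∀ (X : Type*) [MeasurableSpace X] (H : Set (X → Bool)), ActiveMDL.PointwiseMeasurable H →
    ∀ (erm : (m : ℕ) → (Fin m → X × Bool) → X → Bool), ActiveMDL.IsERM H erm →
    ∀ (k : ℕ) [NeZero k] (D : Fin k → Measure (X × Bool)) [∀ i, IsProbabilityMeasure (D i)]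
      (hstar : X → Bool), hstar ∈ H →
      (∀ h ∈ H, ActiveMDL.mdErr D hstar ≤ ActiveMDL.mdErr D h) →
    ∀ (d s : ℕ), ActiveMDL.vcDim H = d → 1 ≤ s → ActiveMDL.starNumber H hstar ≤ s →
    ∀ (ε δ : ℝ), 0 < ε → ε < 1 → 0 < δ → δ < 1 →
      100 * ((k : ℝ) + d) * ActiveMDL.mdErr D hstar ≤ ε →
    ∀ A : ActiveMDL.Setup X k,
      A = { H := H, erm := erm, D := D, s := s, d := d, ε := ε, δ := δ, c := c, C := C } →
      ActiveMDL.tapeMeasure D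
        {ω | ¬ (A.Terminates ω ∧
          ActiveMDL.mdErr D (A.output ω) ≤ ActiveMDL.mdErr D hstar + ε ∧
          (A.labels ω : ℝ) ≤ K * (s * (1 + Real.log (1 / ε))) *
            (1 + Real.log k + Real.log (1 / δ) + Real.log (1 + Real.log (1 / ε))) ^ p)}
        ≤ ENNReal.ofReal δ := by
  refine ⟨2, by norm_num, 10 ^ 7, by norm_num, 3 * 10 ^ 10, by norm_num, 3, ?_⟩
  intro X _ H hH erm hE k _ D hD hstar hst _ d s hd hs hstarno ε δ hε hε1 hδ hδ1 hν A hA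
  subst hA
  have : ∀ i, IsProbabilityMeasure
      ((⟨H, erm, D, s, d, ε, δ, 2, 10 ^ 7⟩ : ActiveMDL.Setup X k).D i) := hD
  exact ActiveMDL.Setup.run_spec (A := ⟨H, erm, D, s, d, ε, δ, 2, 10 ^ 7⟩) hH hE hst hd hs
    hstarno hε hε1 hδ hδ1 hν rfl rfl
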